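/- Let $G=(\mathbb C^4,*)$ be the complex solvable Lie group (a semidirect product of $\mathbb C$ with the complex Heisenberg group) with multiplication $$y*z=\Big(z_1+y_1,\; e^{-y_1}z_2+y_2,\; e^{y_1}z_3+y_3,\; z_4+y_4+\tfrac12e^{y_1}y_2z_3-\tfrac12e^{-y_1}y_3z_2\Big),$$ with the left-invariant holomorphic coframe $$\varphi^1=dz_1,\quad \varphi^2=e^{z_1}dz_2,\quad \varphi^3=e^{-z_1}dz_3,\quad \varphi^4=dz_4-\tfrac12 z_2\,dz_3+\tfrac12 z_3\,dz_2$$ and dual frame $Z_1,\dots,Z_4$. Let $\Gamma\subset G$ be a lattice (a discrete subgroup with compact quotient $\Gamma\backslash G$) with $e^{\gamma_1-\overline{\gamma_1}}=1$ for all $\gamma\in\Gamma$; this holds for the lattice $\Gamma_\pi$ that defines $M_\pi=\Gamma_\pi\backslash G$. Write $M=\Gamma\backslash G$. On $M$ consider the $(0,1)$-forms $\widetilde\varphi^{\bar1}=\overline{\varphi^1}$, $\widetilde\varphi^{\bar2}=e^{z_1-\bar z_1}\overline{\varphi^2}$, $\widetilde\varphi^{\bar3}=e^{\bar z_1-z_1}\overline{\varphi^3}$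 and, for $t=(t_{i\lambda})\in\mathbb C^{12}$ ($1\le i\le4$, $1\le\lambda\le3$), the $(0,1)$-vector form $$\psi(t)=\sum_{\lambda=1}^3\sum_{i=1}^4t_{i\lambda}\,\widetilde\varphi^{\bar\lambda}\otimes Z_i+(-t_{22}t_{33}+t_{12}t_{43}+t_{13}t_{42}+t_{23}t_{32})\,\overline{\varphi^4}\otimes Z_4 .$$ For $t$ near $0$ let $J_t$ be the almost complex structure on $M$ with $(1,0)$-coframe $\varphi^j_t=\varphi^j+\psi(t)\lrcorner\,\varphi^j$, $j=1,\dots,4$. Consider the equations $$\begin{aligned}&t_{11}t_{12}=t_{11}t_{13}=t_{12}t_{21}=t_{21}t_{13}-2t_{11}t_{23}=2t_{11}t_{32}-t_{31}t_{12}=t_{13}t_{31}=t_{12}t_{13}=t_{12}t_{23}=t_{13}t_{32}\\&\quad=t_{11}t_{42}+t_{21}t_{32}-t_{31}t_{22}=t_{21}t_{33}-t_{11}t_{43}-t_{31}t_{23}=0\end{aligned}\qquad(\ast)$$ and the four classes of parameters (i) $t_{11}\ne0$, $t_{12}=t_{13}=t_{32}=t_{23}=0$, $t_{11}t_{42}=t_{31}t_{22}$,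 $t_{11}t_{43}=t_{21}t_{33}$; (ii) $t_{11}=t_{12}=t_{13}=0$, $t_{21}t_{32}=t_{31}t_{22}$, $t_{21}t_{33}=t_{31}t_{23}$; (iii) $t_{12}\ne0$, $t_{11}=t_{21}=t_{31}=t_{13}=t_{23}=0$; (iv) $t_{13}\neq0$, $t_{11}=t_{12}=t_{21}=t_{31}=t_{32}=0$. Then the solution set of $(\ast)$ is the disjoint union of the classes (i)–(iv), and there is $\varepsilon>0$ such that for every $t$ with $\max_{i,\lambda}|t_{i\lambda}|<\varepsilon$: 1. $J_t$ is an integrable complex structure on $M$ if and only if $t$ satisfies $(\ast)$; 2. if $t$ is in class (i) or (ii), then $(M,J_t)$ admits no SKT metric, that is, no Hermitian metric whose fundamental form $\omega$ satisfies $\partial_t\overline\partial_t\,\omega=0$; 3. if $t$ is in class (i), then $(M,J_t)$ admits no astheno-Kähler metric, that is, no Hermitian metric whose fundamental form $\omega$ satisfies $\partial_t\overline\partial_t\,\omega^{2}=0$. -/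

import Mathlib

open Complex
open scoped ContDiff ComplexConjugate

noncomputable section

/-! ### Types of complex-valued forms, `∂` and `∂bar` of an almost complex structure -/

section Forms

variable {V : Type*} [NormedAddCommGroup V] [NormedSpace ℝ V]

/-- The `(p, q)`-component of a complex-valued real-multilinear alternating `k`-form `α`
(with `p + q = k`) on a real vector space with complex structure `J`.

The endomorphism `exp (θ J) = cos θ + sin θ J` acts as `exp (iθ)` on vectors of type `(1, 0)` and
as `exp (-iθ)` on vectors of type `(0, 1)`; so pull-back by it multiplies the `(p, q)`-component by
`exp (i (p - q) θ)`. The weights `p - q` occurring in degree `k` lie in `[-k, k]`, hence are distinct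
modulo `2k + 1`, and the component is extracted by averaging over the `(2k+1)`-st roots of unity. -/
def typeComponent (J : V →L[ℝ] V) (p q : ℕ) {k : ℕ} (α : V [⋀^Fin k]→L[ℝ] ℂ) :
    V [⋀^Fin k]→L[ℝ] ℂ :=
  ((2 * k + 1 : ℂ)⁻¹) • ∑ m : Fin (2 * k + 1),
    Complex.exp (-(((p : ℂ) - q) * (2 * Real.pi * m / (2 * k + 1)) * I)) •
      α.compContinuousLinearMap
        (Real.cos (2 * Real.pi * m / (2 * k + 1)) • ContinuousLinearMap.id ℝ V +
          Real.sin (2 * Real.pi * m / (2 * k + 1)) • J)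

/-- `∂` on forms of type `(p, q)`: the `(p + 1, q)`-component of the exterior derivative. -/
def del (J : V → V →L[ℝ] V) (p q : ℕ) {k : ℕ} (α : V → V [⋀^Fin k]→L[ℝ] ℂ) :
    V → V [⋀^Fin (k + 1)]→L[ℝ] ℂ :=
  fun x => typeComponent (J x) (p + 1) q (extDeriv α x)

/-- `∂bar` on forms of type `(p, q)`: the `(p, q + 1)`-component of the exterior derivative. -/
def delBar (J : V → V →L[ℝ] V) (p q : ℕ) {k : ℕ} (α : V → V [⋀^Fin k]→L[ℝ] ℂ) :
    V → V [⋀^Fin (k + 1)]→L[ℝ] ℂ :=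
  fun x => typeComponent (J x) p (q + 1) (extDeriv α x)

/-- The multilinear map `(v₁, …, v_{k+l}) ↦ α (v₁, …, v_k) β (v_{k+1}, …, v_{k+l})`. -/
def mulForms {k l : ℕ} (α : V [⋀^Fin k]→L[ℝ] ℂ) (β : V [⋀^Fin l]→L[ℝ] ℂ) :
    ContinuousMultilinearMap ℝ (fun _ : Fin (k + l) => V) ℂ :=
  (ContinuousMultilinearMap.uncurrySum
    ((ContinuousLinearMap.toSpanSingleton ℂ β.toContinuousMultilinearMap).restrictScalars
      ℝ |>.compContinuousMultilinearMap α.toContinuousMultilinearMap)).domDomCongr finSumFinEquiv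

theorem mulForms_apply {k l : ℕ} (α : V [⋀^Fin k]→L[ℝ] ℂ) (β : V [⋀^Fin l]→L[ℝ] ℂ)
    (v : Fin (k + l) → V) :
    mulForms α β v = α (fun i => v (Fin.castAdd l i)) * β (fun i => v (Fin.natAdd k i)) := by
  simp [mulForms, Function.comp_def]

/-- The wedge product, with the usual normalisation
`(α ∧ β)(v) = 1 / (k! l!) ∑_σ sgn σ α (v_{σ 1}, …) β (v_{σ (k+1)}, …)`. -/
def wedge {k l : ℕ} (α : V [⋀^Fin k]→L[ℝ] ℂ) (β : V [⋀^Fin l]→L[ℝ] ℂ) :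
    V [⋀^Fin (k + l)]→L[ℝ] ℂ :=
  ((k.factorial * l.factorial : ℝ)⁻¹) • (mulForms α β).alternatization

end Forms

/-! ### The solvable group `G = (ℂ⁴, *)` -/

/-- The manifold `ℂ⁴` underlying the group. It carries the additive normed structure of `ℂ⁴`
(for calculus) and the multiplication `*` defined below. -/
def SolvGroup : Type := Fin 4 → ℂ

namespace SolvGroup

instance : NormedAddCommGroup SolvGroup := inferInstanceAs (NormedAddCommGroup (Fin 4 → ℂ))
instance : NormedSpace ℂ SolvGroup := inferInstanceAs (NormedSpace ℂ (Fin 4 → ℂ))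
instance : NormedSpace ℝ SolvGroup := inferInstanceAs (NormedSpace ℝ (Fin 4 → ℂ))

instance : Mul SolvGroup where
  mul y z := ![z 0 + y 0,
    exp (-y 0) * z 1 + y 1,
    exp (y 0) * z 2 + y 2,
    z 3 + y 3 + 1 / 2 * exp (y 0) * y 1 * z 2 - 1 / 2 * exp (-y 0) * y 2 * z 1]

instance : One SolvGroup where
  one := fun _ => 0

instance : Inv SolvGroup where
  inv y := ![-y 0, -(exp (y 0) * y 1), -(exp (-y 0) * y 2), -y 3]

theorem mul_zero_coord (y z : SolvGroup) : (y * z) 0 = z 0 + y 0 := rfl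

theorem mul_one_coord (y z : SolvGroup) : (y * z) 1 = exp (-y 0) * z 1 + y 1 := rfl

theorem mul_two_coord (y z : SolvGroup) : (y * z) 2 = exp (y 0) * z 2 + y 2 := rfl

theorem mul_three_coord (y z : SolvGroup) : (y * z) 3 =
    z 3 + y 3 + 1 / 2 * exp (y 0) * y 1 * z 2 - 1 / 2 * exp (-y 0) * y 2 * z 1 := rfl

theorem one_coord (i : Fin 4) : (1 : SolvGroup) i = 0 := rfl

theorem inv_zero_coord (y : SolvGroup) : y⁻¹ 0 = -y 0 := rfl

theorem inv_one_coord (y : SolvGroup) : y⁻¹ 1 = -(exp (y 0) * y 1) := rfl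

theorem inv_two_coord (y : SolvGroup) : y⁻¹ 2 = -(exp (-y 0) * y 2) := rfl

theorem inv_three_coord (y : SolvGroup) : y⁻¹ 3 = -y 3 := rfl

theorem ext_coord {y z : SolvGroup} (h0 : y 0 = z 0) (h1 : y 1 = z 1) (h2 : y 2 = z 2)
    (h3 : y 3 = z 3) : y = z := by
  funext i
  fin_cases i
  exacts [h0, h1, h2, h3]

instance : Group SolvGroup :=
  Group.ofLeftAxioms
    (by
      intro a b c
      have h := exp_ne_zero (a 0)
      have h' := exp_ne_zero (b 0)
      apply ext_coord <;>
        simp only [mul_zero_coord, mul_one_coord, mul_two_coord, mul_three_coord, neg_add,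
          exp_add, exp_neg]
      · ring
      all_goals field_simp; ring)
    (by
      intro a
      apply ext_coord <;>
        simp [mul_zero_coord, mul_one_coord, mul_two_coord, mul_three_coord, one_coord])
    (by
      intro a
      have h := exp_ne_zero (a 0)
      apply ext_coord <;>
        simp only [mul_zero_coord, mul_one_coord, mul_two_coord, mul_three_coord, one_coord,
          inv_zero_coord, inv_one_coord, inv_two_coord, inv_three_coord, neg_neg, exp_neg] <;>
        field_simp <;> ring_nf)

/-- The coordinate form `dz_{i+1}` (coordinates are numbered from `0` in the code). -/
def dz (i : Fin 4) : SolvGroup →L[ℝ] ℂ :=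
  (ContinuousLinearMap.proj (R := ℝ) (φ := fun _ : Fin 4 => ℂ) i)

/-- The complex conjugate of a complex-valued `1`-form. -/
def conjForm (α : SolvGroup →L[ℝ] ℂ) : SolvGroup →L[ℝ] ℂ :=
  (conjCLE : ℂ →L[ℝ] ℂ) ∘L α

/-- The left-invariant holomorphic coframe `φ¹ = dz₁`, `φ² = e^{z₁} dz₂`, `φ³ = e^{-z₁} dz₃`,
`φ⁴ = dz₄ - z₂ dz₃ / 2 + z₃ dz₂ / 2`. -/
def coframe (z : SolvGroup) : Fin 4 → SolvGroup →L[ℝ] ℂ :=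
  ![dz 0, exp (z 0) • dz 1, exp (-z 0) • dz 2, dz 3 - (z 1 / 2) • dz 2 + (z 2 / 2) • dz 1]

/-- The `(0,1)`-forms `conj φ¹`, `e^{z₁ - conj z₁} conj φ²`, `e^{conj z₁ - z₁} conj φ³`. -/
def dolbeaultForm (z : SolvGroup) : Fin 3 → SolvGroup →L[ℝ] ℂ :=
  ![conjForm (coframe z 0), exp (z 0 - conj (z 0)) • conjForm (coframe z 1),
    exp (conj (z 0) - z 0) • conjForm (coframe z 2)]

/-! ### The family of deformations -/

/-- The parameter space: `t i l` is the parameter `t_{i+1, l+1}`. -/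
abbrev Param : Type := Fin 4 → Fin 3 → ℂ

/-- The component `ψ^j(t)` of the `(0,1)`-vector form `ψ(t) = ∑_j ψ^j(t) ⊗ Z_j`, where `Z_j` is the
frame dual to the coframe. -/
def psi (t : Param) (z : SolvGroup) (j : Fin 4) : SolvGroup →L[ℝ] ℂ :=
  ∑ l : Fin 3, t j l • dolbeaultForm z l +
    if j = 3 then
      (-(t 1 1 * t 2 2) + t 0 1 * t 3 2 + t 0 2 * t 3 1 + t 1 2 * t 2 1) • conjForm (coframe z 3)
    else 0

/-- The deformed `(1,0)`-coframe `φ^j_t = φ^j + ψ(t) ⌟ φ^j`, assembled into a real-linear map from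
the tangent space to `ℂ⁴`. -/
def deformedCoframe (t : Param) (z : SolvGroup) : SolvGroup →L[ℝ] (Fin 4 → ℂ) :=
  ContinuousLinearMap.pi fun j => coframe z j + psi t z j

/-- The deformed almost complex structure `J_t`, for which the `φ^j_t` are of type `(1,0)`, that is,
`φ^j_t ∘ J_t = i φ^j_t` (a junk value when the `φ^j_t` do not form a coframe). -/
def deformedJ (t : Param) (z : SolvGroup) : SolvGroup →L[ℝ] SolvGroup :=
  (deformedCoframe t z).inverse ∘L (I • deformedCoframe t z)

/-- The equations on the parameters that cut out the Kuranishi space. -/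
def KuranishiEquations (t : Param) : Prop :=
  t 0 0 * t 0 1 = 0 ∧ t 0 0 * t 0 2 = 0 ∧ t 0 1 * t 1 0 = 0 ∧
  t 1 0 * t 0 2 - 2 * t 0 0 * t 1 2 = 0 ∧ 2 * t 0 0 * t 2 1 - t 2 0 * t 0 1 = 0 ∧
  t 0 2 * t 2 0 = 0 ∧ t 0 1 * t 0 2 = 0 ∧ t 0 1 * t 1 2 = 0 ∧ t 0 2 * t 2 1 = 0 ∧
  t 0 0 * t 3 1 + t 1 0 * t 2 1 - t 2 0 * t 1 1 = 0 ∧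
  t 1 0 * t 2 2 - t 0 0 * t 3 2 - t 2 0 * t 1 2 = 0

/-- The four classes (i), (ii), (iii), (iv) of parameters (numbered `0, 1, 2, 3` in the code). -/
def DeformationClass : Fin 4 → Param → Prop :=
  ![fun t => t 0 0 ≠ 0 ∧ t 0 1 = 0 ∧ t 0 2 = 0 ∧ t 2 1 = 0 ∧ t 1 2 = 0 ∧
      t 0 0 * t 3 1 = t 2 0 * t 1 1 ∧ t 0 0 * t 3 2 = t 1 0 * t 2 2,
    fun t => t 0 0 = 0 ∧ t 0 1 = 0 ∧ t 0 2 = 0 ∧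
      t 1 0 * t 2 1 = t 2 0 * t 1 1 ∧ t 1 0 * t 2 2 = t 2 0 * t 1 2,
    fun t => t 0 1 ≠ 0 ∧ t 0 0 = 0 ∧ t 1 0 = 0 ∧ t 2 0 = 0 ∧ t 0 2 = 0 ∧ t 1 2 = 0,
    fun t => t 0 2 ≠ 0 ∧ t 0 0 = 0 ∧ t 0 1 = 0 ∧ t 1 0 = 0 ∧ t 2 0 = 0 ∧ t 2 1 = 0]

/-! ### The quotient `M = Γ \ G` and the geometric structures on it

For a discrete subgroup `Γ` acting by left translations, `G → Γ \ G` is a smooth covering map, and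
tensor fields on `Γ \ G` are the same thing as `Γ`-invariant tensor fields on `G`; this is how
complex structures and metrics on `Γ \ G` are encoded below. -/

/-- The differential at `z` of the left translation by `γ`. -/
def leftDiff (γ z : SolvGroup) : SolvGroup →L[ℝ] SolvGroup :=
  fderiv ℝ (fun w : SolvGroup => γ * w) z

/-- `Γ` is a lattice in `G`: it is discrete and the quotient `Γ \ G` is compact. -/
structure IsLattice (Γ : Subgroup SolvGroup) : Prop where
  discrete : DiscreteTopology Γ
  cocompact : CompactSpace (MulAction.orbitRel.Quotient Γ SolvGroup)

/-- `J` is (the lift to `G` of) a smooth integrable complex structure on `Γ \ G`. Integrability: the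
exterior derivative of a `(1,0)`-form has no component of type `(0,2)`. -/
structure IsComplexStructure (Γ : Subgroup SolvGroup) (J : SolvGroup → SolvGroup →L[ℝ] SolvGroup) :
    Prop where
  smooth : ContDiff ℝ ∞ J
  sq : ∀ z v, J z (J z v) = -v
  invariant : ∀ γ ∈ Γ, ∀ z v, J (γ * z) (leftDiff γ z v) = leftDiff γ z (J z v)
  integrable : ∀ α : SolvGroup → SolvGroup [⋀^Fin 1]→L[ℝ] ℂ, ContDiff ℝ ∞ α →
    (∀ z, typeComponent (J z) 1 0 (α z) = α z) →
    ∀ z, typeComponent (J z) 0 2 (extDeriv α z) = 0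

/-- A (smooth) Hermitian metric on `(Γ \ G, J)`. -/
structure HermitianMetric (Γ : Subgroup SolvGroup)
    (J : SolvGroup → SolvGroup →L[ℝ] SolvGroup) where
  /-- the Riemannian metric -/
  g : SolvGroup → SolvGroup →L[ℝ] SolvGroup →L[ℝ] ℝ
  smooth : ContDiff ℝ ∞ g
  symm : ∀ z v w, g z v w = g z w v
  pos : ∀ z v, v ≠ 0 → 0 < g z v v
  compatible : ∀ z v w, g z (J z v) (J z w) = g z v w
  invariant : ∀ γ ∈ Γ, ∀ z v w, g (γ * z) (leftDiff γ z v) (leftDiff γ z w) = g z v w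

namespace HermitianMetric

variable {Γ : Subgroup SolvGroup} {J : SolvGroup → SolvGroup →L[ℝ] SolvGroup}

/-- The bilinear form `(v, w) ↦ g (J v, w)`, with values regarded as complex numbers and `w`
regarded as the argument of a `1`-form. -/
def preFundamental (h : HermitianMetric Γ J) (z : SolvGroup) :
    SolvGroup →L[ℝ] SolvGroup [⋀^Fin 1]→L[ℝ] ℂ :=
  (ContinuousAlternatingMap.ofSubsingletonLIE (𝕜 := ℝ) (E := SolvGroup) (F := ℂ)
    (0 : Fin 1)).toContinuousLinearEquiv.toContinuousLinearMap ∘L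
    (ContinuousLinearMap.compL ℝ SolvGroup ℝ ℂ ofRealCLM) ∘L h.g z ∘L J z

/-- The fundamental form `ω (v, w) = g (J v, w)`, as a complex-valued `2`-form. It is defined by
skew-symmetrisation; see `fundamentalForm_apply`. -/
def fundamentalForm (h : HermitianMetric Γ J) (z : SolvGroup) : SolvGroup [⋀^Fin 2]→L[ℝ] ℂ :=
  (1 / 2 : ℝ) • ContinuousAlternatingMap.alternatizeUncurryFin (h.preFundamental z)

theorem fundamentalForm_apply (hJ : ∀ z v, J z (J z v) = -v) (h : HermitianMetric Γ J)
    (z v w : SolvGroup) : h.fundamentalForm z ![v, w] = (h.g z (J z v) w : ℂ) := by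
  have key : h.g z (J z w) v = -h.g z (J z v) w := by
    rw [← h.compatible z (J z w) v, hJ, h.symm z (J z v) w]; simp
  simp [fundamentalForm, preFundamental, ContinuousAlternatingMap.alternatizeUncurryFin_apply,
    Fin.sum_univ_two, Fin.removeNth, key]
  ring

/-- Strong Kähler with torsion (pluriclosed): `∂ ∂bar ω = 0`. -/
def IsSKT (h : HermitianMetric Γ J) : Prop :=
  ∀ z, del J 1 2 (delBar J 1 1 h.fundamentalForm) z = 0

/-- Astheno-Kähler: `∂ ∂bar ω^{n-2} = 0`, where `n = 4` is the complex dimension. -/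
def IsAsthenoKahler (h : HermitianMetric Γ J) : Prop :=
  ∀ z, del J 2 3 (delBar J 2 2
    (fun y => wedge (h.fundamentalForm y) (h.fundamentalForm y))) z = 0

end HermitianMetric

end SolvGroup

end

/-!
The numbering of coordinates in these comments is the usual one, `z_1, …, z_4` and `t_{11}, …,
t_{43}`; in the code it starts at `0`.

*Classes and integrability.* The decomposition of the solution set of the equations is elementary,
by cases on which of `t_{11}`, `t_{12}`, `t_{13}` is non-zero. In the coframe formed by the `φ^j`
and the forms `g_l` of the Dolbeault coframe all structure constants are constant, so the
`(0,2)`-part of `dφ_t^j` has constant coefficients in the forms `g_l ∧ g_m`. These coefficients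
are, up to non-zero constants, the left-hand sides of the Kuranishi equations (`torsion_eq`). The
coefficient of `conj φ⁴ ⊗ Z₄` is what makes the `g_2 ∧ g_3` component of `dφ_t^4` vanish. The
deformed coframe is `Γ`-invariant because `e^{γ_1 - conj γ_1} = 1`, so the almost complex
structure descends to the quotient.

*Non-existence of metrics.* Instead of Stokes' theorem on the compact quotient, the proof uses averages
over large regions of a complex vector space. By cocompactness the coefficients of a `Γ`-invariant
form in the deformed coframe are bounded on `G` (`IsInvariant.exists_bound`), and positive ones are
bounded below. Pull-back along a holomorphic map from a vector space `E` to `(G, J_t)` commutes with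
`∂` and `∂bar`, and for a `(p,p)`-form `η` on `E` the equation `∂∂bar η = 0` says `d (J dη) = 0`
(`alternatization_snd_deriv_eq_zero`). Integrated against cut-off functions at scale `R`, derivatives
of bounded functions contribute a factor `1/R`, and so disappear in comparison with the integral of a
function that is bounded below.

* SKT (`not_isSKT`): both classes have `t_{12} = t_{13} = 0`, and then the fibre `z_1 = 0` is a
  complex submanifold, which `ℂ² × ℂ` parametrises holomorphically (`fibreMap`). There `d (J dη)`,
  evaluated on a left-invariant frame, is a sum of divergences and of the squared length of the
  central vector times a constant built from the brackets of the frame. For small `t` that constant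
  is non-zero, as the bracket of the Heisenberg group is.
* Astheno-Kähler (`not_isAsthenoKahler`): for `t_{11} ≠ 0` there is a holomorphic leaf, parametrised
  by `ℂ × ℂ²` (`leafMap`), on which `e^{2 Re z_1}` times the restriction of `ω²` to the last two
  directions is comparable to a constant. After averaging over these two directions, `d (J dη) = 0`
  leaves only the Laplacian in the first one of a function comparable to `e^{-ℓ}`, where
  `ℓ = 2 Re z_1` is a non-zero linear form. Integration by parts moves it to the test function
  `e^ℓ`, whose Laplacian is a positive multiple of `e^ℓ`: a contradiction.
-/

noncomputable section

/-! ### Types of forms -/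

section TypeDecomposition

variable {V : Type*} [NormedAddCommGroup V] [NormedSpace ℝ V]

/-- The endomorphism `exp (θ J) = cos θ + sin θ J`. -/
def typeRotation (J : V →L[ℝ] V) (θ : ℝ) : V →L[ℝ] V :=
  Real.cos θ • ContinuousLinearMap.id ℝ V + Real.sin θ • J

theorem typeRotation_apply (J : V →L[ℝ] V) (θ : ℝ) (v : V) :
    typeRotation J θ v = Real.cos θ • v + Real.sin θ • J v := by
  simp [typeRotation]

/-- The sum of the `n`-th powers of the `N`-th roots of unity vanishes unless `N` divides `n`. -/
theorem sum_exp_eq_zero {N : ℕ} (hN : 0 < N) (n : ℤ) (hn : ¬ (N : ℤ) ∣ n) :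
    ∑ m : Fin N, exp (n * ((2 * Real.pi * (m : ℕ) / N : ℂ) * I)) = 0 := by
  have hN' : (N : ℂ) ≠ 0 := by exact_mod_cast hN.ne'
  set z : ℂ := exp (n * ((2 * Real.pi / N : ℂ) * I)) with hz
  have h1 : ∀ m : ℕ, exp (n * ((2 * Real.pi * m / N : ℂ) * I)) = z ^ m := by
    intro m
    rw [hz, ← exp_nat_mul]
    congr 1
    ring
  have hz1 : z ≠ 1 := by
    intro h
    rw [hz, exp_eq_one_iff] at h
    obtain ⟨k, hk⟩ := h
    apply hn
    refine ⟨k, ?_⟩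
    have hpi : (2 * Real.pi * I : ℂ) ≠ 0 := two_pi_I_ne_zero
    have : (n : ℂ) * (2 * Real.pi * I) = (N * k : ℂ) * (2 * Real.pi * I) := by
      field_simp at hk
      linear_combination hk * (2 * Real.pi * I)
    have := mul_right_cancel₀ hpi this
    exact_mod_cast this
  have hzN : z ^ N = 1 := by
    rw [← h1 N, exp_eq_one_iff]
    refine ⟨n, ?_⟩
    field_simp
  simp_rw [h1]
  rw [Fin.sum_univ_eq_sum_range (fun m => z ^ m)]
  have := mul_neg_geom_sum z N
  rw [hzN, sub_self] at this
  rcases mul_eq_zero.1 this with h | h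
  · exact absurd (sub_eq_zero.1 h).symm hz1
  · exact h

theorem typeComponent_apply (J : V →L[ℝ] V) (p q : ℕ) {k : ℕ} (α : V [⋀^Fin k]→L[ℝ] ℂ)
    (v : Fin k → V) :
    typeComponent J p q α v = (2 * k + 1 : ℂ)⁻¹ * ∑ m : Fin (2 * k + 1),
      exp (-(((p : ℂ) - q) * (2 * Real.pi * m / (2 * k + 1)) * I)) *
        α (fun i => typeRotation J (2 * Real.pi * m / (2 * k + 1)) (v i)) := by
  simp [typeComponent, typeRotation, Function.comp_def]

theorem typeComponent_compContinuousLinearMap {W : Type*} [NormedAddCommGroup W] [NormedSpace ℝ W]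
    (J : V →L[ℝ] V) (J' : W →L[ℝ] W) (A : W →L[ℝ] V) (hA : ∀ w, J (A w) = A (J' w))
    (p q : ℕ) {k : ℕ} (α : V [⋀^Fin k]→L[ℝ] ℂ) :
    typeComponent J' p q (α.compContinuousLinearMap A) =
      (typeComponent J p q α).compContinuousLinearMap A := by
  ext v
  simp only [typeComponent_apply, ContinuousAlternatingMap.compContinuousLinearMap_apply,
    Function.comp_def, typeRotation_apply, map_add, map_smul, hA]

/-- If the pull-back of `α` by `exp (θ J)`, weighted as in the `(p, q)`-component, rotates like
`e^{-iσθ} (cos θ P + sin θ Q)` with `σ = ± 1`, then that component is `(P - iσQ) / 2`. -/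
theorem typeComponent_apply_of_typeRotation (J : V →L[ℝ] V) (p q : ℕ) {k : ℕ} (hk : k ≠ 0)
    (α : V [⋀^Fin k]→L[ℝ] ℂ) (v : Fin k → V) (P Q : ℂ) (σ : ℤ) (hσ : σ = 1 ∨ σ = -1)
    (h : ∀ θ : ℝ, exp (-(((p : ℂ) - q) * θ * I)) * α (fun i => typeRotation J θ (v i)) =
      exp (-(σ * θ * I)) * (Real.cos θ * P + Real.sin θ * Q)) :
    typeComponent J p q α v = (P - σ * I * Q) / 2 := by
  have hN : 0 < 2 * k + 1 := by omega
  have hNC : (2 * k + 1 : ℂ) ≠ 0 := by exact_mod_cast hN.ne'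
  have hdiv : ¬ ((2 * k + 1 : ℕ) : ℤ) ∣ (-2 * σ) := by
    intro hd
    have h2 := Int.natAbs_dvd_natAbs.2 hd
    have h3 : (-2 * σ).natAbs = 2 := by rcases hσ with rfl | rfl <;> rfl
    rw [h3] at h2
    have := Nat.le_of_dvd (by norm_num) h2
    simp only [Int.natAbs_natCast] at this
    omega
  have hs := sum_exp_eq_zero hN (-2 * σ) hdiv
  rw [typeComponent_apply]
  have hterm : ∀ m : Fin (2 * k + 1),
      exp (-(((p : ℂ) - q) * (2 * Real.pi * m / (2 * k + 1)) * I)) *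
        α (fun i => typeRotation J (2 * Real.pi * m / (2 * k + 1)) (v i)) =
      (P - σ * I * Q) / 2 + (P + σ * I * Q) / 2 *
        exp (((-2 * σ : ℤ) : ℂ) * ((2 * Real.pi * (m : ℕ) / (2 * k + 1 : ℕ) : ℂ) * I)) := by
    intro m
    have h1 := h (2 * Real.pi * m / (2 * k + 1))
    set θ : ℝ := 2 * Real.pi * m / (2 * k + 1) with hθ
    have hθc : (2 * Real.pi * m / (2 * k + 1) : ℂ) = (θ : ℂ) := by rw [hθ]; push_cast; rfl
    have hθc' : (2 * Real.pi * (m : ℕ) / (2 * k + 1 : ℕ) : ℂ) = (θ : ℂ) := by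
      rw [hθ]; push_cast; rfl
    rw [hθc, hθc', h1]
    push_cast
    rw [Complex.cos, Complex.sin]
    have e1 : exp (-(σ * θ * I)) * exp (σ * θ * I) = 1 := by rw [← exp_add]; simp
    have e2 : exp (-2 * σ * (θ * I)) = exp (-(σ * θ * I)) * exp (-(σ * θ * I)) := by
      rw [← exp_add]; congr 1; ring
    rw [e2]
    rcases hσ with rfl | rfl
    · simp only [Int.cast_one, one_mul, neg_mul] at *
      linear_combination (P / 2 - I * Q / 2) * e1
    · simp only [Int.cast_neg, Int.cast_one, neg_mul, one_mul, neg_neg] at *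
      linear_combination (P / 2 + I * Q / 2) * e1
  rw [Finset.sum_congr rfl fun m _ => hterm m, Finset.sum_add_distrib, ← Finset.mul_sum, hs]
  simp
  field_simp

/-- The `(1,0)`-component of a complex-valued `1`-form. -/
theorem typeComponent_one_zero_apply (J : V →L[ℝ] V) (α : V [⋀^Fin 1]→L[ℝ] ℂ) (v : V) :
    typeComponent J 1 0 α (fun _ => v) = (α (fun _ => v) - I * α (fun _ => J v)) / 2 := by
  have := typeComponent_apply_of_typeRotation J 1 0 one_ne_zero α (fun _ => v) (α (fun _ => v))
    (α (fun _ => J v)) 1 (Or.inl rfl) (fun θ => by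
      have h1 : α (fun _ => typeRotation J θ v) = Real.cos θ * α (fun _ => v)
          + Real.sin θ * α (fun _ => J v) := by
        have hα : ∀ w : V, α (fun _ => w) =
            (ContinuousAlternatingMap.ofSubsingleton ℝ V ℂ (0 : Fin 1)).symm α w := by
          intro w; simp [ContinuousAlternatingMap.ofSubsingleton]
        rw [hα, hα, hα, typeRotation_apply, map_add, map_smul, map_smul]
        simp
      rw [h1]
      simp)
  rw [this]
  simp

/-- A `1`-form is of type `(1,0)` exactly when it is complex linear for `J`. -/
theorem typeComponent_one_zero_eq_self_iff (J : V →L[ℝ] V)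
    (α : V [⋀^Fin 1]→L[ℝ] ℂ) :
    typeComponent J 1 0 α = α ↔ ∀ v, α (fun _ => J v) = I * α (fun _ => v) := by
  constructor
  · intro h v
    have h1 := typeComponent_one_zero_apply J α v
    rw [h] at h1
    linear_combination (-2 * I) * h1 + α (fun _ => J v) * I_sq
  · intro h
    ext v
    have hv : v = fun _ => v 0 := by
      funext i
      rw [Subsingleton.elim i 0]
    rw [hv, typeComponent_one_zero_apply, h]
    linear_combination (-1 / 2 * α fun _ => v 0) * I_sq

section TwoForms

variable (α : V [⋀^Fin 2]→L[ℝ] ℂ)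

theorem twoForm_add_left (u v w : V) : α ![u + v, w] = α ![u, w] + α ![v, w] :=
  α.map_vecCons_add _ _ _

theorem twoForm_smul_left (c : ℝ) (v w : V) : α ![c • v, w] = c • α ![v, w] :=
  α.map_vecCons_smul _ _ _

theorem twoForm_swap (v w : V) : α ![v, w] = -α ![w, v] := by
  have h : α (![w, v] ∘ Equiv.swap 0 1) = -α ![w, v] :=
    α.map_swap ![w, v] (show (0 : Fin 2) ≠ 1 by decide)
  rw [← h]
  congr 1
  funext i
  fin_cases i <;> simp

theorem twoForm_add_right (u v w : V) : α ![u, v + w] = α ![u, v] + α ![u, w] := by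
  rw [twoForm_swap α u, twoForm_swap α u v, twoForm_swap α u w, twoForm_add_left]
  ring

theorem twoForm_smul_right (c : ℝ) (v w : V) : α ![v, c • w] = c • α ![v, w] := by
  rw [twoForm_swap α v, twoForm_swap α v w, twoForm_smul_left, smul_neg]

/-- The `(0,2)`-component of a complex-valued `2`-form. -/
theorem typeComponent_zero_two_apply (J : V →L[ℝ] V) (v w : V) :
    typeComponent J 0 2 α ![v, w] =
      (α ![v, w] - α ![J v, J w] + I * α ![J v, w] + I * α ![v, J w]) / 4 := by
  have hs2 := sum_exp_eq_zero (N := 5) (by norm_num) 2 (by decide)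
  have hs4 := sum_exp_eq_zero (N := 5) (by norm_num) 4 (by decide)
  -- the average over `2 k + 1 = 5` rotations kills the components of the other types, whose
  -- rotation speeds relative to type `(0,2)` are `2` and `4`
  rw [typeComponent_apply]
  set A := α ![v, w]
  set B := α ![J v, w] + α ![v, J w] with hB
  set C := α ![J v, J w]
  have hterm : ∀ m : Fin (2 * 2 + 1),
      exp (-((((0 : ℕ) : ℂ) - (2 : ℕ)) * (2 * Real.pi * m / (2 * (2 : ℕ) + 1)) * I)) *
        α (fun i => typeRotation J (2 * Real.pi * m / (2 * (2 : ℕ) + 1)) (![v, w] i)) =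
      (A - C + I * B) / 4 +
        (A + C) / 2 * exp ((2 : ℤ) * ((2 * Real.pi * (m : ℕ) / (5 : ℕ) : ℂ) * I)) +
        (A - C - I * B) / 4 * exp ((4 : ℤ) * ((2 * Real.pi * (m : ℕ) / (5 : ℕ) : ℂ) * I)) := by
    intro m
    set θ : ℝ := 2 * Real.pi * m / (2 * (2 : ℕ) + 1) with hθ
    have hθc : (2 * Real.pi * m / (2 * (2 : ℕ) + 1) : ℂ) = (θ : ℂ) := by
      rw [hθ]; push_cast; rfl
    have hθc' : (2 * Real.pi * (m : ℕ) / (5 : ℕ) : ℂ) = (θ : ℂ) := by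
      rw [hθ]; push_cast; norm_num
    rw [hθc, hθc']
    have hv : (fun i => typeRotation J θ (![v, w] i)) =
        ![Real.cos θ • v + Real.sin θ • J v, Real.cos θ • w + Real.sin θ • J w] := by
      funext i
      fin_cases i <;> simp [typeRotation_apply]
    rw [hv]
    simp only [twoForm_add_left, twoForm_add_right, twoForm_smul_left, twoForm_smul_right,
      real_smul]
    push_cast
    have e0 : exp (-((0 - 2) * (θ : ℂ) * I)) = exp (θ * I) * exp (θ * I) := by
      rw [← exp_add]; congr 1; ring
    have e2 : exp (2 * ((θ : ℂ) * I)) = exp (θ * I) * exp (θ * I) := by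
      rw [← exp_add]; congr 1; ring
    have e4 : exp (4 * ((θ : ℂ) * I)) = exp (θ * I) * exp (θ * I) * exp (θ * I) * exp (θ * I) := by
      simp only [← exp_add]; congr 1; ring
    have e5 : exp (θ * I) * exp (-(θ : ℂ) * I) = 1 := by rw [← exp_add]; simp
    have hc : exp (θ * I) * Complex.cos θ = (exp (θ * I) * exp (θ * I) + 1) / 2 := by
      rw [Complex.cos]; linear_combination e5 / 2
    have hs : exp (θ * I) * Complex.sin θ = (1 - exp (θ * I) * exp (θ * I)) * I / 2 := by
      rw [Complex.sin]; linear_combination e5 * I / 2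
    rw [e0, e2, e4]
    generalize exp ((θ : ℂ) * I) = x at *
    generalize Complex.cos (θ : ℂ) = c at *
    generalize Complex.sin (θ : ℂ) = s at *
    calc _ = (x * c) ^ 2 * A + (x * c) * (x * s) * B + (x * s) ^ 2 * C := by rw [hB]; ring
      _ = _ := by
        rw [hc, hs]
        linear_combination (1 - x * x) ^ 2 / 4 * C * I_sq
  rw [Finset.sum_congr rfl fun m _ => hterm m, Finset.sum_add_distrib, Finset.sum_add_distrib,
    ← Finset.mul_sum, ← Finset.mul_sum]
  rw [show (∑ m : Fin (2 * 2 + 1), exp ((2 : ℤ) * ((2 * Real.pi * (m : ℕ) / (5 : ℕ) : ℂ) * I))) = 0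
    from hs2, show (∑ m : Fin (2 * 2 + 1),
      exp ((4 : ℤ) * ((2 * Real.pi * (m : ℕ) / (5 : ℕ) : ℂ) * I))) = 0 from hs4]
  simp only [Finset.sum_const, Finset.card_univ, Fintype.card_fin, hB]
  simp
  ring

end TwoForms

/-! ### `∂∂bar` for a constant complex structure -/

section ConstantStructure

open ContinuousAlternatingMap

variable {k : ℕ}

theorem alternatizeUncurryFin_compContinuousLinearMap (T : V →L[ℝ] V [⋀^Fin k]→L[ℝ] ℂ)
    (A : V →L[ℝ] V) (v : Fin (k + 1) → V) :
    alternatizeUncurryFin T (fun i => A (v i)) =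
      ∑ i : Fin (k + 1), (-1) ^ (i : ℕ) • T (A (v i)) (fun j => A (i.removeNth v j)) := by
  rw [alternatizeUncurryFin_apply]
  rfl

/-- The form `β` has weight `r`: it is multiplied by `e^{-irθ}` by pull-back along `exp (θ J)`. Forms
of type `(p, q)` have weight `q - p`. -/
def HasWeight (J : V →L[ℝ] V) (r : ℤ) (β : V [⋀^Fin k]→L[ℝ] ℂ) : Prop :=
  ∀ (θ : ℝ) (v : Fin k → V), β (fun i => typeRotation J θ (v i)) = exp (-(r * θ * I)) * β v

/-- Here and below `T` plays the role of the derivative of a field of forms of weight `r`, so that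
`alternatizeUncurryFin T` is its exterior derivative. -/
theorem alternatizeUncurryFin_typeRotation (J : V →L[ℝ] V) (r : ℤ)
    (T : V →L[ℝ] V [⋀^Fin k]→L[ℝ] ℂ) (hT : ∀ u, HasWeight J r (T u)) (θ : ℝ)
    (v : Fin (k + 1) → V) :
    alternatizeUncurryFin T (fun i => typeRotation J θ (v i)) = exp (-(r * θ * I)) *
      (Real.cos θ * alternatizeUncurryFin T v + Real.sin θ * alternatizeUncurryFin (T ∘L J) v) := by
  rw [alternatizeUncurryFin_compContinuousLinearMap, alternatizeUncurryFin_apply,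
    alternatizeUncurryFin_apply, Finset.mul_sum, Finset.mul_sum, ← Finset.sum_add_distrib,
    Finset.mul_sum]
  refine Finset.sum_congr rfl fun i _ => ?_
  rw [hT, typeRotation_apply]
  simp
  ring

/-- The exterior derivative of a form of weight `r` has components of weights `r - 1` and `r + 1`
only, given by the two projections `(1 ∓ iJ) / 2` applied to the direction of differentiation. -/
theorem typeComponent_alternatizeUncurryFin (J : V →L[ℝ] V) (p q : ℕ) (r σ : ℤ)
    (hσ : σ = 1 ∨ σ = -1) (hpq : (p : ℤ) - q + r = σ)
    (T : V →L[ℝ] V [⋀^Fin k]→L[ℝ] ℂ) (hT : ∀ u, HasWeight J r (T u)) :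
    typeComponent J p q (alternatizeUncurryFin T) =
      (1 / 2 : ℂ) • alternatizeUncurryFin T -
        (σ * I / 2 : ℂ) • alternatizeUncurryFin (T ∘L J) := by
  ext v
  rw [typeComponent_apply_of_typeRotation J p q k.succ_ne_zero _ v (alternatizeUncurryFin T v)
    (alternatizeUncurryFin (T ∘L J) v) σ hσ]
  · simp
    ring
  · intro θ
    rw [alternatizeUncurryFin_typeRotation J r T hT, ← mul_assoc, ← exp_add]
    congr 2
    rw [← hpq]
    push_cast
    ring

theorem hasWeight_delBar {J : V →L[ℝ] V} (hJ : ∀ v, J (J v) = -v)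
    (T : V →L[ℝ] V [⋀^Fin k]→L[ℝ] ℂ) (hT : ∀ u, HasWeight J 0 (T u)) :
    HasWeight J 1 ((1 / 2 : ℂ) • alternatizeUncurryFin T +
        (I / 2 : ℂ) • alternatizeUncurryFin (T ∘L J)) := by
  intro θ v
  have hJJ : alternatizeUncurryFin ((T ∘L J) ∘L J) v = -alternatizeUncurryFin T v := by
    simp [alternatizeUncurryFin_apply, hJ]
  have h1 := alternatizeUncurryFin_typeRotation J 0 T hT θ v
  have h2 := alternatizeUncurryFin_typeRotation J 0 (T ∘L J) (fun u => hT (J u)) θ v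
  rw [hJJ] at h2
  simp only [ContinuousAlternatingMap.add_apply, ContinuousAlternatingMap.smul_apply, smul_eq_mul,
    h1, h2]
  have he : exp (-(((1 : ℤ) : ℂ) * θ * I)) = Complex.cos θ - Complex.sin θ * I := by
    rw [show (-(((1 : ℤ) : ℂ) * θ * I)) = (-θ : ℂ) * I by push_cast; ring, exp_mul_I]
    simp
    ring
  rw [he]
  push_cast
  simp
  linear_combination (Complex.sin θ * alternatizeUncurryFin (T ∘L J) v / 2) * I_sq

theorem HasWeight.fderiv {J : V →L[ℝ] V} {r : ℤ} {β : V → V [⋀^Fin k]→L[ℝ] ℂ}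
    (hβ : Differentiable ℝ β) (hw : ∀ x, HasWeight J r (β x)) (x u : V) :
    HasWeight J r (fderiv ℝ β x u) := by
  intro θ v
  rw [← fderiv_continuousAlternatingMap_apply_const_apply (hβ x),
    ← fderiv_continuousAlternatingMap_apply_const_apply (hβ x)]
  have : (fun y => β y fun i => typeRotation J θ (v i)) =
      fun y => exp (-(r * θ * I)) * β y v := funext fun y => hw y θ v
  rw [this, fderiv_const_mul ((hβ x).continuousAlternatingMap_apply_const v)]
  simp

theorem hasFDerivAt_clm_comp {F G : Type*} [NormedAddCommGroup F] [NormedSpace ℝ F]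
    [NormedAddCommGroup G] [NormedSpace ℝ G] (L : F →L[ℝ] G) {f : V → F} {x : V}
    (hf : DifferentiableAt ℝ f x) : HasFDerivAt (fun y => L (f y)) (L ∘L _root_.fderiv ℝ f x) x :=
  L.hasFDerivAt.comp x hf.hasFDerivAt

/-- For a constant complex structure `J` on a vector space, `∂∂bar η = (i/2) d(Jdη)` on forms of
type `(p, p)`; hence if `∂∂bar η = 0`, then the twice alternated second derivative
`(u, v) ↦ D²η (u, J v)` vanishes. -/
theorem alternatization_snd_deriv_eq_zero {J : V →L[ℝ] V} (hJ : ∀ v, J (J v) = -v)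
    {η : V → V [⋀^Fin k]→L[ℝ] ℂ} (hη : ContDiff ℝ ∞ η) (hw : ∀ x, HasWeight J 0 (η x)) (p : ℕ)
    (h : ∀ x, del (fun _ => J) p (p + 1) (delBar (fun _ => J) p p η) x = 0) (x : V) :
    alternatizeUncurryFin (alternatizeUncurryFinCLM ℝ V ℂ ∘L
      (ContinuousLinearMap.compL ℝ V V (V [⋀^Fin k]→L[ℝ] ℂ)).flip J ∘L
        fderiv ℝ (fderiv ℝ η) x) = 0 := by
  set A := alternatizeUncurryFinCLM (n := k) ℝ V ℂ with hA
  set A' := alternatizeUncurryFinCLM (n := k + 1) ℝ V ℂ with hA'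
  set RJ := (ContinuousLinearMap.compL ℝ V V (V [⋀^Fin k]→L[ℝ] ℂ)).flip J with hRJ
  have hηd : Differentiable ℝ η := hη.differentiable (by simp)
  have hη1 : ContDiff ℝ ∞ (fderiv ℝ η) := hη.fderiv_right (by simp)
  have hη1d : Differentiable ℝ (fderiv ℝ η) := hη1.differentiable (by simp)
  have hw1 : ∀ x u, HasWeight J 0 (fderiv ℝ η x u) := HasWeight.fderiv hηd hw
  set B : (V →L[ℝ] V [⋀^Fin k]→L[ℝ] ℂ) →L[ℝ] V [⋀^Fin (k + 1)]→L[ℝ] ℂ :=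
    (1 / 2 : ℂ) • A + (I / 2 : ℂ) • (A ∘L RJ) with hB
  have hβ : delBar (fun _ => J) p p η = fun x => B (fderiv ℝ η x) := by
    funext y
    rw [delBar, extDeriv, typeComponent_alternatizeUncurryFin J p (p + 1) 0 (-1) (Or.inr rfl)
      (by push_cast; ring) _ (hw1 y)]
    rw [sub_eq_add_neg, ← neg_smul]
    simp [hB, hA, hRJ, neg_div]
  have hβw : ∀ y, HasWeight J 1 (B (fderiv ℝ η y)) := fun y => hasWeight_delBar hJ _ (hw1 y)
  have hβd : Differentiable ℝ fun y => B (fderiv ℝ η y) := fun y =>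
    (hasFDerivAt_clm_comp (F := V →L[ℝ] V [⋀^Fin k]→L[ℝ] ℂ) (G := V [⋀^Fin (k + 1)]→L[ℝ] ℂ) B
      (f := fderiv ℝ η) (hη1d y)).differentiableAt
  set D2 := fderiv ℝ (fderiv ℝ η) x with hD2
  have hDβ : fderiv ℝ (fun y => B (fderiv ℝ η y)) x = B ∘L D2 :=
    (hasFDerivAt_clm_comp (F := V →L[ℝ] V [⋀^Fin k]→L[ℝ] ℂ) (G := V [⋀^Fin (k + 1)]→L[ℝ] ℂ) B
      (f := fderiv ℝ η) (hη1d x)).fderiv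
  have hsymm : ∀ u v, D2 u v = D2 v u := by
    intro u v
    exact (hη.contDiffAt (x := x)).isSymmSndFDerivAt (by
      rw [minSmoothness_of_isRCLikeNormedField]; exact WithTop.coe_le_coe.2 le_top) u v
  have h0 := h x
  rw [hβ, del, extDeriv, typeComponent_alternatizeUncurryFin J (p + 1) (p + 1) 1 1 (Or.inl rfl)
      (by push_cast; ring) _ (fun u => HasWeight.fderiv hβd hβw x u), hDβ] at h0
  simp only [← alternatizeUncurryFinCLM_apply, ← hA'] at h0 ⊢
  have s1 : A' (A ∘L D2) = 0 :=
    alternatizeUncurryFin_alternatizeUncurryFinCLM_comp_of_symmetric hsymm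
  have s2 : A' (A ∘L (RJ ∘L D2 ∘L J)) = 0 := by
    apply alternatizeUncurryFin_alternatizeUncurryFinCLM_comp_of_symmetric
    intro u v
    simp [hRJ, hsymm (J u) (J v)]
  have s3 : A' (A ∘L (D2 ∘L J + RJ ∘L D2)) = 0 := by
    apply alternatizeUncurryFin_alternatizeUncurryFinCLM_comp_of_symmetric
    intro u v
    simp [hRJ, hsymm (J u) v, hsymm (J v) u, add_comm]
  have e1 : B ∘L D2 = (1 / 2 : ℂ) • (A ∘L D2) + (I / 2 : ℂ) • (A ∘L RJ ∘L D2) := by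
    ext; simp [hB]
  have e2 : (B ∘L D2) ∘L J = (1 / 2 : ℂ) • (A ∘L (D2 ∘L J)) +
      (I / 2 : ℂ) • (A ∘L (RJ ∘L D2 ∘L J)) := by
    ext; simp [hB]
  have lin : ∀ (c d : ℂ) (S T : V →L[ℝ] V [⋀^Fin (k + 1)]→L[ℝ] ℂ),
      A' (c • S + d • T) = c • A' S + d • A' T := by
    intro c d S T
    simp [hA']
  rw [ContinuousLinearMap.comp_add, map_add] at s3
  rw [e2, e1, lin, lin, s1, s2, eq_neg_of_add_eq_zero_left s3] at h0
  have h3 : (I / 2 : ℂ) • A' (A ∘L RJ ∘L D2) = 0 := by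
    rw [← h0]
    module
  exact (smul_eq_zero.1 h3).resolve_left (by simp)

/-- With the hypotheses of `alternatization_snd_deriv_eq_zero`, the form `J dη` is closed. -/
theorem extDeriv_extDeriv_comp_eq_zero {J : V →L[ℝ] V} (hJ : ∀ v, J (J v) = -v)
    {η : V → V [⋀^Fin k]→L[ℝ] ℂ} (hη : ContDiff ℝ ∞ η) (hw : ∀ x, HasWeight J 0 (η x)) (p : ℕ)
    (h : ∀ x, del (fun _ => J) p (p + 1) (delBar (fun _ => J) p p η) x = 0) (x : V) :
    extDeriv (fun y => (extDeriv η y).compContinuousLinearMap J) x = 0 := by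
  have hη1 : ContDiff ℝ ∞ (fderiv ℝ η) := hη.fderiv_right (by simp)
  have hη1d : Differentiable ℝ (fderiv ℝ η) := hη1.differentiable (by simp)
  have hw1 : ∀ x u, HasWeight J 0 (fderiv ℝ η x u) :=
    HasWeight.fderiv (hη.differentiable (by simp)) hw
  set L : (V →L[ℝ] V [⋀^Fin k]→L[ℝ] ℂ) →L[ℝ] V [⋀^Fin (k + 1)]→L[ℝ] ℂ :=
    alternatizeUncurryFinCLM ℝ V ℂ ∘L
      (ContinuousLinearMap.compL ℝ V V (V [⋀^Fin k]→L[ℝ] ℂ)).flip J with hL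
  have key : (fun y => (extDeriv η y).compContinuousLinearMap J) =
      fun y => L (fderiv ℝ η y) := by
    funext y
    ext v
    have := alternatizeUncurryFin_typeRotation J 0 (fderiv ℝ η y) (hw1 y) (Real.pi / 2) v
    simpa [typeRotation_apply, extDeriv, Function.comp_def, hL] using this
  have hd := (hasFDerivAt_clm_comp (F := V →L[ℝ] V [⋀^Fin k]→L[ℝ] ℂ)
    (G := V [⋀^Fin (k + 1)]→L[ℝ] ℂ) L (f := fderiv ℝ η) (hη1d x)).fderiv
  rw [key, extDeriv, hd, ← alternatization_snd_deriv_eq_zero hJ hη hw p h x]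
  rfl

end ConstantStructure

end TypeDecomposition

/-! ### Averages along exhausting families -/

section Averages

set_option linter.unusedSectionVars false

open MeasureTheory Filter Topology Module
open scoped Pointwise

variable {X Y : Type*} [NormedAddCommGroup X] [NormedSpace ℝ X] [FiniteDimensional ℝ X]
  [NormedAddCommGroup Y] [NormedSpace ℝ Y] [FiniteDimensional ℝ Y]

/-- A smooth cut-off function, equal to `1` on the unit ball and supported in the ball of
radius `2`. -/
def cutoff (X : Type*) [NormedAddCommGroup X] [NormedSpace ℝ X] [FiniteDimensional ℝ X] :
    X → ℝ :=
  (⟨1, 2, one_pos, one_lt_two⟩ : ContDiffBump (0 : X))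

theorem contDiff_cutoff : ContDiff ℝ ∞ (cutoff X) := ContDiffBump.contDiff _

theorem hasCompactSupport_cutoff : HasCompactSupport (cutoff X) := ContDiffBump.hasCompactSupport _

theorem cutoff_nonneg (x : X) : 0 ≤ cutoff X x := ContDiffBump.nonneg _

theorem cutoff_eq_one {x : X} (hx : ‖x‖ ≤ 1) : cutoff X x = 1 :=
  ContDiffBump.one_of_mem_closedBall _ (by simpa using hx)

theorem cutoff_eq_zero {x : X} (hx : 2 ≤ ‖x‖) : cutoff X x = 0 :=
  ContDiffBump.zero_of_le_dist _ (by simpa using hx)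

theorem integral_cutoff_pos [MeasurableSpace X] [BorelSpace X] (μ : Measure X)
    [μ.IsAddHaarMeasure] : 0 < ∫ x, cutoff X x ∂μ :=
  ContDiffBump.integral_pos _

/-- A test function of product type, where the second factor is stretched by `S`. -/
def testFunction (α : X → ℝ) (β : Y → ℝ) (S : ℝ) (z : X × Y) : ℝ := α z.1 * β (S⁻¹ • z.2)

theorem testFunction_contDiff {α : X → ℝ} {β : Y → ℝ} (hα : ContDiff ℝ ∞ α) (hβ : ContDiff ℝ ∞ β)
    (S : ℝ) : ContDiff ℝ ∞ (testFunction α β S) := by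
  unfold testFunction
  fun_prop

theorem hasCompactSupport_testFunction {α : X → ℝ} {β : Y → ℝ} (hα : HasCompactSupport α)
    (hβ : HasCompactSupport β) {S : ℝ} (hS : 0 < S) : HasCompactSupport (testFunction α β S) := by
  have hβ' : HasCompactSupport fun y => β (S⁻¹ • y) :=
    hβ.comp_homeomorph (Homeomorph.smulOfNeZero S⁻¹ (inv_ne_zero hS.ne'))
  refine HasCompactSupport.intro (hα.isCompact.prod hβ'.isCompact) fun z hz => ?_
  rw [Set.mem_prod, not_and_or] at hz
  unfold testFunction
  rcases hz with hz | hz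
  · rw [image_eq_zero_of_notMem_tsupport hz, zero_mul]
  · have : β (S⁻¹ • z.2) = 0 :=
      image_eq_zero_of_notMem_tsupport (f := fun y => β (S⁻¹ • y)) hz
    rw [this, mul_zero]

theorem fderiv_testFunction {α : X → ℝ} {β : Y → ℝ} (hα : ContDiff ℝ ∞ α) (hβ : ContDiff ℝ ∞ β)
    (S : ℝ) (u : X) (v : Y) :
    (fun z => fderiv ℝ (testFunction α β S) z (u, v)) = fun z =>
      testFunction (fun x => fderiv ℝ α x u) β S z +
        S⁻¹ * testFunction α (fun y => fderiv ℝ β y v) S z := by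
  funext z
  have h1 : HasFDerivAt (fun z : X × Y => α z.1)
      (fderiv ℝ α z.1 ∘L ContinuousLinearMap.fst ℝ X Y) z :=
    ((hα.differentiable (by simp)) z.1).hasFDerivAt.comp z hasFDerivAt_fst
  have h2 : HasFDerivAt (fun z : X × Y => S⁻¹ • z.2) (S⁻¹ • ContinuousLinearMap.snd ℝ X Y) z :=
    hasFDerivAt_snd.const_smul S⁻¹
  have h3 : HasFDerivAt (fun z : X × Y => β (S⁻¹ • z.2))
      (fderiv ℝ β (S⁻¹ • z.2) ∘L (S⁻¹ • ContinuousLinearMap.snd ℝ X Y)) z :=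
    ((hβ.differentiable (by simp)) _).hasFDerivAt.comp z h2
  have h := (h1.mul h3).fderiv
  have h' : fderiv ℝ (testFunction α β S) z = _ := h
  rw [h']
  simp [testFunction]
  ring

variable [MeasurableSpace X] [BorelSpace X] [MeasurableSpace Y] [BorelSpace Y]
  (μ : Measure X) [μ.IsAddHaarMeasure] (ν : Measure Y) [ν.IsAddHaarMeasure]

theorem integral_testFunction_smul_fderiv {φ : X × Y → ℝ} (hφ : ContDiff ℝ ∞ φ)
    (hc : HasCompactSupport φ) {g : X × Y → ℂ} (hg : ContDiff ℝ ∞ g) (v : X × Y) :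
    ∫ z, φ z • fderiv ℝ g z v ∂(μ.prod ν) = -∫ z, fderiv ℝ φ z v • g z ∂(μ.prod ν) := by
  have hgc : Continuous g := hg.continuous
  have hφc : Continuous φ := hφ.continuous
  have hφ' : Continuous fun z => fderiv ℝ φ z v :=
    (hφ.continuous_fderiv (by simp)).clm_apply continuous_const
  have hg' : Continuous fun z => fderiv ℝ g z v :=
    (hg.continuous_fderiv (by simp)).clm_apply continuous_const
  have hc' : HasCompactSupport fun z => fderiv ℝ φ z v := hc.fderiv_apply (𝕜 := ℝ) v
  apply integral_smul_fderiv_eq_neg_fderiv_smul_of_integrable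
  · exact (hφ'.smul hgc).integrable_of_hasCompactSupport hc'.smul_right
  · exact (hφc.smul hg').integrable_of_hasCompactSupport hc.smul_right
  · exact (hφc.smul hgc).integrable_of_hasCompactSupport hc.smul_right
  · exact fun z _ => (hφ.differentiable (by simp)) z
  · exact fun z _ => (hg.differentiable (by simp)) z

/-- The function is bounded on every strip `‖x‖ ≤ R`. -/
def StripBounded (f : X × Y → ℂ) : Prop :=
  ∀ R : ℝ, ∃ C : ℝ, ∀ x y, ‖x‖ ≤ R → ‖f (x, y)‖ ≤ C

/-- The integral of a function that is bounded on strips against a test function stretched by `S`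
grows at most like the volume of a ball of radius `S` in the second factor. -/
theorem exists_norm_integral_testFunction_le {α : X → ℝ} {β : Y → ℝ} (hα : Continuous α)
    (hβ : Continuous β) (hαc : HasCompactSupport α) (hβc : HasCompactSupport β)
    {f : X × Y → ℂ} (hf : StripBounded f) :
    ∃ M : ℝ, ∀ S > 0, ‖∫ z, testFunction α β S z • f z ∂(μ.prod ν)‖ ≤ M * S ^ finrank ℝ Y := by
  obtain ⟨A, hA⟩ := hα.bounded_above_of_compact_support hαc
  obtain ⟨B, hB⟩ := hβ.bounded_above_of_compact_support hβc
  obtain ⟨R, hR⟩ := hαc.isCompact.isBounded.exists_norm_le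
  obtain ⟨C, hC⟩ := hf R
  have hA0 : 0 ≤ A := (norm_nonneg _).trans (hA 0)
  have hB0 : 0 ≤ B := (norm_nonneg _).trans (hB 0)
  have hC0 : 0 ≤ |C| := abs_nonneg C
  set K := tsupport α
  set L := tsupport β
  refine ⟨A * B * |C| * (μ.real K * ν.real L), fun S hS => ?_⟩
  have hzero : ∀ z, z ∉ K ×ˢ (S • L) → testFunction α β S z • f z = 0 := by
    intro z hz
    rw [Set.mem_prod, not_and_or] at hz
    rcases hz with hz | hz
    · simp [testFunction, image_eq_zero_of_notMem_tsupport hz]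
    · rw [Set.mem_smul_set_iff_inv_smul_mem₀ hS.ne'] at hz
      simp [testFunction, image_eq_zero_of_notMem_tsupport hz]
  rw [← setIntegral_eq_integral_of_forall_compl_eq_zero hzero]
  have hbound : ∀ z ∈ K ×ˢ (S • L), ‖testFunction α β S z • f z‖ ≤ A * B * |C| := by
    rintro ⟨x, y⟩ ⟨hx, -⟩
    rw [norm_smul, testFunction, norm_mul]
    exact mul_le_mul (mul_le_mul (hA _) (hB _) (norm_nonneg _) hA0)
      ((hC x y (hR x hx)).trans (le_abs_self C)) (norm_nonneg _) (by positivity)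
  have hfin : (μ.prod ν) (K ×ˢ (S • L)) < ⊤ :=
    (hαc.isCompact.prod (hβc.isCompact.smul S)).measure_lt_top
  refine (norm_setIntegral_le_of_norm_le_const hfin hbound).trans ?_
  have hvol : (μ.prod ν).real (K ×ˢ (S • L)) = μ.real K * (S ^ finrank ℝ Y * ν.real L) := by
    rw [measureReal_def, Measure.prod_prod, ENNReal.toReal_mul, Measure.addHaar_smul,
      ENNReal.toReal_mul, ENNReal.toReal_ofReal (abs_nonneg _), abs_of_pos (pow_pos hS _)]
    rfl
  rw [hvol]
  exact le_of_eq (by ring)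

/-- The normalised integral of `f` against `α (x) χ (y / S)`, where `χ` is the standard cut-off. -/
def sliceMean (α : X → ℝ) (f : X × Y → ℂ) (S : ℝ) : ℂ :=
  (S ^ finrank ℝ Y)⁻¹ • ∫ z, testFunction α (cutoff Y) S z • f z ∂(μ.prod ν)

/-- The averages of `f` over larger and larger balls in the second variable, weighted by a test
function of the first variable, tend to `0`. -/
def AveragesToZero (f : X × Y → ℂ) : Prop :=
  ∀ α : X → ℝ, ContDiff ℝ ∞ α → HasCompactSupport α →
    Tendsto (sliceMean μ ν α f) atTop (𝓝 0)

variable {μ ν}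

theorem integrable_testFunction_smul {α : X → ℝ} (hα : Continuous α) (hc : HasCompactSupport α)
    {f : X × Y → ℂ} (hf : Continuous f) {S : ℝ} (hS : 0 < S) :
    Integrable (fun z => testFunction α (cutoff Y) S z • f z) (μ.prod ν) := by
  have h : Continuous (testFunction α (cutoff Y) S) := by
    have := (contDiff_cutoff (X := Y)).continuous
    unfold testFunction
    fun_prop
  exact (h.smul hf).integrable_of_hasCompactSupport
    (hasCompactSupport_testFunction hc hasCompactSupport_cutoff hS).smul_right

theorem AveragesToZero.congr {f g : X × Y → ℂ} (hf : AveragesToZero μ ν f)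
    (h : ∀ z, f z = g z) : AveragesToZero μ ν g :=
  funext h ▸ hf

theorem AveragesToZero.add {f g : X × Y → ℂ} (hf : AveragesToZero μ ν f)
    (hg : AveragesToZero μ ν g) (hfc : Continuous f) (hgc : Continuous g) :
    AveragesToZero μ ν fun z => f z + g z := by
  intro α hα hc
  have h := (hf α hα hc).add (hg α hα hc)
  rw [add_zero] at h
  refine h.congr' ?_
  filter_upwards [eventually_gt_atTop 0] with S hS
  simp only [sliceMean, smul_add]
  rw [integral_add (integrable_testFunction_smul hα.continuous hc hfc hS)
    (integrable_testFunction_smul hα.continuous hc hgc hS), smul_add]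

theorem AveragesToZero.const_mul {f : X × Y → ℂ} (hf : AveragesToZero μ ν f) (c : ℂ) :
    AveragesToZero μ ν fun z => c * f z := by
  intro α hα hc
  have h := (hf α hα hc).const_mul c
  rw [mul_zero] at h
  refine h.congr fun S => ?_
  simp only [sliceMean]
  rw [mul_smul_comm, ← integral_const_mul]
  simp only [mul_smul_comm]

theorem AveragesToZero.sum {ι : Type*} (s : Finset ι) {f : ι → X × Y → ℂ}
    (hf : ∀ i ∈ s, AveragesToZero μ ν (f i)) (hfc : ∀ i ∈ s, Continuous (f i)) :
    AveragesToZero μ ν fun z => ∑ i ∈ s, f i z := by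
  classical
  induction s using Finset.induction_on with
  | empty =>
    intro α _ _
    have h0 : sliceMean μ ν α (fun _ : X × Y => 0) = fun _ => 0 := by
      funext S
      simp [sliceMean]
    simp only [Finset.sum_empty]
    rw [h0]
    exact tendsto_const_nhds
  | insert i s hi ih =>
    simp only [Finset.sum_insert hi]
    exact (hf i (Finset.mem_insert_self _ _)).add
      (ih (fun j hj => hf j (Finset.mem_insert_of_mem hj))
        fun j hj => hfc j (Finset.mem_insert_of_mem hj))
      (hfc i (Finset.mem_insert_self _ _))
      (continuous_finsetSum _ fun j hj => hfc j (Finset.mem_insert_of_mem hj))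

/-- If integration by parts gains a factor `S⁻ⁿ`, then the averages tend to `0`. -/
theorem tendsto_sliceMean_of_eq {α β : X → ℝ} {γ : Y → ℝ}
    (hβ : Continuous β) (hγ : Continuous γ) (hβc : HasCompactSupport β)
    (hγc : HasCompactSupport γ) {f g : X × Y → ℂ} (hg : StripBounded g) (n : ℕ) (hn : n ≠ 0)
    (c : ℝ)
    (h : ∀ S > 0, ∫ z, testFunction α (cutoff Y) S z • f z ∂(μ.prod ν) =
      (c * (S ^ n)⁻¹) • ∫ z, testFunction β γ S z • g z ∂(μ.prod ν)) :
    Tendsto (sliceMean μ ν α f) atTop (𝓝 0) := by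
  obtain ⟨M, hM⟩ := exists_norm_integral_testFunction_le μ ν hβ hγ hβc hγc hg
  have hlim : Tendsto (fun S : ℝ => |c| * M * (S ^ n)⁻¹) atTop (𝓝 0) := by
    simpa using (tendsto_inv_atTop_zero.comp (tendsto_pow_atTop hn)).const_mul (|c| * M)
  refine squeeze_zero_norm' ?_ hlim
  filter_upwards [eventually_gt_atTop 0] with S hS
  rw [sliceMean, h S hS, norm_smul, norm_smul]
  have hp : 0 < S ^ finrank ℝ Y := pow_pos hS _
  have hpn : 0 < S ^ n := pow_pos hS _
  rw [Real.norm_of_nonneg (inv_nonneg.2 hp.le), norm_mul, Real.norm_of_nonneg (inv_nonneg.2 hpn.le)]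
  calc _ ≤ (S ^ finrank ℝ Y)⁻¹ * (‖c‖ * (S ^ n)⁻¹ * (M * S ^ finrank ℝ Y)) := by
        gcongr
        exact hM S hS
    _ = _ := by
        rw [Real.norm_eq_abs]
        field_simp

/-- Derivatives in the direction of the second variable, multiplied by a function of the first
variable, average to zero. -/
theorem averagesToZero_fderiv_snd {κ : X → ℝ} (hκ : ContDiff ℝ ∞ κ) {g : X × Y → ℂ}
    (hg : ContDiff ℝ ∞ g) (hb : StripBounded g) (v : Y) :
    AveragesToZero μ ν fun z => κ z.1 • fderiv ℝ g z (0, v) := by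
  intro α hα hc
  have hχ := contDiff_cutoff (X := Y)
  have hχc := hasCompactSupport_cutoff (X := Y)
  have hακ : ContDiff ℝ ∞ fun x => α x * κ x := hα.mul hκ
  have hακc : HasCompactSupport fun x => α x * κ x := hc.mul_right
  refine tendsto_sliceMean_of_eq (β := fun x => α x * κ x) (γ := fun y => fderiv ℝ (cutoff Y) y v)
    hακ.continuous ((hχ.continuous_fderiv (by simp)).clm_apply continuous_const) hακc
    (hχc.fderiv_apply (𝕜 := ℝ) v) hb 1 one_ne_zero (-1) fun S hS => ?_
  have h := integral_testFunction_smul_fderiv μ ν (testFunction_contDiff hακ hχ S)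
    (hasCompactSupport_testFunction hακc hχc hS) hg (0, v)
  have h1 : ∀ z : X × Y, testFunction α (cutoff Y) S z • κ z.1 • fderiv ℝ g z (0, v) =
      testFunction (fun x => α x * κ x) (cutoff Y) S z • fderiv ℝ g z (0, v) := by
    intro z
    rw [smul_smul, testFunction, testFunction]
    congr 1
    ring
  simp only [h1, h]
  have h2 := fderiv_testFunction hακ hχ S (0 : X) v
  have h3 : ∀ z : X × Y, fderiv ℝ (testFunction (fun x => α x * κ x) (cutoff Y) S) z (0, v) =
      S⁻¹ * testFunction (fun x => α x * κ x) (fun y => fderiv ℝ (cutoff Y) y v) S z := by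
    intro z
    rw [congrFun h2 z]
    simp [testFunction]
  simp only [h3, mul_smul, integral_smul]
  simp

theorem sliceMean_fderiv_fst {α : X → ℝ} (hα : ContDiff ℝ ∞ α) (hc : HasCompactSupport α)
    {g : X × Y → ℂ} (hg : ContDiff ℝ ∞ g) (u : X) {S : ℝ} (hS : 0 < S) :
    sliceMean μ ν α (fun z => fderiv ℝ g z (u, 0)) S =
      -sliceMean μ ν (fun x => fderiv ℝ α x u) g S := by
  have hχ := contDiff_cutoff (X := Y)
  have hχc := hasCompactSupport_cutoff (X := Y)
  have h := integral_testFunction_smul_fderiv μ ν (testFunction_contDiff hα hχ S)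
    (hasCompactSupport_testFunction hc hχc hS) hg (u, 0)
  have h2 := fderiv_testFunction hα hχ S u (0 : Y)
  have h3 : ∀ z : X × Y, fderiv ℝ (testFunction α (cutoff Y) S) z (u, 0) =
      testFunction (fun x => fderiv ℝ α x u) (cutoff Y) S z := by
    intro z
    rw [congrFun h2 z]
    simp [testFunction]
  rw [sliceMean, h, sliceMean, smul_neg]
  simp only [h3]

theorem contDiff_fderiv_apply {E F : Type*} [NormedAddCommGroup E] [NormedSpace ℝ E]
    [NormedAddCommGroup F] [NormedSpace ℝ F] {f : E → F} (hf : ContDiff ℝ ∞ f) (v : E) :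
    ContDiff ℝ ∞ fun x => fderiv ℝ f x v :=
  (hf.fderiv_right (by simp)).clm_apply contDiff_const

/-- Second derivatives, of which one is in the direction of the second variable, average to
zero. -/
theorem averagesToZero_fderiv_fderiv {g : X × Y → ℂ} (hg : ContDiff ℝ ∞ g) (hb : StripBounded g)
    (w : X × Y) (v : Y) :
    AveragesToZero μ ν fun z => fderiv ℝ (fun z => fderiv ℝ g z (0, v)) z w := by
  have hχ := contDiff_cutoff (X := Y)
  have hχc := hasCompactSupport_cutoff (X := Y)
  set F : X × Y → ℂ := fun z => fderiv ℝ g z (0, v) with hF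
  have hFs : ContDiff ℝ ∞ F := contDiff_fderiv_apply hg _
  have hFa : AveragesToZero μ ν F := by
    simpa using averagesToZero_fderiv_snd (μ := μ) (ν := ν) (contDiff_const (c := (1 : ℝ))) hg hb v
  have h1 : AveragesToZero μ ν fun z => fderiv ℝ F z (w.1, 0) := by
    intro α hα hc
    have h := (hFa _ (contDiff_fderiv_apply hα w.1) (hc.fderiv_apply (𝕜 := ℝ) w.1)).neg
    rw [neg_zero] at h
    refine h.congr' ?_
    filter_upwards [eventually_gt_atTop 0] with S hS
    rw [sliceMean_fderiv_fst hα hc hFs w.1 hS]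
  have h2 : AveragesToZero μ ν fun z => fderiv ℝ F z (0, w.2) := by
    intro α hα hc
    set γ : Y → ℝ := fun y => fderiv ℝ (cutoff Y) y w.2 with hγ
    have hγs : ContDiff ℝ ∞ γ := contDiff_fderiv_apply hχ _
    have hγc : HasCompactSupport γ := hχc.fderiv_apply (𝕜 := ℝ) w.2
    refine tendsto_sliceMean_of_eq (β := α) (γ := fun y => fderiv ℝ γ y v) hα.continuous
      (contDiff_fderiv_apply hγs v).continuous hc (hγc.fderiv_apply (𝕜 := ℝ) v) hb 2 two_ne_zero 1
      fun S hS => ?_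
    have e1 := integral_testFunction_smul_fderiv μ ν (testFunction_contDiff hα hχ S)
      (hasCompactSupport_testFunction hc hχc hS) hFs (0, w.2)
    have e2 := integral_testFunction_smul_fderiv μ ν (testFunction_contDiff hα hγs S)
      (hasCompactSupport_testFunction hc hγc hS) hg (0, v)
    have e3 : ∀ z : X × Y, fderiv ℝ (testFunction α (cutoff Y) S) z (0, w.2) =
        S⁻¹ * testFunction α γ S z := by
      intro z
      rw [congrFun (fderiv_testFunction hα hχ S (0 : X) w.2) z]
      simp [testFunction, hγ]
    have e4 : ∀ z : X × Y, fderiv ℝ (testFunction α γ S) z (0, v) =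
        S⁻¹ * testFunction α (fun y => fderiv ℝ γ y v) S z := by
      intro z
      rw [congrFun (fderiv_testFunction hα hγs S (0 : X) v) z]
      simp [testFunction]
    rw [e1]
    simp only [e3, e4, mul_smul, integral_smul, hF] at e2 ⊢
    rw [e2]
    rw [smul_neg, neg_neg, smul_smul, smul_smul]
    congr 1
    field_simp
  have hsum := h1.add h2 (contDiff_fderiv_apply hFs _).continuous
    (contDiff_fderiv_apply hFs _).continuous
  refine hsum.congr fun z => ?_
  rw [← map_add]
  simp

/-- A bounded family of densities that is, up to an error of size `O(1/R)`, at least a positive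
multiple of the cut-off at scale `R` does not have vanishing averages. -/
theorem false_of_averages_tendsto_zero {Ψ : ℝ → X × Y → ℝ} {c C : ℝ} (hc : 0 < c)
    (hΨ : ∀ R ≥ 1, Continuous (Ψ R)) (hsupp : ∀ R ≥ 1, ∀ x y, 2 * R < ‖x‖ → Ψ R (x, y) = 0)
    (hlow : ∀ R ≥ 1, ∀ x y,
      c * cutoff X (R⁻¹ • x) - C / R * cutoff X ((2 * R)⁻¹ • x) ≤ Ψ R (x, y))
    (hlim : ∀ R ≥ 1, Tendsto (fun S : ℝ => (S ^ finrank ℝ Y)⁻¹ *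
      ∫ z, cutoff Y (S⁻¹ • z.2) * Ψ R z ∂(μ.prod ν)) atTop (𝓝 0)) : False := by
  have hχ : Continuous (cutoff X) := contDiff_cutoff.continuous
  have hχY : Continuous (cutoff Y) := contDiff_cutoff.continuous
  set a := ∫ x, cutoff X x ∂μ with ha
  set b := ∫ y, cutoff Y y ∂ν with hb
  have ha0 : 0 < a := integral_cutoff_pos μ
  have hb0 : 0 < b := integral_cutoff_pos ν
  -- at this scale the error, of total mass at most `C / R * (2 R) ^ dim X * a`, is at most half of
  -- the main term `c * R ^ dim X * a`
  set R : ℝ := max 1 (2 * (|C| * 2 ^ finrank ℝ X) / c) with hR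
  have hR1 : 1 ≤ R := le_max_left _ _
  have hR0 : 0 < R := by linarith
  have hRc : C / R * 2 ^ finrank ℝ X ≤ c / 2 := by
    have h1 : 2 * (|C| * 2 ^ finrank ℝ X) / c ≤ R := le_max_right _ _
    rw [div_le_iff₀ hc] at h1
    have h2 : C * 2 ^ finrank ℝ X ≤ |C| * 2 ^ finrank ℝ X := by gcongr; exact le_abs_self C
    rw [div_mul_eq_mul_div, div_le_iff₀ hR0]
    linarith
  have hcut : ∀ r : ℝ, 0 < r → HasCompactSupport fun x : X => cutoff X (r⁻¹ • x) := fun r hr =>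
    hasCompactSupport_cutoff.comp_homeomorph (Homeomorph.smulOfNeZero r⁻¹ (inv_ne_zero hr.ne'))
  have hcutY : ∀ r : ℝ, 0 < r → HasCompactSupport fun x : Y => cutoff Y (r⁻¹ • x) := fun r hr =>
    hasCompactSupport_cutoff.comp_homeomorph (Homeomorph.smulOfNeZero r⁻¹ (inv_ne_zero hr.ne'))
  have hint : ∀ r : ℝ, 0 < r → Integrable (fun x : X => cutoff X (r⁻¹ • x)) μ := fun r hr =>
    (show Continuous fun x : X => cutoff X (r⁻¹ • x) by fun_prop).integrable_of_hasCompactSupport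
      (hcut r hr)
  have hintY : ∀ r : ℝ, 0 < r → Integrable (fun x : Y => cutoff Y (r⁻¹ • x)) ν := fun r hr =>
    (show Continuous fun x : Y => cutoff Y (r⁻¹ • x) by fun_prop).integrable_of_hasCompactSupport
      (hcutY r hr)
  have hscale : ∀ r : ℝ, 0 < r → ∫ x, cutoff X (r⁻¹ • x) ∂μ = r ^ finrank ℝ X * a := by
    intro r hr
    rw [Measure.integral_comp_inv_smul, abs_of_pos (pow_pos hr _), smul_eq_mul]
  have hscaleY : ∀ r : ℝ, 0 < r → ∫ y, cutoff Y (r⁻¹ • y) ∂ν = r ^ finrank ℝ Y * b := by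
    intro r hr
    rw [Measure.integral_comp_inv_smul, abs_of_pos (pow_pos hr _), smul_eq_mul]
  set low : X → ℝ := fun x => c * cutoff X (R⁻¹ • x) - C / R * cutoff X ((2 * R)⁻¹ • x) with hlowdef
  have hlowint : Integrable low μ :=
    ((hint R hR0).const_mul c).sub ((hint (2 * R) (by linarith)).const_mul _)
  have hlowval : R ^ finrank ℝ X * a * (c / 2) ≤ ∫ x, low x ∂μ := by
    rw [hlowdef, integral_sub ((hint R hR0).const_mul c)
      ((hint (2 * R) (by linarith)).const_mul _), integral_const_mul, integral_const_mul,
      hscale R hR0, hscale (2 * R) (by linarith), mul_pow]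
    have h3 : 0 < R ^ finrank ℝ X * a := by positivity
    nlinarith [mul_le_mul_of_nonneg_left hRc h3.le]
  have hpos : 0 < R ^ finrank ℝ X * a * (c / 2) := by positivity
  have hge : ∀ S : ℝ, 0 < S → b * (R ^ finrank ℝ X * a * (c / 2)) ≤ (S ^ finrank ℝ Y)⁻¹ *
      ∫ z, cutoff Y (S⁻¹ • z.2) * Ψ R z ∂(μ.prod ν) := by
    intro S hS
    have hSp : 0 < S ^ finrank ℝ Y := pow_pos hS _
    have h1 : ∫ z : X × Y, low z.1 * cutoff Y (S⁻¹ • z.2) ∂(μ.prod ν) ≤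
        ∫ z, cutoff Y (S⁻¹ • z.2) * Ψ R z ∂(μ.prod ν) := by
      apply integral_mono
      · exact hlowint.mul_prod (hintY S hS)
      · have hcont : Continuous fun z : X × Y => cutoff Y (S⁻¹ • z.2) * Ψ R z := by
          have := hΨ R hR1
          fun_prop
        refine hcont.integrable_of_hasCompactSupport (HasCompactSupport.intro
          ((isCompact_closedBall (0 : X) (2 * R)).prod (hcutY S hS).isCompact) fun z hz => ?_)
        rw [Set.mem_prod, not_and_or] at hz
        rcases hz with hz | hz
        · rw [show z = (z.1, z.2) from rfl, hsupp R hR1 _ _ (by simpa using hz), mul_zero]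
        · have : cutoff Y (S⁻¹ • z.2) = 0 :=
            image_eq_zero_of_notMem_tsupport (f := fun y => cutoff Y (S⁻¹ • y)) hz
          rw [this, zero_mul]
      · intro z
        simp only
        rw [mul_comm]
        exact mul_le_mul_of_nonneg_left (hlow R hR1 z.1 z.2) (cutoff_nonneg _)
    rw [integral_prod_mul low fun y : Y => cutoff Y (S⁻¹ • y), hscaleY S hS] at h1
    rw [inv_mul_eq_div, le_div_iff₀ hSp]
    refine le_trans ?_ h1
    have : 0 < S ^ finrank ℝ Y * b := by positivity
    nlinarith [mul_le_mul_of_nonneg_right hlowval this.le]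
  have := ge_of_tendsto (hlim R hR1) ((eventually_gt_atTop 0).mono hge)
  have : 0 < b * (R ^ finrank ℝ X * a * (c / 2)) := by positivity
  linarith

theorem fderiv_comp_smul_apply {f : X → ℝ} (hf : ContDiff ℝ ∞ f) (r : ℝ) (x u : X) :
    fderiv ℝ (fun x => f (r • x)) x u = r * fderiv ℝ f (r • x) u := by
  have h2 : HasFDerivAt (fun x : X => r • x) (r • ContinuousLinearMap.id ℝ X) x :=
    (hasFDerivAt_id x).const_smul r
  have h3 : HasFDerivAt (fun x : X => f (r • x))
      (fderiv ℝ f (r • x) ∘L (r • ContinuousLinearMap.id ℝ X)) x :=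
    ((hf.differentiable (by simp)) _).hasFDerivAt.comp x h2
  rw [h3.fderiv]
  simp

theorem fderiv_cutoff_eq_zero {x : X} (hx : 2 < ‖x‖) (u : X) : fderiv ℝ (cutoff X) x u = 0 := by
  have h : cutoff X =ᶠ[𝓝 x] fun _ => 0 := by
    filter_upwards [(isOpen_lt continuous_const continuous_norm).mem_nhds hx] with y hy
    exact cutoff_eq_zero (le_of_lt hy)
  rw [h.fderiv_eq]
  simp

theorem fderiv_fderiv_cutoff_eq_zero {x : X} (hx : 2 < ‖x‖) (u : X) :
    fderiv ℝ (fun x => fderiv ℝ (cutoff X) x u) x u = 0 := by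
  have h : (fun x => fderiv ℝ (cutoff X) x u) =ᶠ[𝓝 x] fun _ => 0 := by
    filter_upwards [(isOpen_lt continuous_const continuous_norm).mem_nhds hx] with y hy
    exact fderiv_cutoff_eq_zero hy u
  rw [h.fderiv_eq]
  simp

/-- A function supported in the ball of radius `2` is dominated by the cut-off at twice the scale. -/
theorem exists_abs_le_mul_cutoff {γ : X → ℝ} (hγ : Continuous γ)
    (h0 : ∀ x, 2 < ‖x‖ → γ x = 0) :
    ∃ K : ℝ, 0 ≤ K ∧ ∀ R : ℝ, 0 < R → ∀ x, |γ (R⁻¹ • x)| ≤ K * cutoff X ((2 * R)⁻¹ • x) := by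
  obtain ⟨K, hK⟩ := (isCompact_closedBall (0 : X) 2).exists_bound_of_continuousOn hγ.continuousOn
  refine ⟨|K|, abs_nonneg _, fun R hR x => ?_⟩
  by_cases hx : ‖R⁻¹ • x‖ ≤ 2
  · have h1 : ‖(2 * R)⁻¹ • x‖ ≤ 1 := by
      rw [mul_inv, mul_smul, norm_smul]
      simp only [norm_inv, Real.norm_ofNat]
      linarith
    rw [cutoff_eq_one h1, mul_one]
    exact (hK _ (by simpa using hx)).trans (le_abs_self K)
  · rw [h0 _ (not_le.1 hx), abs_zero]
    exact mul_nonneg (abs_nonneg _) (cutoff_nonneg _)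

theorem two_lt_norm_inv_smul {R : ℝ} (hR : 0 < R) {x : X} (hx : 2 * R < ‖x‖) :
    2 < ‖R⁻¹ • x‖ := by
  rw [norm_smul, norm_inv, Real.norm_of_nonneg hR.le, inv_mul_eq_div, lt_div_iff₀ hR]
  exact hx

theorem re_sliceMean {α : X → ℝ} (hα : Continuous α) (hc : HasCompactSupport α) {f : X × Y → ℂ}
    (hf : Continuous f) {S : ℝ} (hS : 0 < S) : (sliceMean μ ν α f S).re =
      (S ^ finrank ℝ Y)⁻¹ * ∫ z, cutoff Y (S⁻¹ • z.2) * (α z.1 * (f z).re) ∂(μ.prod ν) := by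
  rw [sliceMean, smul_re, smul_eq_mul]
  congr 1
  have h := integral_re (𝕜 := ℂ) (integrable_testFunction_smul (μ := μ) (ν := ν) hα hc hf hS)
  simp only [RCLike.re_eq_complex_re] at h
  rw [← h]
  congr 1
  funext z
  rw [smul_re, testFunction, smul_eq_mul]
  ring

theorem hasCompactSupport_cutoff_smul {R : ℝ} (hR : 0 < R) :
    HasCompactSupport fun x : X => cutoff X (R⁻¹ • x) :=
  hasCompactSupport_cutoff.comp_homeomorph (Homeomorph.smulOfNeZero R⁻¹ (inv_ne_zero hR.ne'))

theorem contDiff_cutoff_smul (R : ℝ) : ContDiff ℝ ∞ fun x : X => cutoff X (R⁻¹ • x) :=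
  contDiff_cutoff.comp (contDiff_const_smul _)

/-- A function bounded below by a positive constant does not average to zero, even after adding
derivatives of bounded functions. -/
theorem not_averagesToZero_of_pos {ι : Type*} [Fintype ι] {h : X × Y → ℂ} (hh : Continuous h)
    {c : ℝ} (hc : 0 < c) (hpos : ∀ z, c ≤ (h z).re) {F : ι → X × Y → ℂ}
    (hF : ∀ i, ContDiff ℝ ∞ (F i)) {C : ℝ} (hC : ∀ i z, ‖F i z‖ ≤ C) (u : ι → X)
    (h0 : AveragesToZero μ ν fun z => h z + ∑ i, fderiv ℝ (F i) z (u i, 0)) : False := by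
  have hχ := contDiff_cutoff (X := X)
  choose K hK0 hK using fun i => exists_abs_le_mul_cutoff
    (contDiff_fderiv_apply hχ (u i)).continuous fun x hx => fderiv_cutoff_eq_zero hx (u i)
  have hder : ∀ (i : ι) (R : ℝ) (x : X), fderiv ℝ (fun x => cutoff X (R⁻¹ • x)) x (u i) =
      R⁻¹ * fderiv ℝ (cutoff X) (R⁻¹ • x) (u i) := fun i R x => fderiv_comp_smul_apply hχ _ _ _
  refine false_of_averages_tendsto_zero (μ := μ) (ν := ν) (c := c) (C := ∑ i, K i * |C|)
    (Ψ := fun R z => cutoff X (R⁻¹ • z.1) * (h z).re -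
      ∑ i, fderiv ℝ (fun x => cutoff X (R⁻¹ • x)) z.1 (u i) * (F i z).re) hc ?_ ?_ ?_ ?_
  · intro R _
    have h1 := (contDiff_cutoff_smul (X := X) R).continuous
    have h2 : ∀ i, Continuous fun z : X × Y =>
        fderiv ℝ (fun x => cutoff X (R⁻¹ • x)) z.1 (u i) := fun i =>
      (contDiff_fderiv_apply (contDiff_cutoff_smul (X := X) R) (u i)).continuous.comp continuous_fst
    have h3 := fun i => (hF i).continuous
    refine ((h1.comp continuous_fst).mul (continuous_re.comp hh)).sub
      (continuous_finsetSum _ fun i _ => (h2 i).mul (continuous_re.comp (h3 i)))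
  · intro R hR x y hx
    have hR0 : 0 < R := by linarith
    have h1 := two_lt_norm_inv_smul hR0 hx
    simp only [hder, fderiv_cutoff_eq_zero h1, cutoff_eq_zero h1.le]
    simp
  · intro R hR x y
    have hR0 : 0 < R := by linarith
    have h1 : c * cutoff X (R⁻¹ • x) ≤ cutoff X (R⁻¹ • x) * (h (x, y)).re := by
      rw [mul_comm]
      exact mul_le_mul_of_nonneg_left (hpos _) (cutoff_nonneg _)
    have h2 : ∑ i, fderiv ℝ (fun x => cutoff X (R⁻¹ • x)) x (u i) * (F i (x, y)).re ≤
        (∑ i, K i * |C|) / R * cutoff X ((2 * R)⁻¹ • x) := by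
      rw [Finset.sum_div, Finset.sum_mul]
      refine Finset.sum_le_sum fun i _ => ?_
      rw [hder]
      have h3 : |(F i (x, y)).re| ≤ |C| :=
        (abs_re_le_norm _).trans ((hC i _).trans (le_abs_self C))
      have h4 := hK i R hR0 x
      refine (le_abs_self _).trans ?_
      rw [abs_mul, abs_mul, abs_of_pos (inv_pos.2 hR0)]
      calc _ ≤ R⁻¹ * (K i * cutoff X ((2 * R)⁻¹ • x)) * |C| := by
            have := cutoff_nonneg ((2 * R)⁻¹ • x)
            have := hK0 i
            gcongr
        _ = _ := by ring
    simp only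
    linarith
  · intro R hR
    have hR0 : 0 < R := by linarith
    have hs := contDiff_cutoff_smul (X := X) R
    have hcs := hasCompactSupport_cutoff_smul (X := X) hR0
    have hlim := (continuous_re.tendsto _).comp (h0 _ hs hcs)
    rw [zero_re] at hlim
    refine hlim.congr' ?_
    filter_upwards [eventually_gt_atTop 0] with S hS
    have hFi : ∀ i, Continuous fun z => fderiv ℝ (F i) z (u i, 0) := fun i =>
      (contDiff_fderiv_apply (hF i) _).continuous
    have e1 : sliceMean μ ν (fun x => cutoff X (R⁻¹ • x))
        (fun z => h z + ∑ i, fderiv ℝ (F i) z (u i, 0)) S =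
        sliceMean μ ν (fun x => cutoff X (R⁻¹ • x)) h S + ∑ i, sliceMean μ ν
          (fun x => cutoff X (R⁻¹ • x)) (fun z => fderiv ℝ (F i) z (u i, 0)) S := by
      simp only [sliceMean, smul_add, Finset.smul_sum]
      rw [integral_add (integrable_testFunction_smul hs.continuous hcs hh hS),
        integral_finsetSum, smul_add, Finset.smul_sum]
      · exact fun i _ => integrable_testFunction_smul hs.continuous hcs (hFi i) hS
      · exact integrable_finsetSum _ fun i _ =>
          integrable_testFunction_smul hs.continuous hcs (hFi i) hS
    have hder_s := fun i => contDiff_fderiv_apply hs (u i)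
    have hder_c := fun i => hcs.fderiv_apply (𝕜 := ℝ) (u i)
    have hintr : ∀ (α : X → ℝ), Continuous α → HasCompactSupport α → ∀ f : X × Y → ℂ,
        Continuous f → Integrable (fun z => cutoff Y (S⁻¹ • z.2) * (α z.1 * (f z).re))
          (μ.prod ν) := by
      intro α hα hαc f hf
      refine (integrable_testFunction_smul (μ := μ) (ν := ν) hα hαc hf hS).re.congr ?_
      filter_upwards with z
      simp [testFunction]
      ring
    simp only [Function.comp_apply]
    rw [e1, add_re, re_sum, re_sliceMean hs.continuous hcs hh hS]
    have e2 : ∀ i, (sliceMean μ ν (fun x => cutoff X (R⁻¹ • x))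
        (fun z => fderiv ℝ (F i) z (u i, 0)) S).re = -((S ^ finrank ℝ Y)⁻¹ *
        ∫ z, cutoff Y (S⁻¹ • z.2) * (fderiv ℝ (fun x => cutoff X (R⁻¹ • x)) z.1 (u i) *
          (F i z).re) ∂(μ.prod ν)) := by
      intro i
      rw [sliceMean_fderiv_fst hs hcs (hF i) _ hS, neg_re,
        re_sliceMean (hder_s i).continuous (hder_c i) (hF i).continuous hS]
    simp only [e2, mul_sub, Finset.mul_sum]
    rw [integral_sub (hintr _ hs.continuous hcs h hh), integral_finsetSum, mul_sub,
      Finset.mul_sum, Finset.sum_neg_distrib, sub_eq_add_neg]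
    · exact fun i _ => hintr _ (hder_s i).continuous (hder_c i) _ (hF i).continuous
    · exact integrable_finsetSum _ fun i _ =>
        hintr _ (hder_s i).continuous (hder_c i) _ (hF i).continuous

theorem fderiv_fderiv_exp_mul_apply (ℓ : X →L[ℝ] ℝ) {f : X → ℝ} (hf : ContDiff ℝ ∞ f) (x u : X) :
    fderiv ℝ (fun x => fderiv ℝ (fun x => Real.exp (ℓ x) * f x) x u) x u =
      Real.exp (ℓ x) * (ℓ u ^ 2 * f x + 2 * ℓ u * fderiv ℝ f x u +
        fderiv ℝ (fun x => fderiv ℝ f x u) x u) := by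
  have h1 : ∀ {F : X → ℝ} (_ : ContDiff ℝ ∞ F) (x : X),
      fderiv ℝ (fun x => Real.exp (ℓ x) * F x) x u =
        Real.exp (ℓ x) * (ℓ u * F x + fderiv ℝ F x u) := by
    intro F hF x
    have h := (ℓ.hasFDerivAt (x := x)).exp.mul ((hF.differentiable (by simp)) x).hasFDerivAt
    have h' : fderiv ℝ (fun x => Real.exp (ℓ x) * F x) x = _ := h.fderiv
    rw [h']
    simp
    ring
  have hf' := contDiff_fderiv_apply hf u
  simp only [h1 hf]
  rw [h1 (F := fun x => ℓ u * f x + fderiv ℝ f x u) ((contDiff_const.mul hf).add hf'),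
    fderiv_fun_add (((hf.differentiable (by simp)) x).const_mul _)
      ((hf'.differentiable (by simp)) x),
    fderiv_const_mul ((hf.differentiable (by simp)) x)]
  simp
  ring

/-- Let `ℓ` be a non-zero linear form. A function comparable to `e^{-ℓ}` cannot have a Laplacian in
the first variable that averages to zero: testing against `e^ℓ` times a cut-off at scale `R` gives a
positive integral, as `e^ℓ` is strictly subharmonic. -/
theorem not_averagesToZero_of_exp {ι : Type*} [Fintype ι] (ℓ : X →L[ℝ] ℝ) {g : X × Y → ℂ}
    (hg : ContDiff ℝ ∞ g) {c C : ℝ} (hc : 0 < c)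
    (hlow : ∀ x y, c * Real.exp (-ℓ x) ≤ (g (x, y)).re)
    (hup : ∀ x y, (g (x, y)).re ≤ C * Real.exp (-ℓ x)) (u : ι → X) (hu : 0 < ∑ i, ℓ (u i) ^ 2)
    (h0 : AveragesToZero μ ν fun z =>
      ∑ i, fderiv ℝ (fun z => fderiv ℝ g z (u i, 0)) z (u i, 0)) : False := by
  have hχ := contDiff_cutoff (X := X)
  have hC : 0 ≤ C := by
    have h1 := (hlow 0 0).trans (hup 0 0)
    simp at h1
    linarith
  choose K hK0 hK using fun i => exists_abs_le_mul_cutoff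
    (contDiff_fderiv_apply hχ (u i)).continuous fun x hx => fderiv_cutoff_eq_zero hx (u i)
  choose K' hK0' hK' using fun i => exists_abs_le_mul_cutoff
    (contDiff_fderiv_apply (contDiff_fderiv_apply hχ (u i)) (u i)).continuous
    fun x hx => fderiv_fderiv_cutoff_eq_zero hx (u i)
  have hder : ∀ (i : ι) (R : ℝ) (x : X), fderiv ℝ (fun x => cutoff X (R⁻¹ • x)) x (u i) =
      R⁻¹ * fderiv ℝ (cutoff X) (R⁻¹ • x) (u i) := fun i R x => fderiv_comp_smul_apply hχ _ _ _
  have hder2 : ∀ (i : ι) (R : ℝ) (x : X),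
      fderiv ℝ (fun x => fderiv ℝ (fun x => cutoff X (R⁻¹ • x)) x (u i)) x (u i) =
      R⁻¹ * (R⁻¹ * fderiv ℝ (fun x => fderiv ℝ (cutoff X) x (u i)) (R⁻¹ • x) (u i)) := by
    intro i R x
    have hd := contDiff_fderiv_apply hχ (u i)
    simp only [hder]
    have hd' : DifferentiableAt ℝ (fun x => fderiv ℝ (cutoff X) (R⁻¹ • x) (u i)) x :=
      ((hd.comp (contDiff_const_smul R⁻¹)).differentiable (by simp)) x
    rw [fderiv_const_mul hd']
    simp only [smul_apply, smul_eq_mul]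
    congr 1
    exact fderiv_comp_smul_apply hd _ _ _
  set α : ℝ → X → ℝ := fun R x => Real.exp (ℓ x) * cutoff X (R⁻¹ • x) with hα
  have hαs : ∀ R, ContDiff ℝ ∞ (α R) := fun R =>
    (ℓ.contDiff.exp).mul (contDiff_cutoff_smul R)
  have hαc : ∀ R, 0 < R → HasCompactSupport (α R) := fun R hR =>
    (hasCompactSupport_cutoff_smul hR).mul_left
  set β : ℝ → X → ℝ := fun R x =>
    ∑ i, fderiv ℝ (fun x => fderiv ℝ (α R) x (u i)) x (u i) with hβ
  have hβs : ∀ R, Continuous (β R) := fun R => continuous_finsetSum _ fun i _ =>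
    (contDiff_fderiv_apply (contDiff_fderiv_apply (hαs R) (u i)) (u i)).continuous
  have hβval : ∀ R x, β R x = ∑ i, Real.exp (ℓ x) * (ℓ (u i) ^ 2 * cutoff X (R⁻¹ • x) +
      2 * ℓ (u i) * (R⁻¹ * fderiv ℝ (cutoff X) (R⁻¹ • x) (u i)) +
      R⁻¹ * (R⁻¹ * fderiv ℝ (fun x => fderiv ℝ (cutoff X) x (u i)) (R⁻¹ • x) (u i))) := by
    intro R x
    refine Finset.sum_congr rfl fun i _ => ?_
    rw [hα, fderiv_fderiv_exp_mul_apply ℓ (contDiff_cutoff_smul R), hder, hder2]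
  refine false_of_averages_tendsto_zero (μ := μ) (ν := ν) (c := c * ∑ i, ℓ (u i) ^ 2)
    (C := C * ∑ i, (2 * |ℓ (u i)| * K i + K' i))
    (Ψ := fun R z => β R z.1 * (g z).re) (by positivity) ?_ ?_ ?_ ?_
  · intro R _
    exact ((hβs R).comp continuous_fst).mul (continuous_re.comp hg.continuous)
  · intro R hR x y hx
    have hR0 : 0 < R := by linarith
    have h1 := two_lt_norm_inv_smul hR0 hx
    simp only [hβval, fderiv_cutoff_eq_zero h1, cutoff_eq_zero h1.le,
      fderiv_fderiv_cutoff_eq_zero h1]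
    simp
  · intro R hR x y
    have hR0 : 0 < R := by linarith
    have hRi : R⁻¹ ≤ 1 := inv_le_one_of_one_le₀ hR
    have hRi0 : 0 < R⁻¹ := inv_pos.2 hR0
    set e := Real.exp (ℓ x) * (g (x, y)).re with he
    have hexp : Real.exp (ℓ x) * Real.exp (-ℓ x) = 1 := by rw [← Real.exp_add]; simp
    have he1 : c ≤ e := by
      have := mul_le_mul_of_nonneg_left (hlow x y) (Real.exp_pos (ℓ x)).le
      rw [mul_left_comm, hexp, mul_one] at this
      exact this
    have he2 : e ≤ C := by
      have := mul_le_mul_of_nonneg_left (hup x y) (Real.exp_pos (ℓ x)).le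
      rw [mul_left_comm (Real.exp (ℓ x)) C, hexp, mul_one] at this
      exact this
    set q := cutoff X ((2 * R)⁻¹ • x)
    have hq : 0 ≤ q := cutoff_nonneg _
    have hcut : 0 ≤ cutoff X (R⁻¹ • x) := cutoff_nonneg _
    have e1 : β R x * (g (x, y)).re = ∑ i, e * (ℓ (u i) ^ 2 * cutoff X (R⁻¹ • x)) +
        ∑ i, e * (2 * ℓ (u i) * (R⁻¹ * fderiv ℝ (cutoff X) (R⁻¹ • x) (u i)) +
      R⁻¹ * (R⁻¹ * fderiv ℝ (fun x => fderiv ℝ (cutoff X) x (u i)) (R⁻¹ • x) (u i))) := by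
      rw [hβval, Finset.sum_mul, ← Finset.sum_add_distrib]
      refine Finset.sum_congr rfl fun i _ => ?_
      rw [he]
      ring
    have e2 : c * (∑ i, ℓ (u i) ^ 2) * cutoff X (R⁻¹ • x) ≤
        ∑ i, e * (ℓ (u i) ^ 2 * cutoff X (R⁻¹ • x)) := by
      rw [mul_assoc, Finset.sum_mul, Finset.mul_sum]
      refine Finset.sum_le_sum fun i _ => ?_
      exact mul_le_mul_of_nonneg_right he1 (by positivity)
    have e3 : -(C * (∑ i, (2 * |ℓ (u i)| * K i + K' i)) / R * q) ≤
        ∑ i, e * (2 * ℓ (u i) * (R⁻¹ * fderiv ℝ (cutoff X) (R⁻¹ • x) (u i)) +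
      R⁻¹ * (R⁻¹ * fderiv ℝ (fun x => fderiv ℝ (cutoff X) x (u i)) (R⁻¹ • x) (u i))) := by
      rw [Finset.mul_sum, Finset.sum_div, Finset.sum_mul, ← Finset.sum_neg_distrib]
      refine Finset.sum_le_sum fun i _ => ?_
      have a1 := hK i R hR0 x
      have a2 := hK' i R hR0 x
      set d1 := fderiv ℝ (cutoff X) (R⁻¹ • x) (u i)
      set d2 := fderiv ℝ (fun x => fderiv ℝ (cutoff X) x (u i)) (R⁻¹ • x) (u i)
      have a3 : |2 * ℓ (u i) * (R⁻¹ * d1) + R⁻¹ * (R⁻¹ * d2)| ≤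
          (2 * |ℓ (u i)| * K i + K' i) * R⁻¹ * q := by
        refine (abs_add_le _ _).trans ?_
        rw [abs_mul, abs_mul, abs_mul, abs_mul, abs_mul, abs_of_pos hRi0, abs_of_pos (two_pos)]
        have b1 : 2 * |ℓ (u i)| * (R⁻¹ * |d1|) ≤ 2 * |ℓ (u i)| * (R⁻¹ * (K i * q)) := by gcongr
        have b2 : R⁻¹ * (R⁻¹ * |d2|) ≤ R⁻¹ * (1 * (K' i * q)) := by
          gcongr
        linarith
      have a4 : |e * (2 * ℓ (u i) * (R⁻¹ * d1) + R⁻¹ * (R⁻¹ * d2))| ≤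
          C * ((2 * |ℓ (u i)| * K i + K' i) * R⁻¹ * q) := by
        rw [abs_mul, abs_of_pos (hc.trans_le he1)]
        exact mul_le_mul he2 a3 (abs_nonneg _) hC
      have a5 := neg_le_of_abs_le a4
      refine le_trans (le_of_eq ?_) a5
      rw [div_eq_mul_inv]
      ring
    simp only
    rw [e1]
    linarith
  · intro R hR
    have hR0 : 0 < R := by linarith
    have hs := hαs R
    have hcs := hαc R hR0
    have hlim := (continuous_re.tendsto _).comp (h0 _ hs hcs)
    rw [zero_re] at hlim
    refine hlim.congr' ?_
    filter_upwards [eventually_gt_atTop 0] with S hS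
    have hgi := fun i => contDiff_fderiv_apply hg (u i, (0 : Y))
    have hgii := fun i => contDiff_fderiv_apply (hgi i) (u i, (0 : Y))
    have hαi := fun i => contDiff_fderiv_apply hs (u i)
    have hαii := fun i => contDiff_fderiv_apply (hαi i) (u i)
    have hαic := fun i => hcs.fderiv_apply (𝕜 := ℝ) (u i)
    have hαiic := fun i => (hαic i).fderiv_apply (𝕜 := ℝ) (u i)
    have e1 : sliceMean μ ν (α R) (fun z =>
        ∑ i, fderiv ℝ (fun z => fderiv ℝ g z (u i, 0)) z (u i, 0)) S =
        ∑ i, sliceMean μ ν (α R) (fun z =>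
          fderiv ℝ (fun z => fderiv ℝ g z (u i, 0)) z (u i, 0)) S := by
      simp only [sliceMean, Finset.smul_sum]
      rw [integral_finsetSum, Finset.smul_sum]
      exact fun i _ => integrable_testFunction_smul hs.continuous hcs (hgii i).continuous hS
    have e2 : ∀ i, (sliceMean μ ν (α R) (fun z =>
        fderiv ℝ (fun z => fderiv ℝ g z (u i, 0)) z (u i, 0)) S).re = (S ^ finrank ℝ Y)⁻¹ *
        ∫ z, cutoff Y (S⁻¹ • z.2) * (fderiv ℝ (fun x => fderiv ℝ (α R) x (u i)) z.1 (u i) *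
          (g z).re) ∂(μ.prod ν) := by
      intro i
      rw [sliceMean_fderiv_fst hs hcs (hgi i) _ hS, sliceMean_fderiv_fst (hαi i) (hαic i) hg _ hS,
        neg_neg, re_sliceMean (hαii i).continuous (hαiic i) hg.continuous hS]
    simp only [Function.comp_apply]
    rw [e1, re_sum]
    simp only [e2, hβ, Finset.sum_mul, Finset.mul_sum]
    rw [integral_finsetSum, Finset.mul_sum]
    intro i _
    refine (integrable_testFunction_smul (μ := μ) (ν := ν) (hαii i).continuous (hαiic i)
      hg.continuous hS).re.congr ?_
    filter_upwards with z
    simp [testFunction]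
    ring

end Averages

/-! ### Forms on `ℂ³` with `d (J dη) = 0` -/

section SecondOrder

open MeasureTheory Filter Topology Module ContinuousAlternatingMap

/-- The standard complex structure, as a real-linear endomorphism of a complex vector space. -/
def mulI (E : Type*) [NormedAddCommGroup E] [NormedSpace ℝ E] [NormedSpace ℂ E]
    [IsScalarTower ℝ ℂ E] : E →L[ℝ] E :=
  (I • ContinuousLinearMap.id ℂ E).restrictScalars ℝ

@[simp]
theorem mulI_apply {E : Type*} [NormedAddCommGroup E] [NormedSpace ℝ E] [NormedSpace ℂ E]
    [IsScalarTower ℝ ℂ E] (v : E) : mulI E v = I • v := rfl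

theorem mulI_mulI {E : Type*} [NormedAddCommGroup E] [NormedSpace ℝ E] [NormedSpace ℂ E]
    [IsScalarTower ℝ ℂ E] (v : E) : mulI E (mulI E v) = -v := by
  simp [smul_smul]

theorem fderiv_fderiv_form_apply {E : Type*} [NormedAddCommGroup E] [NormedSpace ℝ E] {k : ℕ}
    {η : E → E [⋀^Fin k]→L[ℝ] ℂ} (hη : ContDiff ℝ ∞ η) (x a b : E) (p : Fin k → E) :
    fderiv ℝ (fun z => fderiv ℝ (fun y => η y p) z b) x a =
      fderiv ℝ (fderiv ℝ η) x a b p := by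
  have h1 : ∀ z, fderiv ℝ (fun y => η y p) z b = fderiv ℝ η z b p := fun z =>
    fderiv_continuousAlternatingMap_apply_const_apply (hη.differentiable (by simp) z) p b
  have hη1 : Differentiable ℝ (fderiv ℝ η) :=
    (hη.fderiv_right (m := ∞) (by simp)).differentiable (by simp)
  simp only [h1]
  have h2 : DifferentiableAt ℝ (fun z => fderiv ℝ η z b) x :=
    (hη1 x).clm_apply (differentiableAt_const b)
  rw [fderiv_continuousAlternatingMap_apply_const_apply h2 p a,
    fderiv_clm_apply (hη1 x) (differentiableAt_const b)]
  simp

theorem fderiv_fderiv_form_symm {E : Type*} [NormedAddCommGroup E] [NormedSpace ℝ E] {k : ℕ}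
    {η : E → E [⋀^Fin k]→L[ℝ] ℂ} (hη : ContDiff ℝ ∞ η) (x a b : E) :
    fderiv ℝ (fderiv ℝ η) x a b = fderiv ℝ (fderiv ℝ η) x b a :=
  (hη.contDiffAt (x := x)).isSymmSndFDerivAt (by
      rw [minSmoothness_of_isRCLikeNormedField]; exact WithTop.coe_le_coe.2 le_top) a b

/-- The real basis of `ℂ³` given by the coordinate vectors and their multiples by `i`. -/
def realBasisVec : Fin 6 → ℂ × ℂ × ℂ :=
  ![(1, 0, 0), (I, 0, 0), (0, 1, 0), (0, I, 0), (0, 0, 1), (0, 0, I)]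

theorem contDiff_form_apply {E : Type*} [NormedAddCommGroup E] [NormedSpace ℝ E] {k : ℕ}
    {η : E → E [⋀^Fin k]→L[ℝ] ℂ} (hη : ContDiff ℝ ∞ η) (p : Fin k → E) :
    ContDiff ℝ ∞ fun z => η z p := by
  exact (ContinuousAlternatingMap.apply ℝ E ℂ p).contDiff.comp hη

/-- On `ℂ³`, a `4`-form that is bounded on the strips `‖z₁‖ ≤ R`, and whose component in the
directions of the last two coordinates is comparable to `e^{-ℓ(z₁)}` with `ℓ ≠ 0`, cannot satisfy
`d (J dη) = 0`. -/
theorem false_of_alternatization_eq_zero {η : ℂ × ℂ × ℂ → (ℂ × ℂ × ℂ) [⋀^Fin 4]→L[ℝ] ℂ}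
    (hη : ContDiff ℝ ∞ η)
    (hdd : ∀ x, alternatizeUncurryFin (alternatizeUncurryFinCLM ℝ (ℂ × ℂ × ℂ) ℂ ∘L
      (ContinuousLinearMap.compL ℝ (ℂ × ℂ × ℂ) (ℂ × ℂ × ℂ) ((ℂ × ℂ × ℂ) [⋀^Fin 4]→L[ℝ] ℂ)).flip
        (mulI _) ∘L fderiv ℝ (fderiv ℝ η) x) = 0)
    (hb : ∀ (p : Fin 4 → ℂ × ℂ × ℂ), StripBounded fun z => η z p)
    (ℓ : ℂ →L[ℝ] ℝ) (hℓ : 0 < ℓ 1 ^ 2 + ℓ I ^ 2) {c C : ℝ} (hc : 0 < c)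
    (hlow : ∀ x y,
      c * Real.exp (-ℓ x) ≤ (η (x, y) ![(0, 1, 0), (0, I, 0), (0, 0, 1), (0, 0, I)]).re)
    (hup : ∀ x y,
      (η (x, y) ![(0, 1, 0), (0, I, 0), (0, 0, 1), (0, 0, I)]).re ≤ C * Real.exp (-ℓ x)) :
    False := by
  set g : ℂ × ℂ × ℂ → ℂ := fun z => η z ![(0, 1, 0), (0, I, 0), (0, 0, 1), (0, 0, I)] with hg
  set rem : Fin 5 × Fin 5 → Fin 4 → ℂ × ℂ × ℂ := fun q =>
    q.2.removeNth (q.1.castSucc.removeNth realBasisVec) with hrem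
  set T : Fin 5 × Fin 5 → ℂ × ℂ × ℂ → ℂ := fun q z => (-1 : ℂ) ^ (q.1 + q.2 : ℕ) *
    (fderiv ℝ (fun z => fderiv ℝ (fun y => η y (rem q)) z (mulI _ (realBasisVec q.2.succ))) z
        (realBasisVec q.1.castSucc) -
      fderiv ℝ (fun z => fderiv ℝ (fun y => η y (rem q)) z (realBasisVec q.2.succ)) z
        (mulI _ (realBasisVec q.1.castSucc))) with hT
  set s : Finset (Fin 5 × Fin 5) := Finset.univ.filter fun q => q.1 ≤ q.2 with hs
  have hsum : ∀ z, ∑ q ∈ s, T q z = 0 := by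
    intro z
    have h1 := DFunLike.congr_fun (hdd z) realBasisVec
    rw [alternatizeUncurryFin_alternatizeUncurryFinCLM_comp_apply] at h1
    change _ = (0 : ℂ) at h1
    rw [hs, Finset.sum_filter, ← Finset.univ_product_univ, Finset.sum_product]
    refine Eq.trans ?_ h1
    refine Finset.sum_congr rfl fun i _ => ?_
    rw [← Finset.sum_filter, Finset.filter_le_eq_Ici]
    refine Finset.sum_congr rfl fun j _ => ?_
    simp only [hT, fderiv_fderiv_form_apply hη]
    rw [fderiv_fderiv_form_symm hη z (mulI _ (realBasisVec i.castSucc))]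
    simp [hrem]
  -- the term `(0, 0)` is minus the Laplacian of `g` in the first coordinate; each of the others
  -- contains a derivative in a direction of the last two coordinates
  have h00 : (0, 0) ∈ s := by simp [hs]
  have hmain : ∀ z, T (0, 0) z = -∑ i : Fin 2,
      fderiv ℝ (fun z => fderiv ℝ g z ((![1, I] : Fin 2 → ℂ) i, 0)) z
        ((![1, I] : Fin 2 → ℂ) i, 0) := by
    intro z
    have hrem0 : rem (0, 0) = ![(0, 1, 0), (0, I, 0), (0, 0, 1), (0, 0, I)] := by
      funext i
      fin_cases i <;> rfl
    have hv1 : mulI (ℂ × ℂ × ℂ) (I, 0, 0) = -(1, 0, 0) := by simp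
    have hv0 : mulI (ℂ × ℂ × ℂ) (1, 0, 0) = (I, 0, 0) := by simp
    have e0 : realBasisVec ((0 : Fin 5).castSucc) = (1, 0, 0) := rfl
    have e1 : realBasisVec ((0 : Fin 5).succ) = (I, 0, 0) := rfl
    simp only [hT, hrem0, Fin.sum_univ_two, e0, e1, hv0, hv1, map_neg]
    simp only [hg]
    have hneg : ∀ z, fderiv ℝ (fun z => -fderiv ℝ g z ((1, 0, 0) : ℂ × ℂ × ℂ)) z
        ((1, 0, 0) : ℂ × ℂ × ℂ) = -fderiv ℝ (fun z => fderiv ℝ g z ((1, 0, 0) : ℂ × ℂ × ℂ)) z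
        ((1, 0, 0) : ℂ × ℂ × ℂ) := by
      intro z
      rw [fderiv_fun_neg]
      rfl
    simp only [hg] at hneg
    rw [hneg]
    exact (by intro a b; simp; ring : ∀ a b : ℂ, (-1 : ℂ) ^ ((0 : Fin 5) + (0 : Fin 5) : ℕ) *
      (-a - b) = -(a + b)) _ _
  have hrest : ∀ q ∈ s.erase (0, 0),
      AveragesToZero volume ((volume : Measure ℂ).prod volume) (T q) := by
    rintro ⟨i, j⟩ hq
    rw [Finset.mem_erase, hs, Finset.mem_filter] at hq
    have hj : j ≠ 0 := by
      rintro rfl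
      exact hq.1 (Prod.ext (Fin.le_zero_iff.1 hq.2.2) rfl)
    have hGs := contDiff_form_apply hη (rem (i, j))
    obtain ⟨y, hy⟩ : ∃ y : ℂ × ℂ, realBasisVec j.succ = (0, y) := by
      fin_cases j
      · exact absurd rfl hj
      all_goals exact ⟨_, rfl⟩
    have hJy : mulI (ℂ × ℂ × ℂ) (0, y) = (0, I • y) := by simp
    have a1 := averagesToZero_fderiv_fderiv (μ := (volume : Measure ℂ))
      (ν := ((volume : Measure ℂ).prod volume)) hGs (hb _) (realBasisVec i.castSucc) (I • y)
    have a2 := averagesToZero_fderiv_fderiv (μ := (volume : Measure ℂ))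
      (ν := ((volume : Measure ℂ).prod volume)) hGs (hb _) (mulI _ (realBasisVec i.castSucc)) y
    have hc2 : ∀ a b, Continuous fun z =>
        fderiv ℝ (fun z => fderiv ℝ (fun y => η y (rem (i, j))) z b) z a := fun a b =>
      (contDiff_fderiv_apply (contDiff_fderiv_apply hGs b) a).continuous
    have a3 := (a1.add (a2.const_mul (-1)) (hc2 _ _) ((hc2 _ _).const_mul _)).const_mul
      ((-1 : ℂ) ^ (i + j : ℕ))
    refine a3.congr fun z => ?_
    simp only [hT, hy, hJy]
    ring
  have hTc : ∀ q, Continuous (T q) := by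
    intro q
    have hGs := contDiff_form_apply hη (rem q)
    have hc2 : ∀ a b, Continuous fun z =>
        fderiv ℝ (fun z => fderiv ℝ (fun y => η y (rem q)) z b) z a := fun a b =>
      (contDiff_fderiv_apply (contDiff_fderiv_apply hGs b) a).continuous
    exact continuous_const.mul ((hc2 _ _).sub (hc2 _ _))
  have havg := AveragesToZero.sum (s.erase (0, 0)) hrest fun q _ => hTc q
  refine not_averagesToZero_of_exp (μ := (volume : Measure ℂ))
    (ν := ((volume : Measure ℂ).prod volume)) ℓ (contDiff_form_apply hη _) hc hlow hup (![1, I] : Fin 2 → ℂ)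
    (by simpa [Fin.sum_univ_two] using hℓ) ?_
  refine havg.congr fun z => ?_
  have h2 := hsum z
  rw [← Finset.add_sum_erase _ _ h00, hmain] at h2
  linear_combination h2

end SecondOrder

/-! ### Divergences of bounded fields -/

section Divergences

set_option linter.unusedSectionVars false

open MeasureTheory Filter Topology Module

variable {X Y : Type*} [NormedAddCommGroup X] [NormedSpace ℝ X] [FiniteDimensional ℝ X]
  [MeasurableSpace X] [BorelSpace X] [NormedAddCommGroup Y] [NormedSpace ℝ Y]
  [FiniteDimensional ℝ Y] [MeasurableSpace Y] [BorelSpace Y]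
  {μ : Measure X} {ν : Measure Y} [μ.IsAddHaarMeasure] [ν.IsAddHaarMeasure]

/-- `f` is, up to a function that averages to zero, a finite sum of derivatives of bounded functions
in directions of the first variable. -/
def IsDivergence (μ : Measure X) (ν : Measure Y) (f : X × Y → ℂ) : Prop :=
  Continuous f ∧ ∃ (ι : Type) (_ : Fintype ι) (F : ι → X × Y → ℂ) (u : ι → X) (C : ℝ),
    (∀ i, ContDiff ℝ ∞ (F i)) ∧ (∀ i z, ‖F i z‖ ≤ C) ∧
      AveragesToZero μ ν fun z => f z - ∑ i, fderiv ℝ (F i) z (u i, 0)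

theorem continuous_fderiv_apply_const {E F : Type*} [NormedAddCommGroup E]
    [NormedSpace ℝ E] [NormedAddCommGroup F] [NormedSpace ℝ F] {f : E → F} (hf : ContDiff ℝ ∞ f)
    (v : E) : Continuous fun x => fderiv ℝ f x v :=
  (contDiff_fderiv_apply hf v).continuous

theorem IsDivergence.add {f g : X × Y → ℂ} (hf : IsDivergence μ ν f) (hg : IsDivergence μ ν g) :
    IsDivergence μ ν fun z => f z + g z := by
  obtain ⟨hfc, ι, _, F, u, C, hF, hC, h⟩ := hf
  obtain ⟨hgc, κ, _, G, v, D, hG, hD, h'⟩ := hg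
  refine ⟨hfc.add hgc, ι ⊕ κ, inferInstance, Sum.elim F G, Sum.elim u v, max C D, ?_, ?_, ?_⟩
  · rintro (i | i)
    exacts [hF i, hG i]
  · rintro (i | i) z
    exacts [(hC i z).trans (le_max_left _ _), (hD i z).trans (le_max_right _ _)]
  · refine (h.add h' ?_ ?_).congr fun z => ?_
    · exact hfc.sub (continuous_finsetSum _ fun i _ => continuous_fderiv_apply_const (hF i) _)
    · exact hgc.sub (continuous_finsetSum _ fun i _ => continuous_fderiv_apply_const (hG i) _)
    · simp only [Fintype.sum_sum_type, Sum.elim_inl, Sum.elim_inr]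
      ring

theorem IsDivergence.const_mul {f : X × Y → ℂ} (hf : IsDivergence μ ν f) (c : ℂ) :
    IsDivergence μ ν fun z => c * f z := by
  obtain ⟨hfc, ι, _, F, u, C, hF, hC, h⟩ := hf
  refine ⟨continuous_const.mul hfc, ι, inferInstance, fun i z => c * F i z, u, ‖c‖ * C,
    fun i => contDiff_const.mul (hF i), fun i z => ?_, (h.const_mul c).congr fun z => ?_⟩
  · rw [norm_mul]
    exact mul_le_mul_of_nonneg_left (hC i z) (norm_nonneg _)
  · rw [mul_sub, Finset.mul_sum]
    congr 1
    refine Finset.sum_congr rfl fun i _ => ?_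
    rw [fderiv_const_mul ((hF i).differentiable (by simp) z)]
    simp

theorem IsDivergence.congr {f g : X × Y → ℂ} (hf : IsDivergence μ ν f) (h : ∀ z, f z = g z) :
    IsDivergence μ ν g :=
  funext h ▸ hf

theorem isDivergence_of_averagesToZero {f : X × Y → ℂ} (hfc : Continuous f)
    (hf : AveragesToZero μ ν f) : IsDivergence μ ν f :=
  ⟨hfc, Empty, inferInstance, fun i => i.elim, fun i => i.elim, 0, fun i => i.elim,
    fun i => i.elim, hf.congr fun z => by simp⟩

theorem isDivergence_fderiv_fst {F : X × Y → ℂ} (hF : ContDiff ℝ ∞ F) {C : ℝ}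
    (hC : ∀ z, ‖F z‖ ≤ C) (u : X) : IsDivergence μ ν fun z => fderiv ℝ F z (u, 0) := by
  refine ⟨continuous_fderiv_apply_const hF _, Unit, inferInstance, fun _ => F, fun _ => u, C,
    fun _ => hF, fun _ => hC, ?_⟩
  have h := AveragesToZero.sum (μ := μ) (ν := ν) (X := X) (Y := Y) (∅ : Finset Unit)
    (f := fun _ _ => 0) (by simp) (by simp)
  exact h.congr fun z => by simp

theorem isDivergence_smul_fderiv_snd {κ : X → ℝ} (hκ : ContDiff ℝ ∞ κ) {F : X × Y → ℂ}
    (hF : ContDiff ℝ ∞ F) {C : ℝ} (hC : ∀ z, ‖F z‖ ≤ C) (v : Y) :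
    IsDivergence μ ν fun z => κ z.1 • fderiv ℝ F z (0, v) :=
  isDivergence_of_averagesToZero
    ((hκ.continuous.comp continuous_fst).smul (continuous_fderiv_apply_const hF _))
    (averagesToZero_fderiv_snd hκ hF (fun _ => ⟨C, fun x y _ => hC (x, y)⟩) v)

/-- A function bounded below by a positive constant is not a divergence. -/
theorem IsDivergence.false_of_pos {f : X × Y → ℂ} (hf : IsDivergence μ ν f) {c : ℝ} (hc : 0 < c)
    (hpos : ∀ z, c ≤ (f z).re) : False := by
  obtain ⟨hfc, ι, _, F, u, C, hF, hC, h⟩ := hf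
  refine not_averagesToZero_of_pos hfc hc hpos (F := fun i z => -F i z) (C := C)
    (fun i => (hF i).neg) (by simpa using hC) u (h.congr fun z => ?_)
  rw [sub_eq_add_neg, ← Finset.sum_neg_distrib]
  congr 1
  refine Finset.sum_congr rfl fun i _ => ?_
  rw [fderiv_fun_neg]
  rfl

end Divergences

/-! ### Smooth fields of forms -/

section SmoothForms

theorem contDiff_form_apply_fields {E V : Type*} [NormedAddCommGroup E] [NormedSpace ℝ E]
    [NormedAddCommGroup V] [NormedSpace ℝ V] {k : ℕ}
    {η : E → V [⋀^Fin k]→L[ℝ] ℂ} (hη : ContDiff ℝ ∞ η) {W : E → Fin k → V}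
    (hW : ∀ i, ContDiff ℝ ∞ fun z => W z i) : ContDiff ℝ ∞ fun z => η z (W z) := by
  let B : (V [⋀^Fin k]→L[ℝ] ℂ) →L[ℝ] ContinuousMultilinearMap ℝ (fun _ : Fin k => V) ℂ :=
    ContinuousAlternatingMap.toContinuousMultilinearMapCLM ℝ
  have h1 : ContDiff ℝ ∞ fun p : (V [⋀^Fin k]→L[ℝ] ℂ) × (Fin k → V) => B p.1 p.2 := by
    rw [← contDiffOn_univ]
    exact (B.analyticOnNhd_uncurry_of_multilinear (s := Set.univ)).contDiffOn uniqueDiffOn_univ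
  exact h1.comp (hη.prodMk (contDiff_pi.2 hW))

/-- A field of forms on a finite-dimensional space is smooth if its values on constant vectors
are. -/
theorem contDiff_form_of_apply {E V : Type*} [NormedAddCommGroup E] [NormedSpace ℝ E]
    [NormedAddCommGroup V] [NormedSpace ℝ V] [FiniteDimensional ℝ V] {k : ℕ}
    {η : E → V [⋀^Fin k]→L[ℝ] ℂ} (hη : ∀ v, ContDiff ℝ ∞ fun z => η z v) : ContDiff ℝ ∞ η := by
  let b := Module.finBasis ℝ V
  let ev : (V [⋀^Fin k]→L[ℝ] ℂ) →ₗ[ℝ] ((Fin k → Fin (Module.finrank ℝ V)) → ℂ) :=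
    { toFun := fun α s => α fun i => b (s i)
      map_add' := fun _ _ => rfl
      map_smul' := fun _ _ => rfl }
  have hinj : Function.Injective ev := by
    intro α β h
    refine ContinuousAlternatingMap.toAlternatingMap_injective ?_
    exact AlternatingMap.coe_multilinearMap_injective
      (Module.Basis.ext_multilinear (fun _ => b) fun s => congrFun h s)
  obtain ⟨g, hg⟩ := ev.exists_leftInverse_of_injective (LinearMap.ker_eq_bot.2 hinj)
  have h1 : η = fun z => g.toContinuousLinearMap (ev (η z)) :=
    funext fun z => (LinearMap.congr_fun hg (η z)).symm
  rw [h1]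
  exact (ContinuousLinearMap.contDiff _).comp (contDiff_pi.2 fun s => hη _)

theorem contDiff_compContinuousLinearMap {E V W : Type*} [NormedAddCommGroup E] [NormedSpace ℝ E]
    [NormedAddCommGroup V] [NormedSpace ℝ V] [NormedAddCommGroup W] [NormedSpace ℝ W]
    [FiniteDimensional ℝ W] {k : ℕ} {η : E → V [⋀^Fin k]→L[ℝ] ℂ} (hη : ContDiff ℝ ∞ η)
    {A : E → W →L[ℝ] V} (hA : ContDiff ℝ ∞ A) :
    ContDiff ℝ ∞ fun z => (η z).compContinuousLinearMap (A z) :=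
  contDiff_form_of_apply fun v => contDiff_form_apply_fields (W := fun z i => A z (v i)) hη
    fun _ => hA.clm_apply contDiff_const

theorem contDiff_extDeriv {E : Type*} [NormedAddCommGroup E] [NormedSpace ℝ E]
    {k : ℕ} {η : E → E [⋀^Fin k]→L[ℝ] ℂ} (hη : ContDiff ℝ ∞ η) : ContDiff ℝ ∞ (extDeriv η) := by
  have h : extDeriv η = fun x =>
    ContinuousAlternatingMap.alternatizeUncurryFinCLM ℝ E ℂ (fderiv ℝ η x) := rfl
  rw [h]
  exact (ContinuousLinearMap.contDiff _).comp (hη.fderiv_right (m := ∞) (by simp))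

end SmoothForms

/-! ### `2`-forms on `ℂ² × ℂ` in a two-step nilpotent frame -/

section HorizontalFields

open MeasureTheory Filter Topology Module VectorField

/-- The vector field `(x, y) ↦ (v, K x v)`. When `K x v` is complex linear in `v`, the fields
`horizontalField K v` and the constant fields `(0, s)` form a frame of `ℂ² × ℂ` that is compatible
with the standard complex structure, and
`[horizontalField K u, horizontalField K v] = (0, K u v - K v u)`. -/
def horizontalField (K : ℂ × ℂ →L[ℝ] ℂ × ℂ →L[ℝ] ℂ) (v : ℂ × ℂ) (z : (ℂ × ℂ) × ℂ) :
    (ℂ × ℂ) × ℂ :=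
  (v, K z.1 v)

variable {K : ℂ × ℂ →L[ℝ] ℂ × ℂ →L[ℝ] ℂ}

theorem contDiff_horizontalField (v : ℂ × ℂ) : ContDiff ℝ ∞ (horizontalField K v) := by
  unfold horizontalField
  fun_prop

theorem fderiv_horizontalField (v : ℂ × ℂ) (z w : (ℂ × ℂ) × ℂ) :
    fderiv ℝ (horizontalField K v) z w = (0, K w.1 v) := by
  have h : HasFDerivAt (horizontalField K v)
      ((0 : (ℂ × ℂ) × ℂ →L[ℝ] ℂ × ℂ).prod
        (K.flip v ∘L ContinuousLinearMap.fst ℝ (ℂ × ℂ) ℂ)) z :=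
    (hasFDerivAt_const v z).prodMk (K.flip v ∘L ContinuousLinearMap.fst ℝ (ℂ × ℂ) ℂ).hasFDerivAt
  rw [h.fderiv]
  rfl

theorem lieBracket_horizontalField (u v : ℂ × ℂ) (z : (ℂ × ℂ) × ℂ) :
    lieBracket ℝ (horizontalField K u) (horizontalField K v) z = (0, K u v - K v u) := by
  rw [lieBracket, fderiv_horizontalField, fderiv_horizontalField]
  simp [horizontalField]

theorem lieBracket_const_horizontalField (s : ℂ) (v : ℂ × ℂ) (z : (ℂ × ℂ) × ℂ) :
    lieBracket ℝ (fun _ => ((0 : ℂ × ℂ), s)) (horizontalField K v) z = 0 := by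
  rw [lieBracket, fderiv_horizontalField]
  simp

theorem isDivergence_fderiv_horizontalField {F : (ℂ × ℂ) × ℂ → ℂ} (hF : ContDiff ℝ ∞ F) {C : ℝ}
    (hC : ∀ z, ‖F z‖ ≤ C) (v : ℂ × ℂ) :
    IsDivergence ((volume : Measure ℂ).prod volume) volume
      fun z => fderiv ℝ F z (horizontalField K v z) := by
  have h1 := isDivergence_fderiv_fst (μ := (volume : Measure ℂ).prod volume)
    (ν := (volume : Measure ℂ)) hF hC v
  have h2 := isDivergence_smul_fderiv_snd (μ := (volume : Measure ℂ).prod volume)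
    (ν := (volume : Measure ℂ)) (κ := fun x => (K x v).re)
    (reCLM.contDiff.comp (K.flip v).contDiff) hF hC 1
  have h3 := isDivergence_smul_fderiv_snd (μ := (volume : Measure ℂ).prod volume)
    (ν := (volume : Measure ℂ)) (κ := fun x => (K x v).im)
    (imCLM.contDiff.comp (K.flip v).contDiff) hF hC I
  refine ((h1.add h2).add h3).congr fun z => ?_
  rw [← map_smul, ← map_smul, ← map_add, ← map_add]
  congr 1
  ext1
  · simp [horizontalField]
  · simp [horizontalField]

theorem sum_sum_Ici_fin_two (f : Fin 2 → Fin 2 → ℂ) :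
    ∑ i, ∑ j ≥ i, f i j = f 0 0 + f 0 1 + f 1 1 := by
  have h0 : Finset.Ici (0 : Fin 2) = {0, 1} := by decide
  have h1 : Finset.Ici (1 : Fin 2) = {1} := by decide
  rw [Fin.sum_univ_two, h0, h1, Finset.sum_pair (by decide), Finset.sum_singleton]

theorem sum_sum_Ici_fin_three (f : Fin 3 → Fin 3 → ℂ) :
    ∑ i, ∑ j ≥ i, f i j = f 0 0 + f 0 1 + f 0 2 + f 1 1 + f 1 2 + f 2 2 := by
  have h0 : Finset.Ici (0 : Fin 3) = {0, 1, 2} := by decide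
  have h1 : Finset.Ici (1 : Fin 3) = {1, 2} := by decide
  have h2 : Finset.Ici (2 : Fin 3) = {2} := by decide
  rw [Fin.sum_univ_three, h0, h1, h2, Finset.sum_insert (by decide), Finset.sum_pair (by decide),
    Finset.sum_pair (by decide), Finset.sum_singleton]
  ring

/-- Cartan's formula for the exterior derivative of a `2`-form. -/
theorem extDeriv_two_apply_vectorField {E : Type*} [NormedAddCommGroup E] [NormedSpace ℝ E]
    {η : E → E [⋀^Fin 2]→L[ℝ] ℂ} (hη : Differentiable ℝ η) {A B C : E → E}
    (hA : Differentiable ℝ A) (hB : Differentiable ℝ B) (hC : Differentiable ℝ C) (z : E) :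
    extDeriv η z ![A z, B z, C z] =
      fderiv ℝ (fun z => η z ![B z, C z]) z (A z) - fderiv ℝ (fun z => η z ![A z, C z]) z (B z) +
        fderiv ℝ (fun z => η z ![A z, B z]) z (C z) -
        (η z ![lieBracket ℝ A B z, C z] - η z ![lieBracket ℝ A C z, B z] +
          η z ![lieBracket ℝ B C z, A z]) := by
  have h := extDeriv_apply_vectorField (𝕜 := ℝ) (x := z) (V := ![A, B, C])
    (hη z) (by
      intro i
      fin_cases i
      exacts [hA z, hB z, hC z])
  have e : ∀ z, (fun x => (![A, B, C] : Fin 3 → E → E) x z) = ![A z, B z, C z] := by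
    intro z
    funext i
    fin_cases i <;> rfl
  have r0 : ∀ a b c : E, (0 : Fin 3).removeNth ![a, b, c] = ![b, c] := fun a b c => by
    funext i; fin_cases i <;> rfl
  have r1 : ∀ a b c : E, (1 : Fin 3).removeNth ![a, b, c] = ![a, c] := fun a b c => by
    funext i; fin_cases i <;> rfl
  have r2 : ∀ a b c : E, (2 : Fin 3).removeNth ![a, b, c] = ![a, b] := fun a b c => by
    funext i; fin_cases i <;> rfl
  have s0 : ∀ a b : E, (0 : Fin 2).removeNth ![a, b] = ![b] := fun a b => by
    funext i; fin_cases i; rfl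
  have s1 : ∀ a b : E, (1 : Fin 2).removeNth ![a, b] = ![a] := fun a b => by
    funext i; fin_cases i; rfl
  rw [sum_sum_Ici_fin_two, Fin.sum_univ_three] at h
  simp only [e, r0, r1, r2, s0, s1, Fin.castSucc_zero, Fin.castSucc_one] at h
  rw [h]
  simp
  ring

/-- Cartan's formula for the exterior derivative of a `3`-form. -/
theorem extDeriv_three_apply_vectorField {E : Type*} [NormedAddCommGroup E] [NormedSpace ℝ E]
    {η : E → E [⋀^Fin 3]→L[ℝ] ℂ} (hη : Differentiable ℝ η) {A B C D : E → E}
    (hA : Differentiable ℝ A) (hB : Differentiable ℝ B) (hC : Differentiable ℝ C)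
    (hD : Differentiable ℝ D) (z : E) :
    extDeriv η z ![A z, B z, C z, D z] =
      fderiv ℝ (fun z => η z ![B z, C z, D z]) z (A z) -
        fderiv ℝ (fun z => η z ![A z, C z, D z]) z (B z) +
        fderiv ℝ (fun z => η z ![A z, B z, D z]) z (C z) -
        fderiv ℝ (fun z => η z ![A z, B z, C z]) z (D z) -
        (η z ![lieBracket ℝ A B z, C z, D z] - η z ![lieBracket ℝ A C z, B z, D z] +
          η z ![lieBracket ℝ A D z, B z, C z] + η z ![lieBracket ℝ B C z, A z, D z] -
          η z ![lieBracket ℝ B D z, A z, C z] + η z ![lieBracket ℝ C D z, A z, B z]) := by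
  have h := extDeriv_apply_vectorField (𝕜 := ℝ) (x := z) (V := ![A, B, C, D])
    (hη z) (by
      intro i
      fin_cases i
      exacts [hA z, hB z, hC z, hD z])
  have e : ∀ z, (fun x => (![A, B, C, D] : Fin 4 → E → E) x z) = ![A z, B z, C z, D z] := by
    intro z
    funext i
    fin_cases i <;> rfl
  have r0 : ∀ a b c d : E, (0 : Fin 4).removeNth ![a, b, c, d] = ![b, c, d] := fun a b c d => by
    funext i; fin_cases i <;> rfl
  have r1 : ∀ a b c d : E, (1 : Fin 4).removeNth ![a, b, c, d] = ![a, c, d] := fun a b c d => by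
    funext i; fin_cases i <;> rfl
  have r2 : ∀ a b c d : E, (2 : Fin 4).removeNth ![a, b, c, d] = ![a, b, d] := fun a b c d => by
    funext i; fin_cases i <;> rfl
  have r3 : ∀ a b c d : E, (3 : Fin 4).removeNth ![a, b, c, d] = ![a, b, c] := fun a b c d => by
    funext i; fin_cases i <;> rfl
  have s0 : ∀ a b c : E, (0 : Fin 3).removeNth ![a, b, c] = ![b, c] := fun a b c => by
    funext i; fin_cases i <;> rfl
  have s1 : ∀ a b c : E, (1 : Fin 3).removeNth ![a, b, c] = ![a, c] := fun a b c => by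
    funext i; fin_cases i <;> rfl
  have s2 : ∀ a b c : E, (2 : Fin 3).removeNth ![a, b, c] = ![a, b] := fun a b c => by
    funext i; fin_cases i <;> rfl
  have c2 : (2 : Fin 3).castSucc = (2 : Fin 4) := rfl
  rw [sum_sum_Ici_fin_three, Fin.sum_univ_four] at h
  simp only [e, r0, r1, r2, r3, s0, s1, s2, Fin.castSucc_zero, Fin.castSucc_one, c2] at h
  rw [h]
  simp
  ring

theorem extDeriv_apply_horizontalField {η : (ℂ × ℂ) × ℂ → ((ℂ × ℂ) × ℂ) [⋀^Fin 2]→L[ℝ] ℂ}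
    (hη : ContDiff ℝ ∞ η) (s : ℂ) (u v : ℂ × ℂ) (z : (ℂ × ℂ) × ℂ) :
    extDeriv η z ![(0, s), horizontalField K u z, horizontalField K v z] =
      fderiv ℝ (fun z => η z ![horizontalField K u z, horizontalField K v z]) z (0, s) -
        fderiv ℝ (fun z => η z ![(0, s), horizontalField K v z]) z (horizontalField K u z) +
        fderiv ℝ (fun z => η z ![(0, s), horizontalField K u z]) z (horizontalField K v z) -
        η z ![(0, K u v - K v u), (0, s)] := by
  have hd : ∀ v, Differentiable ℝ (horizontalField K v) := fun v =>
    (contDiff_horizontalField v).differentiable (by simp)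
  have h := extDeriv_two_apply_vectorField (hη.differentiable (by simp))
    (differentiable_const ((0 : ℂ × ℂ), s)) (hd u) (hd v) z
  rw [h, lieBracket_const_horizontalField, lieBracket_const_horizontalField,
    lieBracket_horizontalField]
  have h0 : ∀ w, η z ![0, w] = 0 := fun w => (η z).map_coord_zero 0 rfl
  rw [h0, h0]
  ring

/-- On `ℂ² × ℂ`, with the frame of the fields `horizontalField K v` and `(0, s)`, a positive
`(1,1)`-form whose coefficients, and those of its exterior derivative, are bounded cannot satisfy
`d (J dη) = 0` if the brackets `c u v = K u v - K v u` satisfy `hpos`. Indeed, up to divergences the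
value of `d (J dη)` on the horizontal fields of `y`, `i y`, `w` and `i w` is, up to sign, the product
of the coefficient `G` of `η` along the vertical fields with the quantity in `hpos`. -/
theorem false_of_extDeriv_comp_extDeriv_eq_zero
    {η : (ℂ × ℂ) × ℂ → ((ℂ × ℂ) × ℂ) [⋀^Fin 2]→L[ℝ] ℂ} (hη : ContDiff ℝ ∞ η)
    (hdd : ∀ z, extDeriv (fun y => (extDeriv η y).compContinuousLinearMap (mulI _)) z = 0)
    (hK : ∀ x v, K x (I • v) = I * K x v)
    (hb : ∀ u v, ∃ C : ℝ, ∀ z, ‖η z ![horizontalField K u z, horizontalField K v z]‖ ≤ C)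
    (hb' : ∀ s v, ∃ C : ℝ, ∀ z, ‖η z ![(0, s), horizontalField K v z]‖ ≤ C)
    (hb'' : ∀ u v w, ∃ C : ℝ, ∀ z,
      ‖extDeriv η z ![horizontalField K u z, horizontalField K v z, horizontalField K w z]‖ ≤ C)
    {G : (ℂ × ℂ) × ℂ → ℝ} {c₀ : ℝ} (hc₀ : 0 < c₀) (hG : ∀ z, c₀ ≤ G z)
    (hηG : ∀ z a b, η z ![(0, a), (0, b)] = G z * (conj a * b).im)
    {c : ℂ × ℂ → ℂ × ℂ → ℂ} (hc : ∀ u v, c u v = K u v - K v u) (y w : ℂ × ℂ)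
    (hpos : 0 < ‖c y w‖ ^ 2 + ‖c (I • y) (I • w)‖ ^ 2 + ‖c y (I • w)‖ ^ 2 + ‖c (I • y) w‖ ^ 2 -
      2 * (conj (c y (I • y)) * c w (I • w)).re) : False := by
  have hIE : ∀ v z, mulI ((ℂ × ℂ) × ℂ) (horizontalField K v z) = horizontalField K (I • v) z :=
    fun v z => by simp [horizontalField, hK]
  have hd : ∀ v, Differentiable ℝ (horizontalField K v) := fun v =>
    (contDiff_horizontalField v).differentiable (by simp)
  have hdη := contDiff_extDeriv hη
  set τ : (ℂ × ℂ) × ℂ → ((ℂ × ℂ) × ℂ) [⋀^Fin 3]→L[ℝ] ℂ :=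
    fun y => (extDeriv η y).compContinuousLinearMap (mulI _) with hτ
  have hτs : ContDiff ℝ ∞ τ := contDiff_compContinuousLinearMap hdη contDiff_const
  have hτ3 : ∀ u v w z, τ z ![horizontalField K u z, horizontalField K v z, horizontalField K w z] =
      extDeriv η z ![horizontalField K (I • u) z, horizontalField K (I • v) z,
        horizontalField K (I • w) z] := by
    intro u v w z
    simp only [hτ, ContinuousAlternatingMap.compContinuousLinearMap_apply, ← hIE]
    congr 1
    funext i
    fin_cases i <;> rfl
  have hτ2 : ∀ s v w z, τ z ![(0, s), horizontalField K v z, horizontalField K w z] =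
      extDeriv η z ![(0, I * s), horizontalField K (I • v) z, horizontalField K (I • w) z] := by
    intro u v w z
    simp only [hτ, ContinuousAlternatingMap.compContinuousLinearMap_apply, ← hIE]
    congr 1
    funext i
    fin_cases i
    · simp
    · rfl
    · rfl
  have hD : ∀ {n : ℕ} {F : (ℂ × ℂ) × ℂ → ((ℂ × ℂ) × ℂ) [⋀^Fin n]→L[ℝ] ℂ} (_ : ContDiff ℝ ∞ F)
      {W : (ℂ × ℂ) × ℂ → Fin n → (ℂ × ℂ) × ℂ} (_ : ∀ i, ContDiff ℝ ∞ fun z => W z i)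
      (_ : ∃ C : ℝ, ∀ z, ‖F z (W z)‖ ≤ C) (a : ℂ × ℂ),
      IsDivergence ((volume : Measure ℂ).prod volume) volume
        fun z => fderiv ℝ (fun z => F z (W z)) z (horizontalField K a z) := by
    rintro n F hF W hW ⟨C, hC⟩ a
    exact isDivergence_fderiv_horizontalField (contDiff_form_apply_fields hF hW) hC a
  have hW2 : ∀ u v (i : Fin 2), ContDiff ℝ ∞ fun z =>
      (![horizontalField K u z, horizontalField K v z] : Fin 2 → (ℂ × ℂ) × ℂ) i := by
    intro u v i
    fin_cases i
    exacts [contDiff_horizontalField u, contDiff_horizontalField v]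
  have hW2' : ∀ s v (i : Fin 2), ContDiff ℝ ∞ fun z =>
      (![(0, s), horizontalField K v z] : Fin 2 → (ℂ × ℂ) × ℂ) i := by
    intro s v i
    fin_cases i
    exacts [contDiff_const, contDiff_horizontalField v]
  have hW3 : ∀ u v w (i : Fin 3), ContDiff ℝ ∞ fun z =>
      (![horizontalField K u z, horizontalField K v z, horizontalField K w z] :
        Fin 3 → (ℂ × ℂ) × ℂ) i := by
    intro u v w i
    fin_cases i
    exacts [contDiff_horizontalField u, contDiff_horizontalField v, contDiff_horizontalField w]
  have h3 : ∀ u v w a, IsDivergence ((volume : Measure ℂ).prod volume) volume fun z =>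
      fderiv ℝ (fun z => τ z ![horizontalField K u z, horizontalField K v z,
        horizontalField K w z]) z (horizontalField K a z) := by
    intro u v w a
    refine hD hτs (hW3 u v w) ?_ a
    obtain ⟨C, hC⟩ := hb'' (I • u) (I • v) (I • w)
    exact ⟨C, fun z => by rw [hτ3]; exact hC z⟩
  have h2 : ∀ s u v, IsDivergence ((volume : Measure ℂ).prod volume) volume fun z =>
      τ z ![(0, s), horizontalField K u z, horizontalField K v z] +
        G z * (conj (c (I • u) (I • v)) * s).re := by
    intro s u v
    obtain ⟨C, hC⟩ := hb (I • u) (I • v)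
    have a1 := isDivergence_smul_fderiv_snd (μ := (volume : Measure ℂ).prod volume)
      (ν := (volume : Measure ℂ)) (κ := fun _ => 1) contDiff_const
      (contDiff_form_apply_fields hη (hW2 (I • u) (I • v))) hC (I * s)
    have a2 := hD hη (hW2' (I * s) (I • v)) (hb' _ _) (I • u)
    have a3 := hD hη (hW2' (I * s) (I • u)) (hb' _ _) (I • v)
    refine ((a1.add (a2.const_mul (-1))).add a3).congr fun z => ?_
    rw [hτ2, extDeriv_apply_horizontalField hη, hηG, ← hc]
    have e : (conj (c (I • u) (I • v)) * (I * s)).im = (conj (c (I • u) (I • v)) * s).re := by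
      simp [mul_im, mul_re]
    rw [e]
    simp only [one_smul]
    ring
  set E := horizontalField K with hE
  have hlie : ∀ u v z, lieBracket ℝ (E u) (E v) z = (0, c u v) := fun u v z => by
    rw [hE, lieBracket_horizontalField, hc]
  have hII : ∀ v : ℂ × ℂ, I • I • v = -v := fun v => by simp [smul_smul]
  have cl : ∀ u v, c (-u) v = -c u v := fun u v => by simp [hc]; ring
  have cr : ∀ u v, c u (-v) = -c u v := fun u v => by simp [hc]; ring
  have cs : ∀ u v, c v u = -c u v := fun u v => by simp [hc]
  -- the terms of `d τ` on the four fields that differentiate along one of them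
  have hq := ((((h3 (I • y) w (I • w) y).add ((h3 y w (I • w) (I • y)).const_mul (-1))).add
    (h3 y (I • y) (I • w) w)).add ((h3 y (I • y) w (I • w)).const_mul (-1)))
  -- the terms of `d τ` that contain a bracket of two of the fields
  have hr := (((((h2 (c y (I • y)) w (I • w)).add ((h2 (c y w) (I • y) (I • w)).const_mul (-1))).add
    (h2 (c y (I • w)) (I • y) w)).add (h2 (c (I • y) w) y (I • w))).add
    ((h2 (c (I • y) (I • w)) y w).const_mul (-1))).add (h2 (c w (I • w)) y (I • y))
  have hfin := (hq.add (hr.const_mul (-1)))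
  set Q := ‖c y w‖ ^ 2 + ‖c (I • y) (I • w)‖ ^ 2 + ‖c y (I • w)‖ ^ 2 + ‖c (I • y) w‖ ^ 2 -
      2 * (conj (c y (I • y)) * c w (I • w)).re with hQ
  have hf : IsDivergence ((volume : Measure ℂ).prod volume) volume
      fun z => ((G z * Q : ℝ) : ℂ) := by
    refine hfin.congr fun z => ?_
    have h0 := extDeriv_three_apply_vectorField (hτs.differentiable (by simp)) (hd y)
      (hd (I • y)) (hd w) (hd (I • w)) z
    rw [hdd] at h0
    simp only [hlie] at h0
    change (0 : ℂ) = _ at h0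
    have hn : ∀ a : ℂ, (conj a * a).re = ‖a‖ ^ 2 := fun a => by
      rw [← normSq_eq_conj_mul_self, ofReal_re, normSq_eq_norm_sq]
    have n1 : (conj (c (I • w) (I • I • w)) * c y (I • y)).re =
        (conj (c y (I • y)) * c w (I • w)).re := by
      rw [hII, cr, cs w, neg_neg]
      simp [mul_re]
      ring
    have n2 : (conj (c (I • y) (I • I • y)) * c w (I • w)).re =
        (conj (c y (I • y)) * c w (I • w)).re := by
      rw [hII, cr, cs y, neg_neg]
    have n3 : (conj (c (I • I • y) (I • I • w)) * c y w).re = ‖c y w‖ ^ 2 := by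
      rw [hII, hII, cr, cl, neg_neg, hn]
    have n4 : (conj (c (I • I • y) (I • w)) * c y (I • w)).re = -‖c y (I • w)‖ ^ 2 := by
      rw [hII, cl, map_neg, neg_mul, neg_re, hn]
    have n5 : (conj (c (I • y) (I • I • w)) * c (I • y) w).re = -‖c (I • y) w‖ ^ 2 := by
      rw [hII, cr, map_neg, neg_mul, neg_re, hn]
    rw [n1, n2, n3, n4, n5, hn, hQ]
    push_cast
    linear_combination -h0
  refine hf.false_of_pos (mul_pos hc₀ hpos) fun z => ?_
  rw [ofReal_re]
  exact mul_le_mul_of_nonneg_right (hG z) hpos.le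

end HorizontalFields

namespace SolvGroup

instance : FiniteDimensional ℝ SolvGroup := inferInstanceAs (FiniteDimensional ℝ (Fin 4 → ℂ))

instance : CompleteSpace SolvGroup := inferInstanceAs (CompleteSpace (Fin 4 → ℂ))

/-! ### Coordinate formulas for the frames and for the deformed coframe -/

theorem coframe_zero_apply (z v : SolvGroup) : coframe z 0 v = v 0 := rfl

theorem coframe_one_apply (z v : SolvGroup) : coframe z 1 v = exp (z 0) * v 1 := rfl

theorem coframe_two_apply (z v : SolvGroup) : coframe z 2 v = exp (-z 0) * v 2 := rfl

theorem coframe_three_apply (z v : SolvGroup) :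
    coframe z 3 v = v 3 - z 1 / 2 * v 2 + z 2 / 2 * v 1 := rfl

theorem dolbeaultForm_zero_apply (z v : SolvGroup) : dolbeaultForm z 0 v = conj (v 0) := rfl

theorem dolbeaultForm_one_apply (z v : SolvGroup) :
    dolbeaultForm z 1 v = exp (z 0) * conj (v 1) := by
  change exp (z 0 - conj (z 0)) * conj (exp (z 0) * v 1) = _
  rw [map_mul, ← exp_conj, ← mul_assoc, ← exp_add, sub_add_cancel]

theorem dolbeaultForm_two_apply (z v : SolvGroup) :
    dolbeaultForm z 2 v = exp (-z 0) * conj (v 2) := by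
  change exp (conj (z 0) - z 0) * conj (exp (-z 0) * v 2) = _
  rw [map_mul, ← exp_conj, ← mul_assoc, ← exp_add, map_neg]
  congr 2
  ring

/-- The coefficient of `conj φ⁴ ⊗ Z₄` in `ψ(t)`. -/
def lastCoeff (t : Param) : ℂ :=
  -(t 1 1 * t 2 2) + t 0 1 * t 3 2 + t 0 2 * t 3 1 + t 1 2 * t 2 1

theorem deformedCoframe_apply (t : Param) (z v : SolvGroup) (j : Fin 4) :
    deformedCoframe t z v j = coframe z j v + (t j 0 * dolbeaultForm z 0 v +
      t j 1 * dolbeaultForm z 1 v + t j 2 * dolbeaultForm z 2 v +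
      if j = 3 then lastCoeff t * conj (coframe z 3 v) else 0) := by
  simp only [deformedCoframe, psi, ContinuousLinearMap.coe_pi', add_apply,
    Fin.sum_univ_three, smul_apply, smul_eq_mul]
  split_ifs
  · rfl
  · rfl

theorem deformedCoframe_zero (t : Param) (z v : SolvGroup) :
    deformedCoframe t z v 0 = v 0 + t 0 0 * conj (v 0) + t 0 1 * (exp (z 0) * conj (v 1)) +
      t 0 2 * (exp (-z 0) * conj (v 2)) := by
  rw [deformedCoframe_apply, dolbeaultForm_zero_apply, dolbeaultForm_one_apply,
    dolbeaultForm_two_apply, coframe_zero_apply, if_neg (by decide)]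
  ring

theorem deformedCoframe_one (t : Param) (z v : SolvGroup) :
    deformedCoframe t z v 1 = exp (z 0) * v 1 + t 1 0 * conj (v 0) +
      t 1 1 * (exp (z 0) * conj (v 1)) + t 1 2 * (exp (-z 0) * conj (v 2)) := by
  rw [deformedCoframe_apply, dolbeaultForm_zero_apply, dolbeaultForm_one_apply,
    dolbeaultForm_two_apply, coframe_one_apply, if_neg (by decide)]
  ring

theorem deformedCoframe_two (t : Param) (z v : SolvGroup) :
    deformedCoframe t z v 2 = exp (-z 0) * v 2 + t 2 0 * conj (v 0) +
      t 2 1 * (exp (z 0) * conj (v 1)) + t 2 2 * (exp (-z 0) * conj (v 2)) := by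
  rw [deformedCoframe_apply, dolbeaultForm_zero_apply, dolbeaultForm_one_apply,
    dolbeaultForm_two_apply, coframe_two_apply, if_neg (by decide)]
  ring

theorem deformedCoframe_three (t : Param) (z v : SolvGroup) :
    deformedCoframe t z v 3 = v 3 - z 1 / 2 * v 2 + z 2 / 2 * v 1 + t 3 0 * conj (v 0) +
      t 3 1 * (exp (z 0) * conj (v 1)) + t 3 2 * (exp (-z 0) * conj (v 2)) +
      lastCoeff t * (conj (v 3) - conj (z 1) / 2 * conj (v 2) + conj (z 2) / 2 * conj (v 1)) := by
  rw [deformedCoframe_apply, dolbeaultForm_zero_apply, dolbeaultForm_one_apply,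
    dolbeaultForm_two_apply, coframe_three_apply, if_pos rfl]
  simp only [map_add, map_sub, map_mul, map_div₀, map_ofNat]
  ring

/-! ### Small parameters: the deformed coframe is a coframe -/

/-- The smallness condition on the parameters that is used throughout. The bound `1 / 100` is not
optimal: what matters is that the coframe remains a coframe and that the bracket on the fibres of
the first coordinate remains close to that of the undeformed structure. -/
def IsSmall (t : Param) : Prop := ∀ j l, ‖t j l‖ ≤ 1 / 100

variable {t : Param}

theorem IsSmall.norm_lastCoeff_le (ht : IsSmall t) : ‖lastCoeff t‖ ≤ 1 / 100 := by
  have h : ∀ i j k l, ‖t i j * t k l‖ ≤ 1 / 10000 := fun i j k l => by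
    rw [norm_mul]
    exact (mul_le_mul (ht i j) (ht k l) (norm_nonneg _) (by norm_num)).trans (by norm_num)
  unfold lastCoeff
  have h1 := norm_add₃_le (a := -(t 1 1 * t 2 2) + t 0 1 * t 3 2) (b := t 0 2 * t 3 1)
    (c := t 1 2 * t 2 1)
  have h2 := norm_add_le (-(t 1 1 * t 2 2)) (t 0 1 * t 3 2)
  rw [norm_neg] at h2
  linarith [h 1 1 2 2, h 0 1 3 2, h 0 2 3 1, h 1 2 2 1]

theorem norm_dolbeaultForm_apply (z v : SolvGroup) (l : Fin 3) :
    ‖dolbeaultForm z l v‖ = ‖coframe z l.castSucc v‖ := by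
  fin_cases l
  · simp [dolbeaultForm_zero_apply, coframe_zero_apply]
  · change ‖dolbeaultForm z 1 v‖ = ‖coframe z 1 v‖
    simp [dolbeaultForm_one_apply, coframe_one_apply]
  · change ‖dolbeaultForm z 2 v‖ = ‖coframe z 2 v‖
    simp [dolbeaultForm_two_apply, coframe_two_apply]

theorem coframe_injective (z : SolvGroup) {v : SolvGroup} (h : ∀ j, coframe z j v = 0) : v = 0 := by
  have h0 : v 0 = 0 := h 0
  have h1 : v 1 = 0 := by simpa [coframe_one_apply] using h 1
  have h2 : v 2 = 0 := by simpa [coframe_two_apply] using h 2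
  have h3 : v 3 = 0 := by simpa [coframe_three_apply, h1, h2] using h 3
  exact ext_coord h0 h1 h2 h3

theorem deformedCoframe_injective (ht : IsSmall t) (z : SolvGroup) :
    Function.Injective (deformedCoframe t z) := by
  rw [injective_iff_map_eq_zero]
  intro v hv
  set w : Fin 4 → ℂ := fun j => coframe z j v with hw
  have h1 : ∀ j, ‖w j‖ ≤ 4 / 100 * ‖w‖ := by
    intro j
    have h := congrFun hv j
    rw [deformedCoframe_apply] at h
    have h2 : w j = -(t j 0 * dolbeaultForm z 0 v +
      t j 1 * dolbeaultForm z 1 v + t j 2 * dolbeaultForm z 2 v +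
      if j = 3 then lastCoeff t * conj (coframe z 3 v) else 0) := eq_neg_of_add_eq_zero_left h
    have h3 : ∀ l, ‖t j l * dolbeaultForm z l v‖ ≤ 1 / 100 * ‖w‖ := fun l => by
      rw [norm_mul, norm_dolbeaultForm_apply]
      exact mul_le_mul (ht j l) (norm_le_pi_norm w _) (norm_nonneg _) (by norm_num)
    have h4 : ‖if j = 3 then lastCoeff t * conj (coframe z 3 v) else 0‖ ≤ 1 / 100 * ‖w‖ := by
      split_ifs
      · rw [norm_mul, RCLike.norm_conj]
        exact mul_le_mul ht.norm_lastCoeff_le (norm_le_pi_norm w _) (norm_nonneg _) (by norm_num)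
      · rw [norm_zero]; positivity
    -- hence `‖w‖ ≤ (4 / 100) ‖w‖`, as each of the four terms is at most `‖w‖ / 100`
    rw [h2, norm_neg]
    refine (norm_add_le _ _).trans ?_
    have h5 := norm_add₃_le (a := t j 0 * dolbeaultForm z 0 v) (b := t j 1 * dolbeaultForm z 1 v)
      (c := t j 2 * dolbeaultForm z 2 v)
    linarith [h3 0, h3 1, h3 2]
  have h2 : ‖w‖ ≤ 4 / 100 * ‖w‖ := (pi_norm_le_iff_of_nonneg (by positivity)).2 h1
  have h3 : w = 0 := norm_eq_zero.1 (by linarith [norm_nonneg w])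
  exact coframe_injective z fun j => congrFun h3 j

/-- The deformed coframe as an isomorphism of the tangent space with `ℂ⁴`. -/
def coframeEquiv (ht : IsSmall t) (z : SolvGroup) : SolvGroup ≃L[ℝ] (Fin 4 → ℂ) :=
  (LinearMap.linearEquivOfInjective (deformedCoframe t z : SolvGroup →ₗ[ℝ] (Fin 4 → ℂ))
    (deformedCoframe_injective ht z) rfl).toContinuousLinearEquiv

theorem coe_coframeEquiv (ht : IsSmall t) (z : SolvGroup) :
    (coframeEquiv ht z : SolvGroup →L[ℝ] (Fin 4 → ℂ)) = deformedCoframe t z := by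
  ext v
  rfl

theorem contDiff_deformedCoframe_apply (t : Param) (v : SolvGroup) :
    ContDiff ℝ ∞ fun z => deformedCoframe t z v := by
  have hp : ∀ i : Fin 4, ContDiff ℝ ∞ fun z : SolvGroup => z i := fun i => (dz i).contDiff
  have he : ContDiff ℝ ∞ fun z : SolvGroup => exp (z 0) := (hp 0).cexp
  have he' : ContDiff ℝ ∞ fun z : SolvGroup => exp (-z 0) := (hp 0).neg.cexp
  have hc : ∀ i : Fin 4, ContDiff ℝ ∞ fun z : SolvGroup => conj (z i) :=
    fun i => (conjForm (dz i)).contDiff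
  have h1 := hp 1
  have h2 := hp 2
  have c1 := hc 1
  have c2 := hc 2
  rw [contDiff_pi]
  intro j
  fin_cases j
  · change ContDiff ℝ ∞ fun z => deformedCoframe t z v 0
    simp only [deformedCoframe_zero]
    fun_prop
  · change ContDiff ℝ ∞ fun z => deformedCoframe t z v 1
    simp only [deformedCoframe_one]
    fun_prop
  · change ContDiff ℝ ∞ fun z => deformedCoframe t z v 2
    simp only [deformedCoframe_two]
    fun_prop
  · change ContDiff ℝ ∞ fun z => deformedCoframe t z v 3
    simp only [deformedCoframe_three, div_eq_mul_inv]
    fun_prop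

theorem contDiff_deformedCoframe (t : Param) : ContDiff ℝ ∞ (deformedCoframe t) :=
  contDiff_clm_apply_iff.2 (contDiff_deformedCoframe_apply t)

/-- The frame dual to the deformed coframe, assembled into a map from `ℂ⁴`. It is the inverse of the
deformed coframe where that is invertible, and `0` elsewhere. -/
def deformedFrame (t : Param) (z : SolvGroup) : (Fin 4 → ℂ) →L[ℝ] SolvGroup :=
  (deformedCoframe t z).inverse

theorem deformedFrame_eq (ht : IsSmall t) (z : SolvGroup) :
    deformedFrame t z = (coframeEquiv ht z).symm := by
  rw [deformedFrame, ← coe_coframeEquiv ht, ContinuousLinearMap.inverse_equiv]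

theorem deformedCoframe_deformedFrame (ht : IsSmall t) (z : SolvGroup) (u : Fin 4 → ℂ) :
    deformedCoframe t z (deformedFrame t z u) = u := by
  rw [deformedFrame_eq ht, ← coe_coframeEquiv ht]
  exact (coframeEquiv ht z).apply_symm_apply u

theorem deformedFrame_deformedCoframe (ht : IsSmall t) (z v : SolvGroup) :
    deformedFrame t z (deformedCoframe t z v) = v := by
  rw [deformedFrame_eq ht, ← coe_coframeEquiv ht]
  exact (coframeEquiv ht z).symm_apply_apply v

theorem contDiff_deformedFrame (ht : IsSmall t) : ContDiff ℝ ∞ (deformedFrame t) := by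
  rw [contDiff_iff_contDiffAt]
  intro z
  have h := contDiffAt_map_inverse (𝕜 := ℝ) (n := ∞) (coframeEquiv ht z)
  rw [coe_coframeEquiv] at h
  exact h.comp z (contDiff_deformedCoframe t).contDiffAt

/-! ### The almost complex structure -/

theorem deformedCoframe_deformedJ (ht : IsSmall t) (z v : SolvGroup) :
    deformedCoframe t z (deformedJ t z v) = I • deformedCoframe t z v :=
  deformedCoframe_deformedFrame ht z _

theorem deformedJ_eq_iff (ht : IsSmall t) (z v w : SolvGroup) :
    deformedJ t z v = w ↔ I • deformedCoframe t z v = deformedCoframe t z w := by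
  rw [← deformedCoframe_deformedJ ht]
  exact (deformedCoframe_injective ht z).eq_iff.symm

theorem deformedJ_deformedJ (ht : IsSmall t) (z v : SolvGroup) :
    deformedJ t z (deformedJ t z v) = -v := by
  rw [deformedJ_eq_iff ht, deformedCoframe_deformedJ ht, smul_smul, I_mul_I, map_neg, neg_one_smul]

theorem contDiff_deformedJ (ht : IsSmall t) : ContDiff ℝ ∞ (deformedJ t) := by
  refine contDiff_clm_apply_iff.2 fun v => ?_
  change ContDiff ℝ ∞ fun z => deformedFrame t z (I • deformedCoframe t z v)
  exact (contDiff_deformedFrame ht).clm_apply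
    ((contDiff_deformedCoframe_apply t v).const_smul I)

/-! ### Left translations -/

theorem contDiff_mul_left (γ : SolvGroup) : ContDiff ℝ ∞ fun w : SolvGroup => γ * w := by
  have hp : ∀ i : Fin 4, ContDiff ℝ ∞ fun z : SolvGroup => z i := fun i => (dz i).contDiff
  have h0 := hp 0
  have h1 := hp 1
  have h2 := hp 2
  have h3 := hp 3
  refine contDiff_pi.2 fun j => ?_
  fin_cases j
  · change ContDiff ℝ ∞ fun w : SolvGroup => (γ * w) 0
    simp only [mul_zero_coord]
    fun_prop
  · change ContDiff ℝ ∞ fun w : SolvGroup => (γ * w) 1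
    simp only [mul_one_coord]
    fun_prop
  · change ContDiff ℝ ∞ fun w : SolvGroup => (γ * w) 2
    simp only [mul_two_coord]
    fun_prop
  · change ContDiff ℝ ∞ fun w : SolvGroup => (γ * w) 3
    simp only [mul_three_coord]
    fun_prop

theorem leftDiff_apply (γ z v : SolvGroup) : leftDiff γ z v = ![v 0, exp (-γ 0) * v 1,
    exp (γ 0) * v 2,
    v 3 + 1 / 2 * exp (γ 0) * γ 1 * v 2 - 1 / 2 * exp (-γ 0) * γ 2 * v 1] := by
  have hd : HasFDerivAt (fun w : SolvGroup => γ * w) (leftDiff γ z) z :=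
    ((contDiff_mul_left γ).differentiable (by simp) z).hasFDerivAt
  have hdz : ∀ i : Fin 4, HasFDerivAt (fun w : SolvGroup => w i) (dz i) z :=
    fun i => (dz i).hasFDerivAt
  have hc : ∀ i, HasFDerivAt (fun w : SolvGroup => (γ * w) i) (dz i ∘L leftDiff γ z) z :=
    fun i => (dz i).hasFDerivAt.comp z hd
  refine ext_coord ?_ ?_ ?_ ?_
  · have h := (hc 0).unique ((hdz 0).add_const (γ 0))
    exact DFunLike.congr_fun h v
  · have h := (hc 1).unique (((hdz 1).const_mul (exp (-γ 0))).add_const (γ 1))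
    exact DFunLike.congr_fun h v
  · have h := (hc 2).unique (((hdz 2).const_mul (exp (γ 0))).add_const (γ 2))
    exact DFunLike.congr_fun h v
  · have h := (hc 3).unique ((((hdz 3).add_const (γ 3)).add
      ((hdz 2).const_mul (1 / 2 * exp (γ 0) * γ 1))).sub
      ((hdz 1).const_mul (1 / 2 * exp (-γ 0) * γ 2)))
    exact DFunLike.congr_fun h v

/-- The deformed coframe is invariant under left translations by elements `γ` with
`e^{γ₁ - conj γ₁} = 1`. -/
theorem deformedCoframe_leftDiff (t : Param) {γ : SolvGroup} (hγ : exp (γ 0 - conj (γ 0)) = 1)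
    (z v : SolvGroup) : deformedCoframe t (γ * z) (leftDiff γ z v) = deformedCoframe t z v := by
  have hγ' : exp (γ 0) = exp (conj (γ 0)) := by
    rw [exp_sub, div_eq_one_iff_eq (exp_ne_zero _)] at hγ
    exact hγ
  have hn : exp (-conj (γ 0)) = exp (-γ 0) := by rw [exp_neg, exp_neg, hγ']
  have hm : exp (γ 0) * exp (-γ 0) = 1 := by rw [← exp_add, add_neg_cancel, exp_zero]
  have c1 : conj (exp (-γ 0)) = exp (-γ 0) := by rw [← exp_conj, map_neg, hn]
  have c2 : conj (exp (γ 0)) = exp (γ 0) := by rw [← exp_conj, hγ']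
  have e0 : (γ * z) 0 = z 0 + γ 0 := rfl
  have e1 : (γ * z) 1 = exp (-γ 0) * z 1 + γ 1 := rfl
  have e2 : (γ * z) 2 = exp (γ 0) * z 2 + γ 2 := rfl
  have l0 : leftDiff γ z v 0 = v 0 := by rw [leftDiff_apply]; rfl
  have l1 : leftDiff γ z v 1 = exp (-γ 0) * v 1 := by rw [leftDiff_apply]; rfl
  have l2 : leftDiff γ z v 2 = exp (γ 0) * v 2 := by rw [leftDiff_apply]; rfl
  have l3 : leftDiff γ z v 3 = v 3 + 1 / 2 * exp (γ 0) * γ 1 * v 2 -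
    1 / 2 * exp (-γ 0) * γ 2 * v 1 := by rw [leftDiff_apply]; rfl
  have x1 : exp (z 0 + γ 0) = exp (z 0) * exp (γ 0) := exp_add _ _
  have x2 : exp (-(z 0 + γ 0)) = exp (-z 0) * exp (-γ 0) := by rw [neg_add, exp_add]
  set a := exp (γ 0)
  set b := exp (-γ 0)
  refine ext_coord (y := deformedCoframe t (γ * z) (leftDiff γ z v)) (z := deformedCoframe t z v)
    ?_ ?_ ?_ ?_
  · rw [deformedCoframe_zero, deformedCoframe_zero]
    simp only [e0, l0, l1, l2, x1, x2, map_mul, c1, c2]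
    linear_combination (t 0 1 * exp (z 0) * conj (v 1) + t 0 2 * exp (-z 0) * conj (v 2)) * hm
  · rw [deformedCoframe_one, deformedCoframe_one]
    simp only [e0, l0, l1, l2, x1, x2, map_mul, c1, c2]
    linear_combination (exp (z 0) * v 1 + t 1 1 * exp (z 0) * conj (v 1) +
      t 1 2 * exp (-z 0) * conj (v 2)) * hm
  · rw [deformedCoframe_two, deformedCoframe_two]
    simp only [e0, l0, l1, l2, x1, x2, map_mul, c1, c2]
    linear_combination (exp (-z 0) * v 2 + t 2 1 * exp (z 0) * conj (v 1) +
      t 2 2 * exp (-z 0) * conj (v 2)) * hm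
  · rw [deformedCoframe_three, deformedCoframe_three]
    simp only [e0, e1, e2, l0, l1, l2, l3, x1, x2, map_mul, map_add, map_sub, map_div₀, map_ofNat,
      map_one, c1, c2]
    linear_combination (-z 1 / 2 * v 2 + z 2 / 2 * v 1 + t 3 1 * exp (z 0) * conj (v 1) +
      t 3 2 * exp (-z 0) * conj (v 2) + lastCoeff t * (-conj (z 1) / 2 * conj (v 2) +
      conj (z 2) / 2 * conj (v 1))) * hm

theorem deformedJ_leftDiff (ht : IsSmall t) {γ : SolvGroup} (hγ : exp (γ 0 - conj (γ 0)) = 1)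
    (z v : SolvGroup) :
    deformedJ t (γ * z) (leftDiff γ z v) = leftDiff γ z (deformedJ t z v) := by
  rw [deformedJ_eq_iff ht, deformedCoframe_leftDiff t hγ, deformedCoframe_leftDiff t hγ,
    deformedCoframe_deformedJ ht]

/-! ### The four classes of parameters -/

/-- The class is determined by which of `t_{11}`, `t_{12}`, `t_{13}` is non-zero: by the equations, at
most one of them is. -/
theorem kuranishiEquations_iff_existsUnique (t : Param) :
    KuranishiEquations t ↔ ∃! c : Fin 4, DeformationClass c t := by
  have c0 : DeformationClass 0 t ↔ t 0 0 ≠ 0 ∧ t 0 1 = 0 ∧ t 0 2 = 0 ∧ t 2 1 = 0 ∧ t 1 2 = 0 ∧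
      t 0 0 * t 3 1 = t 2 0 * t 1 1 ∧ t 0 0 * t 3 2 = t 1 0 * t 2 2 := Iff.rfl
  have c1 : DeformationClass 1 t ↔ t 0 0 = 0 ∧ t 0 1 = 0 ∧ t 0 2 = 0 ∧
      t 1 0 * t 2 1 = t 2 0 * t 1 1 ∧ t 1 0 * t 2 2 = t 2 0 * t 1 2 := Iff.rfl
  have c2 : DeformationClass 2 t ↔ t 0 1 ≠ 0 ∧ t 0 0 = 0 ∧ t 1 0 = 0 ∧ t 2 0 = 0 ∧ t 0 2 = 0 ∧
      t 1 2 = 0 := Iff.rfl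
  have c3 : DeformationClass 3 t ↔ t 0 2 ≠ 0 ∧ t 0 0 = 0 ∧ t 0 1 = 0 ∧ t 1 0 = 0 ∧ t 2 0 = 0 ∧
      t 2 1 = 0 := Iff.rfl
  constructor
  · rintro ⟨h1, h2, h3, h4, h5, h6, h7, h8, h9, h10, h11⟩
    by_cases h00 : t 0 0 = 0
    · simp only [h00, zero_mul, mul_zero, sub_zero, zero_sub, neg_eq_zero, zero_add]
        at h4 h5 h10 h11
      by_cases h01 : t 0 1 = 0
      · by_cases h02 : t 0 2 = 0
        · refine ⟨1, c1.2 ⟨h00, h01, h02, by linear_combination h10, by linear_combination h11⟩, ?_⟩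
          intro c hc
          fin_cases c
          exacts [absurd h00 (c0.1 hc).1, rfl, absurd h01 (c2.1 hc).1, absurd h02 (c3.1 hc).1]
        · refine ⟨3, c3.2 ⟨h02, h00, h01, (mul_eq_zero.1 h4).resolve_right h02,
            (mul_eq_zero.1 h6).resolve_left h02, (mul_eq_zero.1 h9).resolve_left h02⟩, ?_⟩
          intro c hc
          fin_cases c
          exacts [absurd h00 (c0.1 hc).1, absurd (c1.1 hc).2.2.1 h02, absurd h01 (c2.1 hc).1, rfl]
      · have h02 := (mul_eq_zero.1 h7).resolve_left h01
        refine ⟨2, c2.2 ⟨h01, h00, (mul_eq_zero.1 h3).resolve_left h01,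
          (mul_eq_zero.1 h5).resolve_right h01, h02, (mul_eq_zero.1 h8).resolve_left h01⟩, ?_⟩
        intro c hc
        fin_cases c
        exacts [absurd h00 (c0.1 hc).1, absurd (c1.1 hc).2.1 h01, rfl, absurd h02 (c3.1 hc).1]
    · have h01 := (mul_eq_zero.1 h1).resolve_left h00
      have h02 := (mul_eq_zero.1 h2).resolve_left h00
      have h12 : t 1 2 = 0 := by
        have : t 0 0 * t 1 2 = 0 := by linear_combination (-1 / 2) * h4 + t 1 0 / 2 * h02
        exact (mul_eq_zero.1 this).resolve_left h00
      have h21 : t 2 1 = 0 := by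
        have : t 0 0 * t 2 1 = 0 := by linear_combination (1 / 2) * h5 + t 2 0 / 2 * h01
        exact (mul_eq_zero.1 this).resolve_left h00
      refine ⟨0, c0.2 ⟨h00, h01, h02, h21, h12, by linear_combination h10 - t 1 0 * h21,
        by linear_combination -h11 - t 2 0 * h12⟩, ?_⟩
      intro c hc
      fin_cases c
      exacts [rfl, absurd (c1.1 hc).1 h00, absurd (c2.1 hc).2.1 h00, absurd (c3.1 hc).2.1 h00]
  · rintro ⟨c, hc, -⟩
    fin_cases c
    · obtain ⟨-, a, b, c, d, e, f⟩ := c0.1 hc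
      refine ⟨?_, ?_, ?_, ?_, ?_, ?_, ?_, ?_, ?_, ?_, ?_⟩ <;> simp [a, b, c, d, e, f]
    · obtain ⟨a, b, c, e, f⟩ := c1.1 hc
      refine ⟨?_, ?_, ?_, ?_, ?_, ?_, ?_, ?_, ?_, ?_, ?_⟩ <;> simp [a, b, c, e, f]
    · obtain ⟨-, a, b, c, d, e⟩ := c2.1 hc
      refine ⟨?_, ?_, ?_, ?_, ?_, ?_, ?_, ?_, ?_, ?_, ?_⟩ <;> simp [a, b, c, d, e]
    · obtain ⟨-, a, b, c, d, e⟩ := c3.1 hc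
      refine ⟨?_, ?_, ?_, ?_, ?_, ?_, ?_, ?_, ?_, ?_, ?_⟩ <;> simp [a, b, c, d, e]

/-! ### Integrability -/

/-- The derivative at `z` in the direction `v` of the function `y ↦ φ_t^j(w)(y)`, for a constant
vector field `w`; see `fderiv_deformedCoframe_apply`. -/
def coframeDeriv (t : Param) (z v w : SolvGroup) : Fin 4 → ℂ :=
  ![coframe z 0 v * (t 0 1 * dolbeaultForm z 1 w - t 0 2 * dolbeaultForm z 2 w),
    coframe z 0 v * (coframe z 1 w + t 1 1 * dolbeaultForm z 1 w - t 1 2 * dolbeaultForm z 2 w),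
    coframe z 0 v * (-coframe z 2 w + t 2 1 * dolbeaultForm z 1 w - t 2 2 * dolbeaultForm z 2 w),
    -(coframe z 1 v * coframe z 2 w - coframe z 2 v * coframe z 1 w) / 2 +
      coframe z 0 v * (t 3 1 * dolbeaultForm z 1 w - t 3 2 * dolbeaultForm z 2 w) -
      lastCoeff t * (dolbeaultForm z 1 v * dolbeaultForm z 2 w -
        dolbeaultForm z 2 v * dolbeaultForm z 1 w) / 2]

theorem hasDerivAt_coord_line (z v : SolvGroup) (i : Fin 4) :
    HasDerivAt (fun τ : ℝ => (z + τ • v) i) (v i) 0 := by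
  have h : HasDerivAt (fun τ : ℝ => z i + τ • v i) ((1 : ℝ) • v i) 0 :=
    ((hasDerivAt_id (0 : ℝ)).smul_const (v i)).const_add (z i)
  rw [one_smul] at h
  exact h

theorem HasDerivAt.conj_comp {f : ℝ → ℂ} {f' : ℂ} {x : ℝ} (h : HasDerivAt f f' x) :
    HasDerivAt (fun τ => conj (f τ)) (conj f') x := by
  exact (conjCLE : ℂ →L[ℝ] ℂ).hasFDerivAt.comp_hasDerivAt x h

theorem fderiv_deformedCoframe_apply (t : Param) (z v w : SolvGroup) :
    fderiv ℝ (fun y => deformedCoframe t y w) z v = coframeDeriv t z v w := by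
  have hd : DifferentiableAt ℝ (fun y => deformedCoframe t y w) z :=
    (contDiff_deformedCoframe_apply t w).differentiable (by simp) z
  have hl := hd.hasFDerivAt.hasLineDerivAt v
  have hz : ∀ i, HasDerivAt (fun τ : ℝ => (z + τ • v) i) (v i) 0 := hasDerivAt_coord_line z v
  have h00 : ∀ i, (z + (0 : ℝ) • v) i = z i := fun i => by rw [zero_smul, add_zero]
  have he := (hz 0).cexp
  have he' := (hz 0).fun_neg.cexp
  rw [h00] at he he'
  have hc : ∀ j, HasDerivAt (fun τ : ℝ => deformedCoframe t (z + τ • v) w j)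
      (fderiv ℝ (fun y => deformedCoframe t y w) z v j) 0 := fun j => hasDerivAt_pi.1 hl j
  have hee : exp (z 0) * exp (-z 0) = 1 := by rw [← exp_add, add_neg_cancel, exp_zero]
  funext j
  refine (hc j).unique ?_
  fin_cases j
  · change HasDerivAt (fun τ : ℝ => deformedCoframe t (z + τ • v) w 0) (coframeDeriv t z v w 0) 0
    simp only [deformedCoframe_zero]
    refine (((he.mul_const (conj (w 1))).const_mul (t 0 1)).const_add
      (w 0 + t 0 0 * conj (w 0))|>.add ((he'.mul_const (conj (w 2))).const_mul
      (t 0 2))).congr_deriv ?_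
    simp only [coframeDeriv, coframe_zero_apply, dolbeaultForm_one_apply, dolbeaultForm_two_apply,
      Matrix.cons_val]
    ring
  · change HasDerivAt (fun τ : ℝ => deformedCoframe t (z + τ • v) w 1) (coframeDeriv t z v w 1) 0
    simp only [deformedCoframe_one]
    refine ((((he.mul_const (w 1)).add_const (t 1 0 * conj (w 0))).add
      ((he.mul_const (conj (w 1))).const_mul (t 1 1))).add
      ((he'.mul_const (conj (w 2))).const_mul (t 1 2))).congr_deriv ?_
    simp only [coframeDeriv, coframe_zero_apply, dolbeaultForm_one_apply, dolbeaultForm_two_apply,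
      Matrix.cons_val, coframe_one_apply]
    ring
  · change HasDerivAt (fun τ : ℝ => deformedCoframe t (z + τ • v) w 2) (coframeDeriv t z v w 2) 0
    simp only [deformedCoframe_two]
    refine ((((he'.mul_const (w 2)).add_const (t 2 0 * conj (w 0))).add
      ((he.mul_const (conj (w 1))).const_mul (t 2 1))).add
      ((he'.mul_const (conj (w 2))).const_mul (t 2 2))).congr_deriv ?_
    simp only [coframeDeriv, coframe_zero_apply, dolbeaultForm_one_apply, dolbeaultForm_two_apply,
      Matrix.cons_val, coframe_two_apply]
    ring
  · change HasDerivAt (fun τ : ℝ => deformedCoframe t (z + τ • v) w 3) (coframeDeriv t z v w 3) 0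
    simp only [deformedCoframe_three]
    have hA := ((((hz 1).div_const 2).mul_const (w 2)).const_sub (w 3)).add
      (((hz 2).div_const 2).mul_const (w 1))
    have hB := ((((HasDerivAt.conj_comp (hz 1)).div_const 2).mul_const (conj (w 2))).const_sub
      (conj (w 3))).add (((HasDerivAt.conj_comp (hz 2)).div_const 2).mul_const (conj (w 1)))
    refine ((((hA.add_const (t 3 0 * conj (w 0))).add
      ((he.mul_const (conj (w 1))).const_mul (t 3 1))).add
      ((he'.mul_const (conj (w 2))).const_mul (t 3 2))).add
      (hB.const_mul (lastCoeff t))).congr_deriv ?_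
    simp only [coframeDeriv, coframe_zero_apply, dolbeaultForm_one_apply, dolbeaultForm_two_apply,
      Matrix.cons_val, coframe_two_apply, coframe_one_apply]
    linear_combination (1 / 2 * (v 1 * w 2 - v 2 * w 1) + 1 / 2 * lastCoeff t *
      (conj (v 1) * conj (w 2) - conj (v 2) * conj (w 1))) * hee

/-- Four times the `(0,2)`-part of `dφ_t`, where `dφ_t(v, w)` is the skew-symmetrisation of
`coframeDeriv`. -/
def torsion (t : Param) (z v w : SolvGroup) (j : Fin 4) : ℂ :=
  let Ω : SolvGroup → SolvGroup → ℂ := fun v w => coframeDeriv t z v w j - coframeDeriv t z w v j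
  Ω v w - Ω (deformedJ t z v) (deformedJ t z w) + I * Ω (deformedJ t z v) w +
    I * Ω v (deformedJ t z w)

/-- Twice the value of the form `g_l` of the Dolbeault coframe on the `(0,1)`-part of `v`. -/
def antiDolbeault (t : Param) (z : SolvGroup) (l : Fin 3) (v : SolvGroup) : ℂ :=
  dolbeaultForm z l v + I * dolbeaultForm z l (deformedJ t z v)

/-- On vectors of type `(0,1)` the forms `φ_t^j` vanish, so that `φ^j = -∑ t_{jl} g_l` there; this
is that identity on the `(0,1)`-part of `v`, solved for `φ^j (J_t v)`. -/
theorem coframe_deformedJ (ht : IsSmall t) (z v : SolvGroup) {j : Fin 4} (hj : j ≠ 3) :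
    coframe z j (deformedJ t z v) = I * (coframe z j v + (t j 0 * antiDolbeault t z 0 v +
      t j 1 * antiDolbeault t z 1 v + t j 2 * antiDolbeault t z 2 v)) := by
  have h := congrFun (deformedCoframe_deformedJ ht z v) j
  rw [Pi.smul_apply, deformedCoframe_apply, deformedCoframe_apply, if_neg hj, if_neg hj,
    smul_eq_mul] at h
  simp only [antiDolbeault]
  linear_combination h - (t j 0 * dolbeaultForm z 0 (deformedJ t z v) +
    t j 1 * dolbeaultForm z 1 (deformedJ t z v) + t j 2 * dolbeaultForm z 2 (deformedJ t z v)) *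
    I_mul_I

/-- The coefficients of `g_1 ∧ g_2`, `g_1 ∧ g_3` and `g_2 ∧ g_3` in the `(0,2)`-part of `dφ_t`. -/
theorem torsion_eq (ht : IsSmall t) (z v w : SolvGroup) (j : Fin 4) :
    torsion t z v w j =
      (![-(t 0 0 * t 0 1), -(t 0 1 * t 1 0), -(2 * t 0 0 * t 2 1 - t 2 0 * t 0 1),
        -(t 0 0 * t 3 1 + t 1 0 * t 2 1 - t 2 0 * t 1 1)] : Fin 4 → ℂ) j *
        (antiDolbeault t z 0 v * antiDolbeault t z 1 w -
          antiDolbeault t z 0 w * antiDolbeault t z 1 v) +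
      (![t 0 0 * t 0 2, -(t 1 0 * t 0 2 - 2 * t 0 0 * t 1 2), t 0 2 * t 2 0,
        -(t 1 0 * t 2 2 - t 0 0 * t 3 2 - t 2 0 * t 1 2)] : Fin 4 → ℂ) j *
        (antiDolbeault t z 0 v * antiDolbeault t z 2 w -
          antiDolbeault t z 0 w * antiDolbeault t z 2 v) +
      (![2 * (t 0 1 * t 0 2), 2 * (t 0 1 * t 1 2), 2 * (t 0 2 * t 2 1), 0] : Fin 4 → ℂ) j *
        (antiDolbeault t z 1 v * antiDolbeault t z 2 w -
          antiDolbeault t z 1 w * antiDolbeault t z 2 v) := by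
  have a : ∀ l v, dolbeaultForm z l (deformedJ t z v) =
      -I * (antiDolbeault t z l v - dolbeaultForm z l v) := fun l v => by
    simp only [antiDolbeault]
    linear_combination dolbeaultForm z l (deformedJ t z v) * I_mul_I
  have f0 : ∀ v, _ := fun v => coframe_deformedJ ht z v (j := 0) (by decide)
  have f1 : ∀ v, _ := fun v => coframe_deformedJ ht z v (j := 1) (by decide)
  have f2 : ∀ v, _ := fun v => coframe_deformedJ ht z v (j := 2) (by decide)
  fin_cases j
  · simp only [torsion, coframeDeriv, Fin.mk_zero, Matrix.cons_val]
    simp only [a, f0]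
    ring_nf
    simp only [I_sq]
    ring
  · simp only [torsion, coframeDeriv, Fin.mk_one, Matrix.cons_val]
    simp only [a, f0, f1]
    ring_nf
    simp only [I_sq]
    ring
  · simp only [torsion, coframeDeriv, Fin.reduceFinMk, Matrix.cons_val]
    simp only [a, f0, f2]
    ring_nf
    simp only [I_sq]
    ring
  · simp only [torsion, coframeDeriv, Fin.reduceFinMk, Matrix.cons_val]
    simp only [a, f0, f1, f2, lastCoeff]
    ring_nf
    simp only [I_sq]
    ring

theorem hasFDerivAt_deformedCoframe_apply (t : Param) (z w : SolvGroup) (j : Fin 4) :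
    HasFDerivAt (fun y => deformedCoframe t y w j)
      (ContinuousLinearMap.proj j ∘L fderiv ℝ (fun y => deformedCoframe t y w) z) z :=
  (ContinuousLinearMap.proj (R := ℝ) (φ := fun _ : Fin 4 => ℂ) j).hasFDerivAt.comp z
    ((contDiff_deformedCoframe_apply t w).differentiable (by simp) z).hasFDerivAt

/-- The exterior derivative of a `1`-form, on constant vector fields. -/
theorem extDeriv_one_apply {E : Type*} [NormedAddCommGroup E] [NormedSpace ℝ E]
    {α : E → E [⋀^Fin 1]→L[ℝ] ℂ} {z : E} (hα : DifferentiableAt ℝ α z) (v w : E) :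
    extDeriv α z ![v, w] =
      fderiv ℝ (fun y => α y fun _ => w) z v - fderiv ℝ (fun y => α y fun _ => v) z w := by
  have r0 : (0 : Fin 2).removeNth ![v, w] = fun _ => w := by funext i; fin_cases i; rfl
  have r1 : (1 : Fin 2).removeNth ![v, w] = fun _ => v := by funext i; fin_cases i; rfl
  rw [extDeriv_apply hα, Fin.sum_univ_two]
  have e : ∀ (p : Fin 1 → E) (a : E), fderiv ℝ (fun y => α y p) z a = fderiv ℝ α z a p :=
    fun p a => fderiv_continuousAlternatingMap_apply_const_apply hα p a
  simp [r0, r1, e, sub_eq_add_neg]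

/-- The `(0,2)`-part of `d(∑ a_j φ_t^j)`: the terms that contain derivatives of the coefficients
`a_j` are of type `(2,0) + (1,1)`. -/
theorem typeComponent_extDeriv_of_eq_sum (ht : IsSmall t)
    {α : SolvGroup → SolvGroup [⋀^Fin 1]→L[ℝ] ℂ} (hα : ContDiff ℝ ∞ α) {a : Fin 4 → SolvGroup → ℂ} (ha : ∀ j, ContDiff ℝ ∞ (a j))
    (h : ∀ z w, (α z fun _ => w) = ∑ j, a j z * deformedCoframe t z w j) (z v w : SolvGroup) :
    typeComponent (deformedJ t z) 0 2 (extDeriv α z) ![v, w] =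
      (∑ j, a j z * torsion t z v w j) / 4 := by
  have hf : ∀ v w, fderiv ℝ (fun y => α y fun _ => w) z v =
      ∑ j, (fderiv ℝ (a j) z v * deformedCoframe t z w j + a j z * coframeDeriv t z v w j) := by
    intro v w
    simp only [h]
    have h1 : HasFDerivAt (fun y => ∑ j, a j y * deformedCoframe t y w j) _ z :=
      HasFDerivAt.fun_sum (u := Finset.univ) fun j _ =>
      ((ha j).differentiable (by simp) z).hasFDerivAt.mul
        (hasFDerivAt_deformedCoframe_apply t z w j)
    rw [h1.fderiv]
    simp only [sum_apply, add_apply, smul_apply, smul_eq_mul,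
      ContinuousLinearMap.comp_apply, ContinuousLinearMap.proj_apply, fderiv_deformedCoframe_apply]
    refine Finset.sum_congr rfl fun j _ => ?_
    ring
  have hJ : ∀ v j, deformedCoframe t z (deformedJ t z v) j = I * deformedCoframe t z v j :=
    fun v j => congrFun (deformedCoframe_deformedJ ht z v) j
  have hα' := hα.differentiable (by simp) z
  rw [typeComponent_zero_two_apply, extDeriv_one_apply hα', extDeriv_one_apply hα',
    extDeriv_one_apply hα', extDeriv_one_apply hα']
  simp only [hf, hJ, torsion, Fin.sum_univ_four]
  ring_nf
  simp only [I_sq]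
  ring

theorem deformedJ_deformedFrame (ht : IsSmall t) (z : SolvGroup) (u : Fin 4 → ℂ) :
    deformedJ t z (deformedFrame t z u) = deformedFrame t z (I • u) := by
  rw [deformedJ_eq_iff ht, deformedCoframe_deformedFrame ht, deformedCoframe_deformedFrame ht]

/-- The vectors on which `antiDolbeault` takes prescribed values. -/
theorem exists_antiDolbeault_eq (ht : IsSmall t) (z : SolvGroup) (b : Fin 3 → ℂ) :
    ∃ v, ∀ l, antiDolbeault t z l v = b l := by
  let G : SolvGroup →ₗ[ℝ] (Fin 4 → ℂ) := LinearMap.pi fun j =>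
    ((conjForm (coframe z j) + I • conjForm (coframe z j) ∘L deformedJ t z :
      SolvGroup →L[ℝ] ℂ) : SolvGroup →ₗ[ℝ] ℂ)
  have hGa : ∀ v j, G v j = conj (coframe z j v) + I * conj (coframe z j (deformedJ t z v)) :=
    fun v j => rfl
  have a0 : ∀ v, antiDolbeault t z 0 v = G v 0 := fun v => rfl
  have a1 : ∀ v, antiDolbeault t z 1 v = exp (z 0 - conj (z 0)) * G v 1 := fun v => by
    simp only [antiDolbeault, hGa]
    change exp (z 0 - conj (z 0)) * conj (coframe z 1 v) + I *
      (exp (z 0 - conj (z 0)) * conj (coframe z 1 (deformedJ t z v))) = _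
    ring
  have a2 : ∀ v, antiDolbeault t z 2 v = exp (conj (z 0) - z 0) * G v 2 := fun v => by
    simp only [antiDolbeault, hGa]
    change exp (conj (z 0) - z 0) * conj (coframe z 2 v) + I *
      (exp (conj (z 0) - z 0) * conj (coframe z 2 (deformedJ t z v))) = _
    ring
  have hinj : Function.Injective G := by
    rw [injective_iff_map_eq_zero]
    intro v hv
    have hz : ∀ l, antiDolbeault t z l v = 0 := by
      intro l
      fin_cases l
      · exact (a0 v).trans (congrFun hv 0)
      · exact (a1 v).trans (by rw [hv, Pi.zero_apply, mul_zero])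
      · exact (a2 v).trans (by rw [hv, Pi.zero_apply, mul_zero])
    have hJ : ∀ j, coframe z j (deformedJ t z v) = I * coframe z j v := by
      intro j
      have h := congrFun (deformedCoframe_deformedJ ht z v) j
      rw [Pi.smul_apply, deformedCoframe_apply, deformedCoframe_apply, smul_eq_mul] at h
      have h0 := hz 0
      have h1 := hz 1
      have h2 := hz 2
      have h3 := congrFun hv 3
      rw [hGa, Pi.zero_apply] at h3
      simp only [antiDolbeault] at h0 h1 h2
      split_ifs at h
      · linear_combination h + I * (t j 0 * h0 + t j 1 * h1 + t j 2 * h2 + lastCoeff t * h3) -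
          (t j 0 * dolbeaultForm z 0 (deformedJ t z v) +
            t j 1 * dolbeaultForm z 1 (deformedJ t z v) +
            t j 2 * dolbeaultForm z 2 (deformedJ t z v) +
            lastCoeff t * conj (coframe z 3 (deformedJ t z v))) * I_mul_I
      · linear_combination h + I * (t j 0 * h0 + t j 1 * h1 + t j 2 * h2) -
          (t j 0 * dolbeaultForm z 0 (deformedJ t z v) +
            t j 1 * dolbeaultForm z 1 (deformedJ t z v) +
            t j 2 * dolbeaultForm z 2 (deformedJ t z v)) * I_mul_I
    refine coframe_injective z fun j => ?_
    have h3 := congrFun hv j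
    rw [hGa, hJ, Pi.zero_apply, map_mul, conj_I] at h3
    have h4 : conj (coframe z j v) = 0 := by
      linear_combination (1 / 2) * h3 + (1 / 2) * conj (coframe z j v) * I_mul_I
    simpa using h4
  obtain ⟨v, hv⟩ := (LinearMap.injective_iff_surjective_of_finrank_eq_finrank rfl).1 hinj
    ![b 0, exp (-(z 0 - conj (z 0))) * b 1, exp (-(conj (z 0) - z 0)) * b 2, 0]
  refine ⟨v, fun l => ?_⟩
  fin_cases l
  · exact (a0 v).trans (congrFun hv 0)
  · refine ((a1 v).trans (congrArg _ (congrFun hv 1))).trans ?_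
    change exp _ * (exp _ * b 1) = b 1
    rw [← mul_assoc, ← exp_add, add_neg_cancel, exp_zero, one_mul]
  · refine ((a2 v).trans (congrArg _ (congrFun hv 2))).trans ?_
    change exp _ * (exp _ * b 2) = b 2
    rw [← mul_assoc, ← exp_add, add_neg_cancel, exp_zero, one_mul]

/-- The equations are read off from the torsion on vectors dual to the Dolbeault coframe. -/
theorem kuranishiEquations_of_torsion_eq_zero (ht : IsSmall t) (z : SolvGroup)
    (h : ∀ j v w, torsion t z v w j = 0) : KuranishiEquations t := by
  obtain ⟨v0, h0⟩ := exists_antiDolbeault_eq ht z ![1, 0, 0]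
  obtain ⟨v1, h1⟩ := exists_antiDolbeault_eq ht z ![0, 1, 0]
  obtain ⟨v2, h2⟩ := exists_antiDolbeault_eq ht z ![0, 0, 1]
  have h01 : ∀ j, _ := fun j => (torsion_eq ht z v0 v1 j).symm.trans (h j _ _)
  have h02 : ∀ j, _ := fun j => (torsion_eq ht z v0 v2 j).symm.trans (h j _ _)
  have h12 : ∀ j, _ := fun j => (torsion_eq ht z v1 v2 j).symm.trans (h j _ _)
  simp only [h0, h1, h2, Matrix.cons_val, mul_zero, mul_one, sub_zero, add_zero, zero_add,
    sub_self] at h01 h02 h12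
  have e0 := h01 0
  have e1 := h01 1
  have e2 := h01 2
  have e3 := h01 3
  have f0 := h02 0
  have f1 := h02 1
  have f2 := h02 2
  have f3 := h02 3
  have g0 := h12 0
  have g1 := h12 1
  have g2 := h12 2
  simp only [Matrix.cons_val, neg_eq_zero, mul_eq_zero, OfNat.ofNat_ne_zero, false_or]
    at e0 e1 e2 e3 f0 f1 f2 f3 g0 g1 g2
  simp only [KuranishiEquations, mul_eq_zero]
  exact ⟨e0, f0, e1, f1, e2, f2, g0, g1, g2, e3, f3⟩

theorem torsion_eq_zero (ht : IsSmall t) (h : KuranishiEquations t) (z v w : SolvGroup)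
    (j : Fin 4) : torsion t z v w j = 0 := by
  obtain ⟨h1, h2, h3, h4, h5, h6, h7, h8, h9, h10, h11⟩ := h
  rw [torsion_eq ht, h1, h2, h3, h4, h5, h6, h7, h8, h9, h10, h11]
  fin_cases j <;> simp

theorem map_eq_sum_of_map_I_smul {n : ℕ} (e : (Fin n → ℂ) →L[ℝ] ℂ)
    (he : ∀ u, e (I • u) = I * e u) (u : Fin n → ℂ) : e u = ∑ j, e (Pi.single j 1) * u j := by
  have hs : ∀ (c : ℂ) u, e (c • u) = e u * c := fun c u => by
    have h : c • u = c.re • u + c.im • I • u := by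
      conv_lhs => rw [← re_add_im c, add_smul, mul_smul]
      rfl
    rw [h, map_add, map_smul, map_smul, he, real_smul, real_smul]
    conv_rhs => rw [← re_add_im c]
    ring
  conv_lhs => rw [← Finset.univ_sum_single u, map_sum]
  refine Finset.sum_congr rfl fun j _ => ?_
  rw [← hs, ← Pi.single_smul, smul_eq_mul, mul_one]

/-- `J_t` is integrable exactly when the Kuranishi equations hold. -/
theorem isComplexStructure_deformedJ_iff (Γ : Subgroup SolvGroup)
    (hchar : ∀ γ ∈ Γ, exp (γ 0 - conj (γ 0)) = 1) (ht : IsSmall t) :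
    IsComplexStructure Γ (deformedJ t) ↔ KuranishiEquations t := by
  constructor
  · intro h
    refine kuranishiEquations_of_torsion_eq_zero ht 1 fun j v w => ?_
    let α : SolvGroup → SolvGroup [⋀^Fin 1]→L[ℝ] ℂ := fun z =>
      ContinuousAlternatingMap.ofSubsingleton ℝ SolvGroup ℂ (0 : Fin 1)
        (ContinuousLinearMap.proj j ∘L deformedCoframe t z)
    have hα : ∀ z v, α z v = deformedCoframe t z (v 0) j := fun z v => rfl
    have hs : ContDiff ℝ ∞ α := contDiff_form_of_apply fun v => by
      simp only [hα]
      exact contDiff_pi.1 (contDiff_deformedCoframe_apply t (v 0)) j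
    have h1 : ∀ z, typeComponent (deformedJ t z) 1 0 (α z) = α z := fun z => by
      rw [typeComponent_one_zero_eq_self_iff]
      intro v
      rw [hα, hα, deformedCoframe_deformedJ ht]
      rfl
    have h2 := typeComponent_extDeriv_of_eq_sum ht hs (a := fun i _ => if i = j then 1 else 0)
      (fun _ => contDiff_const) (fun z w => by simp [hα]) 1 v w
    rw [h.integrable α hs h1] at h2
    have h3 : (0 : ℂ) = torsion t 1 v w j / 4 := by simpa using h2
    linear_combination -4 * h3
  · intro h
    refine ⟨contDiff_deformedJ ht, deformedJ_deformedJ ht, fun γ hγ z v => ?_, fun α hα h1 z => ?_⟩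
    · exact deformedJ_leftDiff ht (hchar γ hγ) z v
    · have hI : ∀ z u, (α z fun _ => deformedFrame t z (I • u)) =
          I * α z fun _ => deformedFrame t z u := fun z u => by
        rw [← deformedJ_deformedFrame ht]
        exact (typeComponent_one_zero_eq_self_iff _ _).1 (h1 z) _
      have hsum : ∀ z w, (α z fun _ => w) = ∑ j, (α z fun _ => deformedFrame t z (Pi.single j 1)) *
          deformedCoframe t z w j := by
        intro z w
        have h2 := map_eq_sum_of_map_I_smul
          ((ContinuousAlternatingMap.ofSubsingleton ℝ SolvGroup ℂ (0 : Fin 1)).symm (α z) ∘L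
            deformedFrame t z) (hI z) (deformedCoframe t z w)
        rw [ContinuousLinearMap.comp_apply, deformedFrame_deformedCoframe ht] at h2
        exact h2
      have hz := typeComponent_extDeriv_of_eq_sum ht hα
        (a := fun j z => α z fun _ => deformedFrame t z (Pi.single j 1))
        (fun j => contDiff_form_apply_fields hα fun _ =>
          (contDiff_deformedFrame ht).clm_apply contDiff_const) hsum z
      ext v
      have hv : v = ![v 0, v 1] := by funext i; fin_cases i <;> rfl
      rw [hv, hz]
      simp [torsion_eq_zero ht h]

variable {Γ : Subgroup SolvGroup}

/-! ### Invariant tensors are bounded -/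

/-- A continuous function that is invariant under a cocompact group takes values in a compact
set. -/
theorem isCompact_range_of_invariant (hΓ : IsLattice Γ) {F : Type*} [TopologicalSpace F]
    {f : SolvGroup → F} (hf : Continuous f) (hinv : ∀ γ ∈ Γ, ∀ z, f (γ * z) = f z) :
    IsCompact (Set.range f) := by
  have := hΓ.cocompact
  let f' : MulAction.orbitRel.Quotient Γ SolvGroup → F := Quotient.lift f (by
    rintro a b ⟨γ, rfl⟩
    exact hinv γ γ.2 b)
  have hf' : Continuous f' := continuous_quot_lift _ hf
  have h : Set.range f = Set.range f' := by
    ext x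
    constructor
    · rintro ⟨z, rfl⟩
      exact ⟨Quotient.mk _ z, rfl⟩
    · rintro ⟨q, rfl⟩
      induction q using Quotient.inductionOn with
      | h z => exact ⟨z, rfl⟩
  rw [h]
  exact isCompact_range hf'

/-- `Γ`-invariance of a field of forms on `G`. -/
def IsInvariant (Γ : Subgroup SolvGroup) {k : ℕ}
    (α : SolvGroup → SolvGroup [⋀^Fin k]→L[ℝ] ℂ) : Prop :=
  ∀ γ ∈ Γ, ∀ z, (α (γ * z)).compContinuousLinearMap (leftDiff γ z) = α z

theorem IsInvariant.extDeriv {k : ℕ} {α : SolvGroup → SolvGroup [⋀^Fin k]→L[ℝ] ℂ}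
    (hα : ContDiff ℝ ∞ α) (h : IsInvariant Γ α) : IsInvariant Γ (_root_.extDeriv α) := by
  intro γ hγ z
  have h1 : (fun z => (α (γ * z)).compContinuousLinearMap
      (fderiv ℝ (fun w : SolvGroup => γ * w) z)) = α := funext fun z => h γ hγ z
  have h2 := extDeriv_pullback (𝕜 := ℝ) (x := z) (f := fun w : SolvGroup => γ * w)
    (hα.differentiable (by simp) _) ((contDiff_mul_left γ).contDiffAt) (by
      rw [minSmoothness_of_isRCLikeNormedField]; exact WithTop.coe_le_coe.2 le_top)
  rw [h1] at h2
  exact h2.symm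

theorem deformedFrame_mul_left (ht : IsSmall t) {γ : SolvGroup}
    (hγ : exp (γ 0 - conj (γ 0)) = 1) (z : SolvGroup) :
    deformedFrame t (γ * z) = leftDiff γ z ∘L deformedFrame t z := by
  ext1 u
  apply deformedCoframe_injective ht (γ * z)
  rw [deformedCoframe_deformedFrame ht, ContinuousLinearMap.comp_apply,
    deformedCoframe_leftDiff t hγ, deformedCoframe_deformedFrame ht]

/-- An invariant form is bounded with respect to the deformed coframe. -/
theorem IsInvariant.exists_bound (hΓ : IsLattice Γ)
    (hchar : ∀ γ ∈ Γ, exp (γ 0 - conj (γ 0)) = 1) (ht : IsSmall t) {k : ℕ}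
    {α : SolvGroup → SolvGroup [⋀^Fin k]→L[ℝ] ℂ} (hα : ContDiff ℝ ∞ α) (h : IsInvariant Γ α) :
    ∃ C : ℝ, ∀ z v, ‖α z v‖ ≤ C * ∏ i, ‖deformedCoframe t z (v i)‖ := by
  have hs : ContDiff ℝ ∞ fun z => (α z).compContinuousLinearMap (deformedFrame t z) :=
    contDiff_compContinuousLinearMap hα (contDiff_deformedFrame ht)
  obtain ⟨C, hC⟩ := (isCompact_range_of_invariant hΓ hs.continuous (by
    intro γ hγ z
    rw [deformedFrame_mul_left ht (hchar γ hγ), ← h γ hγ z]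
    rfl)).isBounded.exists_norm_le
  refine ⟨C, fun z v => ?_⟩
  have h1 : α z v = (α z).compContinuousLinearMap (deformedFrame t z)
      fun i => deformedCoframe t z (v i) := by
    rw [ContinuousAlternatingMap.compContinuousLinearMap_apply]
    congr 1
    funext i
    exact (deformedFrame_deformedCoframe ht z (v i)).symm
  rw [h1]
  refine (ContinuousAlternatingMap.le_opNorm _ _).trans ?_
  exact mul_le_mul_of_nonneg_right (hC _ ⟨z, rfl⟩) (by positivity)

/-- A positive continuous invariant function is bounded below by a positive constant and bounded
above. -/
theorem exists_bounds_of_invariant_of_pos (hΓ : IsLattice Γ) {f : SolvGroup → ℝ}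
    (hf : Continuous f) (hinv : ∀ γ ∈ Γ, ∀ z, f (γ * z) = f z) (hpos : ∀ z, 0 < f z) :
    ∃ c C : ℝ, 0 < c ∧ ∀ z, c ≤ f z ∧ f z ≤ C := by
  have h := isCompact_range_of_invariant hΓ hf hinv
  obtain ⟨a, ⟨z₀, rfl⟩, ha⟩ := h.exists_isLeast ⟨f 1, 1, rfl⟩
  obtain ⟨C, hC⟩ := h.bddAbove
  exact ⟨f z₀, C, hpos z₀, fun z => ⟨ha ⟨z, rfl⟩, hC ⟨z, rfl⟩⟩⟩

/-! ### Fundamental forms and their squares -/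

namespace HermitianMetric

variable {J : SolvGroup → SolvGroup →L[ℝ] SolvGroup}

theorem contDiff_fundamentalForm (hJ : ∀ z v, J z (J z v) = -v) (hJs : ContDiff ℝ ∞ J)
    (h : HermitianMetric Γ J) : ContDiff ℝ ∞ h.fundamentalForm := by
  refine contDiff_form_of_apply fun v => ?_
  have hv : v = ![v 0, v 1] := by funext i; fin_cases i <;> rfl
  rw [hv]
  simp only [h.fundamentalForm_apply hJ]
  exact ofRealCLM.contDiff.comp ((h.smooth.clm_apply (hJs.clm_apply contDiff_const)).clm_apply
    contDiff_const)

theorem isInvariant_fundamentalForm (hJ : ∀ z v, J z (J z v) = -v)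
    (hJi : ∀ γ ∈ Γ, ∀ z v, J (γ * z) (leftDiff γ z v) = leftDiff γ z (J z v))
    (h : HermitianMetric Γ J) : IsInvariant Γ h.fundamentalForm := by
  intro γ hγ z
  ext v
  have hv : v = ![v 0, v 1] := by funext i; fin_cases i <;> rfl
  have hv' : (leftDiff γ z ∘ v) = ![leftDiff γ z (v 0), leftDiff γ z (v 1)] := by
    funext i; fin_cases i <;> rfl
  rw [ContinuousAlternatingMap.compContinuousLinearMap_apply, hv', h.fundamentalForm_apply hJ,
    hJi γ hγ, h.invariant γ hγ, hv, h.fundamentalForm_apply hJ]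
  rfl

end HermitianMetric

theorem sum_perm_fin_succ {n : ℕ} (f : Equiv.Perm (Fin (n + 1)) → ℂ) :
    ∑ σ, f σ = ∑ p, ∑ τ : Equiv.Perm (Fin n), f (Equiv.Perm.decomposeFin.symm (p, τ)) := by
  rw [← Equiv.sum_comp Equiv.Perm.decomposeFin.symm, Fintype.sum_prod_type]

/-- The signed sum over the `24` permutations of four indices, written out. -/
theorem sum_perm_fin_four (g : Fin 4 → Fin 4 → Fin 4 → Fin 4 → ℂ) :
    ∑ σ : Equiv.Perm (Fin 4), ((Equiv.Perm.sign σ : ℤ) : ℂ) * g (σ 0) (σ 1) (σ 2) (σ 3) =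
      g 0 1 2 3 - g 0 1 3 2 - g 0 2 1 3 + g 0 2 3 1 + g 0 3 1 2 - g 0 3 2 1 -
      g 1 0 2 3 + g 1 0 3 2 + g 1 2 0 3 - g 1 2 3 0 - g 1 3 0 2 + g 1 3 2 0 +
      g 2 0 1 3 - g 2 0 3 1 - g 2 1 0 3 + g 2 1 3 0 + g 2 3 0 1 - g 2 3 1 0 -
      g 3 0 1 2 + g 3 0 2 1 + g 3 1 0 2 - g 3 1 2 0 - g 3 2 0 1 + g 3 2 1 0 := by
  have h1 : ∀ (p : Fin 4) (q : Fin 3) (r : Fin 2) (τ : Equiv.Perm (Fin 1)),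
      Equiv.Perm.sign (Equiv.Perm.decomposeFin.symm (p, Equiv.Perm.decomposeFin.symm
        (q, Equiv.Perm.decomposeFin.symm (r, τ)))) =
      (if p = 0 then 1 else -1) * (if q = 0 then 1 else -1) * (if r = 0 then 1 else -1) := by
    decide
  have h2 : ∀ (p : Fin 4) (q : Fin 3) (r : Fin 2) (τ : Equiv.Perm (Fin 1)) (i : Fin 4),
      Equiv.Perm.decomposeFin.symm (p, Equiv.Perm.decomposeFin.symm
        (q, Equiv.Perm.decomposeFin.symm (r, τ))) i =
      (![![![![0, 1, 2, 3], ![0, 1, 3, 2]], ![![0, 2, 1, 3], ![0, 2, 3, 1]],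
          ![![0, 3, 2, 1], ![0, 3, 1, 2]]],
        ![![![1, 0, 2, 3], ![1, 0, 3, 2]], ![![1, 2, 0, 3], ![1, 2, 3, 0]],
          ![![1, 3, 2, 0], ![1, 3, 0, 2]]],
        ![![![2, 1, 0, 3], ![2, 1, 3, 0]], ![![2, 0, 1, 3], ![2, 0, 3, 1]],
          ![![2, 3, 0, 1], ![2, 3, 1, 0]]],
        ![![![3, 1, 2, 0], ![3, 1, 0, 2]], ![![3, 2, 1, 0], ![3, 2, 0, 1]],
          ![![3, 0, 2, 1], ![3, 0, 1, 2]]]] : Fin 4 → Fin 3 → Fin 2 → Fin 4 → Fin 4) p q r i := by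
    decide
  simp only [sum_perm_fin_succ (n := 3), sum_perm_fin_succ (n := 2), sum_perm_fin_succ (n := 1),
    Fin.sum_univ_four, Fin.sum_univ_three, Fin.sum_univ_two, Fintype.sum_unique, h1]
  simp only [h2, Matrix.cons_val]
  simp
  ring

theorem wedge_two_two_apply {V : Type*} [NormedAddCommGroup V] [NormedSpace ℝ V]
    (α : V [⋀^Fin 2]→L[ℝ] ℂ) (v : Fin 4 → V) :
    wedge α α v = 2 * (α ![v 0, v 1] * α ![v 2, v 3] - α ![v 0, v 2] * α ![v 1, v 3] +
      α ![v 0, v 3] * α ![v 1, v 2]) := by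
  have h : ∀ σ : Equiv.Perm (Fin 4), mulForms α α (v ∘ σ) =
      α ![v (σ 0), v (σ 1)] * α ![v (σ 2), v (σ 3)] := by
    intro σ
    rw [mulForms_apply]
    congr 2 <;> funext i <;> fin_cases i <;> rfl
  have hs : ∀ i j, α ![v j, v i] = -α ![v i, v j] := fun i j => twoForm_swap α _ _
  have h2 : wedge α α v = (1 / 4 : ℂ) * ∑ σ : Equiv.Perm (Fin 4), ((Equiv.Perm.sign σ : ℤ) : ℂ) *
      (α ![v (σ 0), v (σ 1)] * α ![v (σ 2), v (σ 3)]) := by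
    have h3 : wedge α α v = (((2 : ℕ).factorial * (2 : ℕ).factorial : ℝ)⁻¹) •
      ContinuousMultilinearMap.alternatization (mulForms α α) v := rfl
    rw [h3, ContinuousMultilinearMap.alternatization_apply_apply]
    simp only [h, real_smul]
    congr 1
    · norm_num [Nat.factorial]
    · refine Finset.sum_congr rfl fun σ _ => ?_
      rcases Int.units_eq_one_or (Equiv.Perm.sign σ) with h | h <;> rw [h] <;> simp
  rw [h2]
  rw [sum_perm_fin_four fun i j k l => α ![v i, v j] * α ![v k, v l]]
  simp only [hs 0 1, hs 0 2, hs 0 3, hs 1 2, hs 1 3, hs 2 3]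
  ring

theorem hasWeight_zero_of_invariant {V : Type*} [NormedAddCommGroup V] [NormedSpace ℝ V]
    {J : V →L[ℝ] V} (hJ : ∀ v, J (J v) = -v) {α : V [⋀^Fin 2]→L[ℝ] ℂ}
    (h : ∀ v w, α ![J v, J w] = α ![v, w]) : HasWeight J 0 α := by
  intro θ v
  have hr : (fun i => typeRotation J θ (v i)) =
      ![typeRotation J θ (v 0), typeRotation J θ (v 1)] := by
    funext i; fin_cases i <;> rfl
  have hv : v = ![v 0, v 1] := by funext i; fin_cases i <;> rfl
  have h1 : α ![J (v 0), v 1] = -α ![v 0, J (v 1)] := by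
    rw [← h (v 0) (J (v 1)), hJ, ← neg_one_smul ℝ (v 1), twoForm_smul_right, neg_one_smul, neg_neg]
  have hcs : (Real.cos θ : ℂ) ^ 2 + (Real.sin θ : ℂ) ^ 2 = 1 := by
    exact_mod_cast Real.cos_sq_add_sin_sq θ
  rw [hr, hv]
  simp only [Matrix.cons_val, typeRotation_apply, twoForm_add_left, twoForm_add_right,
    twoForm_smul_left, twoForm_smul_right, h, h1, real_smul, Int.cast_zero, zero_mul, neg_zero,
    exp_zero, one_mul]
  linear_combination α ![v 0, v 1] * hcs

theorem hasWeight_wedge {V : Type*} [NormedAddCommGroup V] [NormedSpace ℝ V]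
    {J : V →L[ℝ] V} {α : V [⋀^Fin 2]→L[ℝ] ℂ} (h : HasWeight J 0 α) :
    HasWeight J 0 (wedge α α) := by
  intro θ v
  have h2 : ∀ x y, α ![typeRotation J θ x, typeRotation J θ y] = α ![x, y] := fun x y => by
    have h3 := h θ ![x, y]
    have hr : (fun i => typeRotation J θ ((![x, y] : Fin 2 → V) i)) =
        ![typeRotation J θ x, typeRotation J θ y] := by
      funext i; fin_cases i <;> rfl
    rw [hr] at h3
    simpa using h3
  rw [wedge_two_two_apply, wedge_two_two_apply]
  simp only [h2]
  simp

/-! ### Pull-back by holomorphic maps -/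

section Pullback

set_option linter.unusedSectionVars false

variable {E : Type*} [NormedAddCommGroup E] [NormedSpace ℝ E] [NormedSpace ℂ E]
  [IsScalarTower ℝ ℂ E] [FiniteDimensional ℝ E]

/-- The pull-back of a form by a map into `G`. -/
def pullbackForm {k : ℕ} (f : E → SolvGroup) (α : SolvGroup → SolvGroup [⋀^Fin k]→L[ℝ] ℂ) (w : E) :
    E [⋀^Fin k]→L[ℝ] ℂ :=
  (α (f w)).compContinuousLinearMap (fderiv ℝ f w)

/-- `f` is holomorphic as a map from the complex vector space `E` to `(G, J)`. Differentiability is not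
part of the definition. -/
def IsHolomorphicMap (J : SolvGroup → SolvGroup →L[ℝ] SolvGroup) (f : E → SolvGroup) : Prop :=
  ∀ w v, J (f w) (fderiv ℝ f w v) = fderiv ℝ f w (I • v)

variable {f : E → SolvGroup} {J : SolvGroup → SolvGroup →L[ℝ] SolvGroup} {k : ℕ}
  {α : SolvGroup → SolvGroup [⋀^Fin k]→L[ℝ] ℂ}

theorem contDiff_pullbackForm (hf : ContDiff ℝ ∞ f) (hα : ContDiff ℝ ∞ α) :
    ContDiff ℝ ∞ (pullbackForm f α) :=
  contDiff_compContinuousLinearMap (hα.comp hf) (hf.fderiv_right (by simp))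

theorem extDeriv_pullbackForm (hf : ContDiff ℝ ∞ f) (hα : ContDiff ℝ ∞ α) :
    extDeriv (pullbackForm f α) = pullbackForm f (extDeriv α) := by
  funext w
  exact extDeriv_pullback (hα.differentiable (by simp) _) hf.contDiffAt (by
    rw [minSmoothness_of_isRCLikeNormedField]; exact WithTop.coe_le_coe.2 le_top)

theorem typeComponent_pullbackForm (hf : IsHolomorphicMap J f) (p q : ℕ) :
    (fun w => typeComponent (mulI E) p q (pullbackForm f α w)) =
      pullbackForm f fun z => typeComponent (J z) p q (α z) := by
  funext w
  exact typeComponent_compContinuousLinearMap _ _ _ (fun v => hf w v) _ _ _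

theorem contDiff_typeComponent (hJ : ContDiff ℝ ∞ J) (hα : ContDiff ℝ ∞ α) (p q : ℕ) :
    ContDiff ℝ ∞ fun z => typeComponent (J z) p q (α z) := by
  unfold typeComponent
  refine ContDiff.const_smul _ (ContDiff.sum fun m _ => ContDiff.const_smul _ ?_)
  have hA : ContDiff ℝ ∞ fun z =>
      Real.cos (2 * Real.pi * m / (2 * k + 1)) • ContinuousLinearMap.id ℝ SolvGroup +
        Real.sin (2 * Real.pi * m / (2 * k + 1)) • J z :=
    contDiff_const.add (hJ.const_smul _)
  exact contDiff_compContinuousLinearMap hα hA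

/-- The operators `∂` and `∂bar` commute with pull-back by a holomorphic map. -/
theorem del_delBar_pullbackForm (hf : ContDiff ℝ ∞ f) (hol : IsHolomorphicMap J f)
    (hJ : ContDiff ℝ ∞ J) (hα : ContDiff ℝ ∞ α) (p q p' q' : ℕ) :
    del (fun _ => mulI E) p q (delBar (fun _ => mulI E) p' q' (pullbackForm f α)) =
      pullbackForm f (del J p q (delBar J p' q' α)) := by
  have h1 : delBar (fun _ => mulI E) p' q' (pullbackForm f α) =
      pullbackForm f (delBar J p' q' α) := by
    unfold delBar
    rw [extDeriv_pullbackForm hf hα]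
    exact typeComponent_pullbackForm hol _ _
  have h2 : ContDiff ℝ ∞ (delBar J p' q' α) := contDiff_typeComponent hJ (contDiff_extDeriv hα) _ _
  rw [h1]
  unfold del
  rw [extDeriv_pullbackForm hf h2]
  exact typeComponent_pullbackForm hol _ _

theorem hasWeight_pullbackForm (hol : IsHolomorphicMap J f) (h : ∀ z, HasWeight (J z) 0 (α z))
    (w : E) : HasWeight (mulI E) 0 (pullbackForm f α w) := by
  intro θ v
  have h1 := h (f w) θ fun i => fderiv ℝ f w (v i)
  have e : ∀ u, typeRotation (J (f w)) θ (fderiv ℝ f w u) =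
      fderiv ℝ f w (typeRotation (mulI E) θ u) := fun u => by
    rw [typeRotation_apply, typeRotation_apply, hol, map_add, ContinuousLinearMap.map_smul,
      ContinuousLinearMap.map_smul, mulI_apply]
  simp only [e] at h1
  exact h1

end Pullback

/-! ### SKT metrics -/

theorem norm_pullbackForm_le {E : Type*} [NormedAddCommGroup E] [NormedSpace ℝ E]
    {f : E → SolvGroup} {k : ℕ} {α : SolvGroup → SolvGroup [⋀^Fin k]→L[ℝ] ℂ} {C : ℝ}
    (hC : ∀ z v, ‖α z v‖ ≤ C * ∏ i, ‖deformedCoframe t z (v i)‖) (w : E) (v : Fin k → E)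
    {u : Fin k → Fin 4 → ℂ}
    (hu : ∀ i, deformedCoframe t (f w) (fderiv ℝ f w (v i)) = u i) :
    ‖pullbackForm f α w v‖ ≤ C * ∏ i, ‖u i‖ := by
  refine (hC (f w) fun i => fderiv ℝ f w (v i)).trans_eq ?_
  simp only [hu]

theorem pullbackForm_two_apply {E : Type*} [NormedAddCommGroup E] [NormedSpace ℝ E]
    {f : E → SolvGroup} {α : SolvGroup → SolvGroup [⋀^Fin 2]→L[ℝ] ℂ} (w a b : E) :
    pullbackForm f α w ![a, b] = α (f w) ![fderiv ℝ f w a, fderiv ℝ f w b] := by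
  rw [pullbackForm, ContinuousAlternatingMap.compContinuousLinearMap_apply]
  congr 1
  funext i
  fin_cases i <;> rfl

/-- The squared length of a non-zero combination of the deformed frame with constant coefficients is
bounded below. -/
theorem HermitianMetric.exists_pos_le_frame (hΓ : IsLattice Γ)
    (hchar : ∀ γ ∈ Γ, exp (γ 0 - conj (γ 0)) = 1) (ht : IsSmall t)
    (h : HermitianMetric Γ (deformedJ t)) {u : Fin 4 → ℂ} (hu : u ≠ 0) :
    ∃ c : ℝ, 0 < c ∧ ∀ z, c ≤ h.g z (deformedFrame t z u) (deformedFrame t z u) := by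
  have hs : ContDiff ℝ ∞ fun z => deformedFrame t z u :=
    (contDiff_deformedFrame ht).clm_apply contDiff_const
  have hcont : Continuous fun z => h.g z (deformedFrame t z u) (deformedFrame t z u) :=
    ((h.smooth.clm_apply hs).clm_apply hs).continuous
  obtain ⟨c, C, hc, hcC⟩ := exists_bounds_of_invariant_of_pos hΓ hcont (fun γ hγ z => by
    rw [deformedFrame_mul_left ht (hchar γ hγ)]
    exact h.invariant γ hγ _ _ _) (fun z => h.pos z _ fun h0 => hu (by
      rw [← deformedCoframe_deformedFrame ht z u, h0, map_zero]))
  exact ⟨c, hc, fun z => (hcC z).1⟩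

theorem HermitianMetric.fundamentalForm_frame (ht : IsSmall t)
    (h : HermitianMetric Γ (deformedJ t)) (z : SolvGroup) (u : Fin 4 → ℂ) (a b : ℂ) :
    h.fundamentalForm z ![deformedFrame t z (a • u), deformedFrame t z (b • u)] =
      h.g z (deformedFrame t z u) (deformedFrame t z u) * (conj a * b).im := by
  have e : ∀ a : ℂ, deformedFrame t z (a • u) =
      a.re • deformedFrame t z u + a.im • deformedJ t z (deformedFrame t z u) := fun a => by
    rw [deformedJ_deformedFrame ht, ← map_smul, ← map_smul, ← map_add]
    congr 1
    conv_lhs => rw [← re_add_im a, add_smul, mul_smul]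
    rfl
  have hJ := deformedJ_deformedJ ht z
  rw [h.fundamentalForm_apply (deformedJ_deformedJ ht), ← ofReal_mul, e, e]
  congr 1
  set v := deformedFrame t z u
  have h1 := h.compatible z v v
  have h2 := h.compatible z v (deformedJ t z v)
  rw [hJ, map_neg] at h2
  have h3 := h.symm z v (deformedJ t z v)
  simp only [map_add, map_smul, add_apply, smul_apply, smul_eq_mul, hJ, map_neg, neg_apply, h1,
    mul_im, conj_re, conj_im]
  linear_combination (a.re * b.re - a.im * b.im) / 2 * (-h2 - h3) - a.im * b.im * h3

/-- If there is a holomorphic map from `ℂ² × ℂ` to `(G, J_t)` along which the deformed coframe is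
`(0, dx_1, dx_2, dy - K(x, dx))`, and the bracket `c` of `K` satisfies `hpos`, then there is no SKT
metric. -/
theorem not_isSKT_of_holomorphicMap (hΓ : IsLattice Γ)
    (hchar : ∀ γ ∈ Γ, exp (γ 0 - conj (γ 0)) = 1) (ht : IsSmall t)
    {K : ℂ × ℂ →L[ℝ] ℂ × ℂ →L[ℝ] ℂ} (hK : ∀ x v, K x (I • v) = I * K x v)
    {f : (ℂ × ℂ) × ℂ → SolvGroup} (hf : ContDiff ℝ ∞ f)
    (hfθ : ∀ w v, deformedCoframe t (f w) (fderiv ℝ f w v) =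
      ![0, v.1.1, v.1.2, v.2 - K w.1 v.1])
    {c : ℂ × ℂ → ℂ × ℂ → ℂ} (hc : ∀ u v, c u v = K u v - K v u) (y w : ℂ × ℂ)
    (hpos : 0 < ‖c y w‖ ^ 2 + ‖c (I • y) (I • w)‖ ^ 2 + ‖c y (I • w)‖ ^ 2 + ‖c (I • y) w‖ ^ 2 -
      2 * (conj (c y (I • y)) * c w (I • w)).re)
    (h : HermitianMetric Γ (deformedJ t)) : ¬ h.IsSKT := by
  intro hskt
  have hJ := deformedJ_deformedJ ht
  have hJs := contDiff_deformedJ ht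
  have hol : IsHolomorphicMap (deformedJ t) f := fun w v => by
    rw [deformedJ_eq_iff ht, hfθ, hfθ]
    simp [hK, mul_sub]
  have hω := h.contDiff_fundamentalForm hJ hJs
  have hωi := h.isInvariant_fundamentalForm hJ fun γ hγ z v =>
    deformedJ_leftDiff ht (hchar γ hγ) z v
  have hη := contDiff_pullbackForm hf hω
  have hw : ∀ x, HasWeight (mulI _) 0 (pullbackForm f h.fundamentalForm x) :=
    hasWeight_pullbackForm hol fun z => hasWeight_zero_of_invariant (hJ z) fun v w => by
      rw [h.fundamentalForm_apply hJ, h.fundamentalForm_apply hJ, h.compatible]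
  have hdd := extDeriv_extDeriv_comp_eq_zero (J := mulI ((ℂ × ℂ) × ℂ)) mulI_mulI hη hw 1
    (fun x => by
      rw [del_delBar_pullbackForm hf hol hJs hω, pullbackForm, hskt]
      rfl)
  obtain ⟨C, hC⟩ := hωi.exists_bound hΓ hchar ht hω
  obtain ⟨C', hC'⟩ := (hωi.extDeriv hω).exists_bound hΓ hchar ht (contDiff_extDeriv hω)
  have hE : ∀ v w, deformedCoframe t (f w) (fderiv ℝ f w (horizontalField K v w)) =
      ![0, v.1, v.2, 0] := fun v w => by
    rw [hfθ]
    simp [horizontalField]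
  have hS : ∀ s w, deformedCoframe t (f w) (fderiv ℝ f w ((0, s) : (ℂ × ℂ) × ℂ)) =
      ![0, 0, 0, s] := fun s w => by
    rw [hfθ]
    simp
  obtain ⟨c₀, hc₀, hle⟩ := h.exists_pos_le_frame hΓ hchar ht (u := ![0, 0, 0, 1])
    (fun h0 => one_ne_zero (congrFun h0 3))
  refine false_of_extDeriv_comp_extDeriv_eq_zero hη hdd hK (fun u v => ?_) (fun s v => ?_)
    (fun u v w => ?_) hc₀ (G := fun w => h.g (f w) (deformedFrame t (f w) ![0, 0, 0, 1])
      (deformedFrame t (f w) ![0, 0, 0, 1])) (fun w => hle (f w)) (fun w a b => ?_) hc y w hpos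
  · exact ⟨_, fun z => norm_pullbackForm_le hC z _
      (u := ![![0, u.1, u.2, 0], ![0, v.1, v.2, 0]]) fun i => by
        fin_cases i
        exacts [hE u z, hE v z]⟩
  · exact ⟨_, fun z => norm_pullbackForm_le hC z _
      (u := ![![0, 0, 0, s], ![0, v.1, v.2, 0]]) fun i => by
        fin_cases i
        exacts [hS s z, hE v z]⟩
  · refine ⟨C' * ∏ i, ‖(![![0, u.1, u.2, 0], ![0, v.1, v.2, 0], ![0, w.1, w.2, 0]] :
      Fin 3 → Fin 4 → ℂ) i‖, fun z => ?_⟩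
    rw [extDeriv_pullbackForm hf hω]
    exact norm_pullbackForm_le hC' z _ fun i => by
        fin_cases i
        exacts [hE u z, hE v z, hE w z]
  · have e : ∀ a, fderiv ℝ f w ((0, a) : (ℂ × ℂ) × ℂ) =
        deformedFrame t (f w) (a • ![0, 0, 0, 1]) := fun a => by
      rw [← deformedFrame_deformedCoframe ht (f w) (fderiv ℝ f w _), hS]
      simp
    rw [pullbackForm_two_apply, e, e, h.fundamentalForm_frame ht]

/-! ### The fibre of the first coordinate -/

/-- The inverse of the real-linear map `σ ↦ σ + s conj σ` of `ℂ`, for `‖s‖ < 1`. -/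
def conjInverse (s : ℂ) : ℂ →L[ℝ] ℂ :=
  (1 - ‖s‖ ^ 2)⁻¹ • (ContinuousLinearMap.id ℝ ℂ - s • (conjCLE : ℂ →L[ℝ] ℂ))

theorem conjInverse_add {s : ℂ} (hs : ‖s‖ < 1) (σ : ℂ) :
    conjInverse s σ + s * conj (conjInverse s σ) = σ := by
  have h : (1 - (‖s‖ : ℂ) ^ 2) ≠ 0 := by
    have : (1 - ‖s‖ ^ 2 : ℝ) ≠ 0 := by nlinarith [norm_nonneg s]
    exact_mod_cast this
  have hn : s * conj s = (‖s‖ : ℂ) ^ 2 := mul_conj' s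
  have e : conjInverse s σ = (1 - (‖s‖ : ℂ) ^ 2)⁻¹ * (σ - s * conj σ) := by
    simp [conjInverse]
  rw [e]
  simp only [map_mul, map_inv₀, map_sub, map_one, map_pow, conj_ofReal, conj_conj]
  field_simp
  linear_combination -σ * hn

/-- The real bilinear form `a_1 b_2 - a_2 b_1` on `ℂ²`. -/
def detForm : ℂ × ℂ →L[ℝ] ℂ × ℂ →L[ℝ] ℂ :=
  (ContinuousLinearMap.mul ℝ ℂ).bilinearComp (ContinuousLinearMap.fst ℝ ℂ ℂ)
      (ContinuousLinearMap.snd ℝ ℂ ℂ) -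
    (ContinuousLinearMap.mul ℝ ℂ).bilinearComp (ContinuousLinearMap.snd ℝ ℂ ℂ)
      (ContinuousLinearMap.fst ℝ ℂ ℂ)

theorem detForm_apply (a b : ℂ × ℂ) : detForm a b = a.1 * b.2 - a.2 * b.1 := rfl

/-- The inverse `P` of the real-linear map `z ↦ z + T conj z` of `ℂ²`, for a small matrix `T`. -/
theorem exists_inverse_add_conj (ht : IsSmall t) : ∃ P : ℂ × ℂ →L[ℝ] ℂ × ℂ, ∀ w,
    (P w).1 + t 1 1 * conj (P w).1 + t 1 2 * conj (P w).2 = w.1 ∧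
    (P w).2 + t 2 1 * conj (P w).1 + t 2 2 * conj (P w).2 = w.2 := by
  let L : ℂ × ℂ →ₗ[ℝ] ℂ × ℂ :=
    { toFun := fun z => (z.1 + t 1 1 * conj z.1 + t 1 2 * conj z.2,
        z.2 + t 2 1 * conj z.1 + t 2 2 * conj z.2)
      map_add' := fun x y => by
        ext1 <;> simp <;> ring
      map_smul' := fun r x => by
        ext1 <;> simp <;> ring }
  have hinj : Function.Injective L := by
    rw [injective_iff_map_eq_zero]
    intro z hz
    have h1 : z.1 + t 1 1 * conj z.1 + t 1 2 * conj z.2 = 0 := congrArg Prod.fst hz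
    have h2 : z.2 + t 2 1 * conj z.1 + t 2 2 * conj z.2 = 0 := congrArg Prod.snd hz
    have hb : ∀ j l (a : ℂ), ‖t j l * conj a‖ ≤ 1 / 100 * ‖a‖ := fun j l a => by
      rw [norm_mul, RCLike.norm_conj]
      exact mul_le_mul_of_nonneg_right (ht j l) (norm_nonneg _)
    have e1 : z.1 = -(t 1 1 * conj z.1 + t 1 2 * conj z.2) := by linear_combination h1
    have e2 : z.2 = -(t 2 1 * conj z.1 + t 2 2 * conj z.2) := by linear_combination h2
    have n1 : ‖z.1‖ ≤ 1 / 100 * ‖z.1‖ + 1 / 100 * ‖z.2‖ := by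
      conv_lhs => rw [e1, norm_neg]
      exact (norm_add_le _ _).trans (add_le_add (hb _ _ _) (hb _ _ _))
    have n2 : ‖z.2‖ ≤ 1 / 100 * ‖z.1‖ + 1 / 100 * ‖z.2‖ := by
      conv_lhs => rw [e2, norm_neg]
      exact (norm_add_le _ _).trans (add_le_add (hb _ _ _) (hb _ _ _))
    have p1 := norm_nonneg z.1
    have p2 := norm_nonneg z.2
    exact Prod.ext (norm_eq_zero.1 (by linarith)) (norm_eq_zero.1 (by linarith))
  let e := LinearEquiv.ofInjectiveEndo L hinj
  refine ⟨LinearMap.toContinuousLinearMap (e.symm : ℂ × ℂ →ₗ[ℝ] ℂ × ℂ), fun w => ?_⟩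
  have h : L (e.symm w) = w := e.apply_symm_apply w
  exact ⟨congrArg Prod.fst h, congrArg Prod.snd h⟩

/-- The bracket `c(u, v) = det(P u, P v) + s conj (det(P u, P v))` on the fibre `z_1 = 0`, where `s`
is the coefficient of `conj φ⁴ ⊗ Z₄` and `P` is the inverse of `z ↦ z + T conj z` on the coordinates
`(z_2, z_3)`. -/
def fibreBracket (s : ℂ) (P : ℂ × ℂ →L[ℝ] ℂ × ℂ) : ℂ × ℂ →L[ℝ] ℂ × ℂ →L[ℝ] ℂ :=
  detForm.bilinearComp P P + s • ContinuousLinearMap.compL ℝ (ℂ × ℂ) ℂ ℂ (conjCLE : ℂ →L[ℝ] ℂ) ∘L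
    detForm.bilinearComp P P

theorem fibreBracket_apply (s : ℂ) (P : ℂ × ℂ →L[ℝ] ℂ × ℂ) (u v : ℂ × ℂ) :
    fibreBracket s P u v = detForm (P u) (P v) + s * conj (detForm (P u) (P v)) := rfl

theorem fibreBracket_swap (s : ℂ) (P : ℂ × ℂ →L[ℝ] ℂ × ℂ) (u v : ℂ × ℂ) :
    fibreBracket s P v u = -fibreBracket s P u v := by
  have h : detForm (P v) (P u) = -detForm (P u) (P v) := by
    rw [detForm_apply, detForm_apply]; ring
  rw [fibreBracket_apply, fibreBracket_apply, h, map_neg]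
  ring

/-- A bilinear form `S` whose quadratic form enters the last coordinate of the holomorphic
parametrisation of the fibre. It is chosen so that `fibreForm` is complex linear in its second
argument. -/
def fibrePotential (s : ℂ) (P : ℂ × ℂ →L[ℝ] ℂ × ℂ) : ℂ × ℂ →L[ℝ] ℂ × ℂ →L[ℝ] ℂ :=
  (-1 / 4 : ℂ) • fibreBracket s P +
    (-I / 4 : ℂ) • (fibreBracket s P).bilinearComp (ContinuousLinearMap.id ℝ _) (mulI _)

theorem fibrePotential_apply (s : ℂ) (P : ℂ × ℂ →L[ℝ] ℂ × ℂ) (u v : ℂ × ℂ) :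
    fibrePotential s P u v =
      -1 / 4 * fibreBracket s P u v + -I / 4 * fibreBracket s P u (I • v) := rfl

/-- The bilinear form `K (u, v) = S (u, v) + S (v, u) + c (u, v) / 2` for which `φ_t^4 = dw - K(x, dx)`
on the fibre. -/
def fibreForm (s : ℂ) (P : ℂ × ℂ →L[ℝ] ℂ × ℂ) : ℂ × ℂ →L[ℝ] ℂ × ℂ →L[ℝ] ℂ :=
  fibrePotential s P + (fibrePotential s P).flip + (1 / 2 : ℂ) • fibreBracket s P

theorem fibreForm_apply (s : ℂ) (P : ℂ × ℂ →L[ℝ] ℂ × ℂ) (u v : ℂ × ℂ) :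
    fibreForm s P u v = fibrePotential s P u v + fibrePotential s P v u +
      1 / 2 * fibreBracket s P u v := rfl

theorem fibreBracket_eq (s : ℂ) (P : ℂ × ℂ →L[ℝ] ℂ × ℂ) (u v : ℂ × ℂ) :
    fibreBracket s P u v = fibreForm s P u v - fibreForm s P v u := by
  rw [fibreForm_apply, fibreForm_apply, fibreBracket_swap s P u v]
  ring

/-- The bracket has no `(0,2)`-part: this is where the value of the coefficient of
`conj φ⁴ ⊗ Z₄` matters. -/
theorem fibreBracket_zero_two {s : ℂ} {P : ℂ × ℂ →L[ℝ] ℂ × ℂ}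
    (hs : s = -(t 1 1 * t 2 2) + t 1 2 * t 2 1)
    (hP : ∀ w, (P w).1 + t 1 1 * conj (P w).1 + t 1 2 * conj (P w).2 = w.1 ∧
      (P w).2 + t 2 1 * conj (P w).1 + t 2 2 * conj (P w).2 = w.2) (u v : ℂ × ℂ) :
    fibreBracket s P u v - fibreBracket s P (I • u) (I • v) + I * fibreBracket s P (I • u) v +
      I * fibreBracket s P u (I • v) = 0 := by
  -- on vectors of type `(0,1)` the coordinates satisfy `dz = -T conj (dz)`
  have h1 : ∀ u, (P u).1 + I * (P (I • u)).1 =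
      -(t 1 1 * conj ((P u).1 - I * (P (I • u)).1) +
        t 1 2 * conj ((P u).2 - I * (P (I • u)).2)) := fun u => by
    have a := (hP u).1
    have b := (hP (I • u)).1
    rw [Prod.smul_fst, smul_eq_mul] at b
    simp only [map_sub, map_mul, conj_I]
    linear_combination a + I * b + u.1 * I_mul_I
  have h2 : ∀ u, (P u).2 + I * (P (I • u)).2 =
      -(t 2 1 * conj ((P u).1 - I * (P (I • u)).1) +
        t 2 2 * conj ((P u).2 - I * (P (I • u)).2)) := fun u => by
    have a := (hP u).2
    have b := (hP (I • u)).2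
    rw [Prod.smul_snd, smul_eq_mul] at b
    simp only [map_sub, map_mul, conj_I]
    linear_combination a + I * b + u.2 * I_mul_I
  have e : fibreBracket s P u v - fibreBracket s P (I • u) (I • v) +
      I * fibreBracket s P (I • u) v + I * fibreBracket s P u (I • v) =
      (((P u).1 + I * (P (I • u)).1) * ((P v).2 + I * (P (I • v)).2) -
        ((P u).2 + I * (P (I • u)).2) * ((P v).1 + I * (P (I • v)).1)) +
      s * (conj ((P u).1 - I * (P (I • u)).1) * conj ((P v).2 - I * (P (I • v)).2) -
        conj ((P u).2 - I * (P (I • u)).2) * conj ((P v).1 - I * (P (I • v)).1)) := by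
    simp only [fibreBracket_apply, detForm_apply, map_sub, map_mul, conj_I]
    ring_nf
    simp only [I_sq]
    ring
  rw [e, h1, h1, h2, h2, hs]
  ring

theorem fibreForm_I_smul {s : ℂ} {P : ℂ × ℂ →L[ℝ] ℂ × ℂ}
    (hs : s = -(t 1 1 * t 2 2) + t 1 2 * t 2 1)
    (hP : ∀ w, (P w).1 + t 1 1 * conj (P w).1 + t 1 2 * conj (P w).2 = w.1 ∧
      (P w).2 + t 2 1 * conj (P w).1 + t 2 2 * conj (P w).2 = w.2) (u v : ℂ × ℂ) :
    fibreForm s P u (I • v) = I * fibreForm s P u v := by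
  have h := fibreBracket_zero_two hs hP u v
  have hII : ∀ v : ℂ × ℂ, I • I • v = -v := fun v => by simp [smul_smul]
  have e1 : fibreBracket s P u (-v) = -fibreBracket s P u v := map_neg _ _
  simp only [fibreForm_apply, fibrePotential_apply, hII, e1]
  rw [fibreBracket_swap s P u (I • v), fibreBracket_swap s P (I • u) (I • v),
    fibreBracket_swap s P u v, fibreBracket_swap s P (I • u) v]
  linear_combination (-I / 4) * h + 1 / 2 * fibreBracket s P u (I • v) * I_mul_I

/-- The holomorphic parametrisation of the fibre `z_1 = 0` by `ℂ² × ℂ`, when `t_{12} = t_{13} = 0`.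
The second and third coordinates of the deformed coframe become `dw_1` and `dw_2`. -/
def fibreMap (t : Param) (P : ℂ × ℂ →L[ℝ] ℂ × ℂ) (w : (ℂ × ℂ) × ℂ) : SolvGroup :=
  ![0, (P w.1).1, (P w.1).2, conjInverse (lastCoeff t) (w.2 - t 3 1 * conj (P w.1).1 -
    t 3 2 * conj (P w.1).2 - fibrePotential (lastCoeff t) P w.1 w.1)]

theorem contDiff_fibreMap (t : Param) (P : ℂ × ℂ →L[ℝ] ℂ × ℂ) : ContDiff ℝ ∞ (fibreMap t P) := by
  have h1 : ContDiff ℝ ∞ fun w : (ℂ × ℂ) × ℂ => (P w.1).1 := by fun_prop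
  have h2 : ContDiff ℝ ∞ fun w : (ℂ × ℂ) × ℂ => (P w.1).2 := by fun_prop
  have c1 : ContDiff ℝ ∞ fun w : (ℂ × ℂ) × ℂ => conj (P w.1).1 :=
    (conjCLE : ℂ →L[ℝ] ℂ).contDiff.comp h1
  have c2 : ContDiff ℝ ∞ fun w : (ℂ × ℂ) × ℂ => conj (P w.1).2 :=
    (conjCLE : ℂ →L[ℝ] ℂ).contDiff.comp h2
  refine contDiff_pi.2 fun i => ?_
  fin_cases i
  · exact contDiff_const
  · exact h1
  · exact h2
  · change ContDiff ℝ ∞ fun w : (ℂ × ℂ) × ℂ => conjInverse (lastCoeff t) (w.2 -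
      t 3 1 * conj (P w.1).1 - t 3 2 * conj (P w.1).2 - fibrePotential (lastCoeff t) P w.1 w.1)
    fun_prop

theorem hasDerivAt_line_coord {E : Type*} [NormedAddCommGroup E] [NormedSpace ℝ E]
    {f : E → SolvGroup} (hf : ContDiff ℝ ∞ f) (w v : E) (i : Fin 4) :
    HasDerivAt (fun τ : ℝ => f (w + τ • v) i) (fderiv ℝ f w v i) 0 :=
  hasDerivAt_pi.1 ((hf.differentiable (by simp) w).hasFDerivAt.hasLineDerivAt v) i

theorem hasDerivAt_clm_line {E F : Type*} [NormedAddCommGroup E] [NormedSpace ℝ E]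
    [NormedAddCommGroup F] [NormedSpace ℝ F] (A : E →L[ℝ] F) (w v : E) :
    HasDerivAt (fun τ : ℝ => A (w + τ • v)) (A v) 0 :=
  A.hasFDerivAt.hasLineDerivAt v

theorem deformedCoframe_fderiv_fibreMap (ht : IsSmall t) (h01 : t 0 1 = 0) (h02 : t 0 2 = 0)
    {P : ℂ × ℂ →L[ℝ] ℂ × ℂ} (hP : ∀ w, (P w).1 + t 1 1 * conj (P w).1 + t 1 2 * conj (P w).2 = w.1 ∧
      (P w).2 + t 2 1 * conj (P w).1 + t 2 2 * conj (P w).2 = w.2) (w v : (ℂ × ℂ) × ℂ) :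
    deformedCoframe t (fibreMap t P w) (fderiv ℝ (fibreMap t P) w v) =
      ![0, v.1.1, v.1.2, v.2 - fibreForm (lastCoeff t) P w.1 v.1] := by
  have hc := hasDerivAt_line_coord (contDiff_fibreMap t P) w v
  set S := fibrePotential (lastCoeff t) P with hS
  set D := fderiv ℝ (fibreMap t P) w v with hD
  have hP1 : HasDerivAt (fun τ : ℝ => (P (w + τ • v).1).1) (P v.1).1 0 :=
    hasDerivAt_clm_line (ContinuousLinearMap.fst ℝ ℂ ℂ ∘L P ∘L ContinuousLinearMap.fst ℝ _ ℂ) w v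
  have hP2 : HasDerivAt (fun τ : ℝ => (P (w + τ • v).1).2) (P v.1).2 0 :=
    hasDerivAt_clm_line (ContinuousLinearMap.snd ℝ ℂ ℂ ∘L P ∘L ContinuousLinearMap.fst ℝ _ ℂ) w v
  have hS1 : HasDerivAt (fun τ : ℝ => S (w + τ • v).1 (w + τ • v).1) (S v.1 w.1 + S w.1 v.1) 0 := by
    have a := hasDerivAt_clm_line (S ∘L ContinuousLinearMap.fst ℝ _ ℂ) w v
    have b := hasDerivAt_clm_line (ContinuousLinearMap.fst ℝ (ℂ × ℂ) ℂ) w v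
    have c := a.clm_apply b
    simpa using c
  have d0 : D 0 = 0 := (hc 0).unique (hasDerivAt_const _ _)
  have d1 : D 1 = (P v.1).1 := (hc 1).unique hP1
  have d2 : D 2 = (P v.1).2 := (hc 2).unique hP2
  have d3 : D 3 = conjInverse (lastCoeff t) (v.2 - t 3 1 * conj (P v.1).1 -
      t 3 2 * conj (P v.1).2 - (S v.1 w.1 + S w.1 v.1)) := by
    refine (hc 3).unique ?_
    have h2 : HasDerivAt (fun τ : ℝ => (w + τ • v).2) v.2 0 :=
      hasDerivAt_clm_line (ContinuousLinearMap.snd ℝ _ ℂ) w v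
    have h3 := ((h2.sub ((HasDerivAt.conj_comp hP1).const_mul (t 3 1))).sub
      ((HasDerivAt.conj_comp hP2).const_mul (t 3 2))).sub hS1
    exact (conjInverse (lastCoeff t)).hasFDerivAt.comp_hasDerivAt _ h3
  have hs : ‖lastCoeff t‖ < 1 := ht.norm_lastCoeff_le.trans_lt (by norm_num)
  have hinv := conjInverse_add hs (v.2 - t 3 1 * conj (P v.1).1 -
      t 3 2 * conj (P v.1).2 - (S v.1 w.1 + S w.1 v.1))
  rw [← d3] at hinv
  have z0 : fibreMap t P w 0 = 0 := rfl
  have z1 : fibreMap t P w 1 = (P w.1).1 := rfl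
  have z2 : fibreMap t P w 2 = (P w.1).2 := rfl
  refine ext_coord (y := deformedCoframe t (fibreMap t P w) D) ?_ ?_ ?_ ?_
  · rw [deformedCoframe_zero, d0, h01, h02]
    simp
  · rw [deformedCoframe_one, d0, d1, d2, z0]
    simpa using (hP v.1).1
  · rw [deformedCoframe_two, d0, d1, d2, z0]
    simpa using (hP v.1).2
  · rw [deformedCoframe_three, d0, d1, d2, z0, z1, z2]
    simp only [Matrix.cons_val, fibreForm_apply, fibreBracket_apply, detForm_apply, ← hS, map_zero,
      neg_zero, exp_zero, map_sub, map_mul]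
    linear_combination hinv

/-- For small parameters, the bracket on the fibre is close to the determinant, which is `1` on the
pair `y, w` and vanishes on `y, i y` and on `w, i w`. -/
theorem fibreBracket_pos (ht : IsSmall t) {s : ℂ} (hs : ‖s‖ ≤ 1 / 100) {P : ℂ × ℂ →L[ℝ] ℂ × ℂ}
    (hP : ∀ w, (P w).1 + t 1 1 * conj (P w).1 + t 1 2 * conj (P w).2 = w.1 ∧
      (P w).2 + t 2 1 * conj (P w).1 + t 2 2 * conj (P w).2 = w.2) (y w : ℂ × ℂ)
    (hy : y = (1, 0)) (hw : w = (0, 1)) :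
    0 < ‖fibreBracket s P y w‖ ^ 2 + ‖fibreBracket s P (I • y) (I • w)‖ ^ 2 +
      ‖fibreBracket s P y (I • w)‖ ^ 2 + ‖fibreBracket s P (I • y) w‖ ^ 2 -
      2 * (conj (fibreBracket s P y (I • y)) * fibreBracket s P w (I • w)).re := by
  have hb : ∀ j l (a : ℂ), ‖t j l * conj a‖ ≤ 1 / 100 * ‖a‖ := fun j l a => by
    rw [norm_mul, RCLike.norm_conj]
    exact mul_le_mul_of_nonneg_right (ht j l) (norm_nonneg _)
  have hn : ∀ u : ℂ × ℂ, ‖u‖ ≤ 1 → ‖(P u).1 - u.1‖ ≤ 1 / 40 ∧ ‖(P u).2 - u.2‖ ≤ 1 / 40 := by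
    intro u hu
    have e1 : (P u).1 - u.1 = -(t 1 1 * conj (P u).1 + t 1 2 * conj (P u).2) := by
      linear_combination (hP u).1
    have e2 : (P u).2 - u.2 = -(t 2 1 * conj (P u).1 + t 2 2 * conj (P u).2) := by
      linear_combination (hP u).2
    have n1 : ‖(P u).1 - u.1‖ ≤ 1 / 100 * ‖(P u).1‖ + 1 / 100 * ‖(P u).2‖ := by
      rw [e1, norm_neg]
      exact (norm_add_le _ _).trans (add_le_add (hb _ _ _) (hb _ _ _))
    have n2 : ‖(P u).2 - u.2‖ ≤ 1 / 100 * ‖(P u).1‖ + 1 / 100 * ‖(P u).2‖ := by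
      rw [e2, norm_neg]
      exact (norm_add_le _ _).trans (add_le_add (hb _ _ _) (hb _ _ _))
    have m1 : ‖(P u).1‖ ≤ ‖(P u).1 - u.1‖ + ‖u.1‖ := by
      simpa using norm_add_le ((P u).1 - u.1) u.1
    have m2 : ‖(P u).2‖ ≤ ‖(P u).2 - u.2‖ + ‖u.2‖ := by
      simpa using norm_add_le ((P u).2 - u.2) u.2
    have k1 := (norm_fst_le u).trans hu
    have k2 := (norm_snd_le u).trans hu
    constructor <;> linarith
  have hdet : ∀ u v : ℂ × ℂ, ‖u‖ ≤ 1 → ‖v‖ ≤ 1 → ‖u.1‖ + ‖u.2‖ + ‖v.1‖ + ‖v.2‖ ≤ 2 →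
      ‖detForm (P u) (P v) - detForm u v‖ ≤ 6 / 100 := by
    intro u v hu hv huv
    obtain ⟨a1, a2⟩ := hn u hu
    obtain ⟨b1, b2⟩ := hn v hv
    have e : detForm (P u) (P v) - detForm u v =
        (((P u).1 - u.1) * v.2 + u.1 * ((P v).2 - v.2) + ((P u).1 - u.1) * ((P v).2 - v.2)) -
        (((P u).2 - u.2) * v.1 + u.2 * ((P v).1 - v.1) + ((P u).2 - u.2) * ((P v).1 - v.1)) := by
      rw [detForm_apply, detForm_apply]
      ring
    have hm : ∀ a b : ℂ, ‖a‖ ≤ 1 / 40 → ‖a * b‖ ≤ 1 / 40 * ‖b‖ := fun a b ha => by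
      rw [norm_mul]
      exact mul_le_mul_of_nonneg_right ha (norm_nonneg _)
    have hm' : ∀ a b : ℂ, ‖b‖ ≤ 1 / 40 → ‖a * b‖ ≤ 1 / 40 * ‖a‖ := fun a b hb => by
      rw [mul_comm a b]
      exact hm b a hb
    rw [e]
    refine (norm_sub_le _ _).trans ((add_le_add norm_add₃_le norm_add₃_le).trans ?_)
    linarith [hm _ v.2 a1, hm' u.1 _ b2, hm _ ((P v).2 - v.2) a1, hm _ v.1 a2, hm' u.2 _ b1,
      hm _ ((P v).1 - v.1) a2]
  have hsc : ∀ d : ℂ, ‖s * conj d‖ ≤ 1 / 100 * ‖d‖ := fun d => by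
    rw [norm_mul, RCLike.norm_conj]
    exact mul_le_mul_of_nonneg_right hs (norm_nonneg _)
  have hlow : 1 / 2 ≤ ‖fibreBracket s P y w‖ := by
    have h1 := hdet y w (by simp [hy]) (by simp [hw]) (by simp [hy, hw]; norm_num)
    have h2 : detForm y w = 1 := by simp [hy, hw, detForm_apply]
    rw [h2] at h1
    set d := detForm (P y) (P w) with hd
    have h3 : ‖d‖ ≤ ‖d - 1‖ + 1 := by simpa using norm_add_le (d - 1) 1
    have h4 : (1 : ℝ) ≤ ‖fibreBracket s P y w‖ + ‖s * conj d‖ + ‖d - 1‖ := by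
      have e : (1 : ℂ) = fibreBracket s P y w - s * conj d - (d - 1) := by
        rw [fibreBracket_apply, ← hd]
        ring
      calc (1 : ℝ) = ‖fibreBracket s P y w - s * conj d - (d - 1)‖ := by rw [← e, norm_one]
        _ ≤ _ := (norm_sub_le _ _).trans (add_le_add (norm_sub_le _ _) le_rfl)
    linarith [hsc d]
  have hup : ∀ u : ℂ × ℂ, (u = y ∨ u = w) → ‖fibreBracket s P u (I • u)‖ ≤ 1 / 10 := by
    intro u hu
    have h1 : ‖detForm (P u) (P (I • u)) - detForm u (I • u)‖ ≤ 6 / 100 := by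
      rcases hu with rfl | rfl
      · exact hdet _ _ (by simp [hy]) (by simp [hy]) (by simp [hy]; norm_num)
      · exact hdet _ _ (by simp [hw]) (by simp [hw]) (by simp [hw]; norm_num)
    have h2 : detForm u (I • u) = 0 := by
      rw [detForm_apply, Prod.smul_fst, Prod.smul_snd, smul_eq_mul, smul_eq_mul]
      ring
    rw [h2, sub_zero] at h1
    rw [fibreBracket_apply]
    refine (norm_add_le _ _).trans ?_
    linarith [hsc (detForm (P u) (P (I • u)))]
  have h1 : (conj (fibreBracket s P y (I • y)) * fibreBracket s P w (I • w)).re ≤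
      1 / 10 * (1 / 10) := by
    refine (re_le_norm _).trans ?_
    rw [norm_mul, RCLike.norm_conj]
    exact mul_le_mul (hup _ (Or.inl rfl)) (hup _ (Or.inr rfl)) (norm_nonneg _) (by norm_num)
  nlinarith [sq_nonneg ‖fibreBracket s P (I • y) (I • w)‖, sq_nonneg ‖fibreBracket s P y (I • w)‖,
    sq_nonneg ‖fibreBracket s P (I • y) w‖]

theorem not_isSKT (hΓ : IsLattice Γ) (hchar : ∀ γ ∈ Γ, exp (γ 0 - conj (γ 0)) = 1)
    (ht : IsSmall t) (h01 : t 0 1 = 0) (h02 : t 0 2 = 0) (h : HermitianMetric Γ (deformedJ t)) :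
    ¬ h.IsSKT := by
  obtain ⟨P, hP⟩ := exists_inverse_add_conj ht
  have hs : lastCoeff t = -(t 1 1 * t 2 2) + t 1 2 * t 2 1 := by
    rw [lastCoeff, h01, h02]
    ring
  exact not_isSKT_of_holomorphicMap hΓ hchar ht (fibreForm_I_smul hs hP) (contDiff_fibreMap t P)
    (deformedCoframe_fderiv_fibreMap ht h01 h02 hP)
    (c := fun u v => fibreBracket (lastCoeff t) P u v) (fibreBracket_eq _ _) _ _
    (fibreBracket_pos ht ht.norm_lastCoeff_le hP _ _ rfl rfl) h

/-! ### Astheno-Kähler metrics -/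

namespace HermitianMetric

variable {J : SolvGroup → SolvGroup →L[ℝ] SolvGroup}

/-- The determinant `g(v, v) g(w, w) - g(J v, w)² - g(v, w)²` of the Hermitian Gram matrix of `v` and
`w`. -/
def gram (h : HermitianMetric Γ J) (z v w : SolvGroup) : ℝ :=
  h.g z v v * h.g z w w - h.g z (J z v) w ^ 2 - h.g z v w ^ 2

theorem g_apply_J (hJ : ∀ z v, J z (J z v) = -v) (h : HermitianMetric Γ J) (z v w : SolvGroup) :
    h.g z v (J z w) = -h.g z (J z v) w := by
  have h1 := h.compatible z (J z v) w
  rw [hJ] at h1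
  rw [← h1]
  simp

theorem g_J_self (hJ : ∀ z v, J z (J z v) = -v) (h : HermitianMetric Γ J) (z v : SolvGroup) :
    h.g z (J z v) v = 0 := by
  have h1 := h.g_apply_J hJ z v v
  rw [h.symm] at h1
  linarith

theorem wedge_fundamentalForm_apply (hJ : ∀ z v, J z (J z v) = -v) (h : HermitianMetric Γ J)
    (z v w : SolvGroup) :
    wedge (h.fundamentalForm z) (h.fundamentalForm z) ![v, J z v, w, J z w] =
      ((2 * h.gram z v w : ℝ) : ℂ) := by
  rw [wedge_two_two_apply]
  simp only [Matrix.cons_val, h.fundamentalForm_apply hJ, h.compatible, hJ, map_neg, neg_apply,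
    h.g_apply_J hJ, neg_neg]
  rw [gram]
  push_cast
  ring

/-- The Gram determinant of `λ v + μ w` and `w` is `|λ|²` times that of `v` and `w`. -/
theorem gram_combination (hJ : ∀ z v, J z (J z v) = -v) (h : HermitianMetric Γ J)
    (z v w : SolvGroup) (a b c d : ℝ) :
    h.gram z (a • v + b • J z v + (c • w + d • J z w)) w = (a ^ 2 + b ^ 2) * h.gram z v w := by
  have s1 := h.symm z w v
  simp only [gram, map_add, map_smul, add_apply, smul_apply, smul_eq_mul, hJ, map_neg, neg_apply,
    h.compatible, h.g_apply_J hJ, h.g_J_self hJ, s1]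
  have s3 : h.g z (J z w) v = -h.g z (J z v) w := by
    rw [h.symm, h.g_apply_J hJ]
  rw [s3]
  ring

theorem gram_pos (hJ : ∀ z v, J z (J z v) = -v) (h : HermitianMetric Γ J)
    {z v w : SolvGroup} (hw : w ≠ 0) (hv : ∀ a b : ℝ, v ≠ a • w + b • J z w) :
    0 < h.gram z v w := by
  have hq := h.pos z w hw
  set q := h.g z w w with hqd
  set r := h.g z v w with hr
  set s := h.g z (J z v) w with hs
  -- positivity of `h` on the component of `v` orthogonal to the complex line spanned by `w`
  have hW := h.pos z (v - ((r / q) • w + (-s / q) • J z w)) (sub_ne_zero.2 (hv _ _))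
  have s1 : h.g z w v = r := h.symm z w v
  have s2 : h.g z (J z w) v = -s := by
    rw [h.symm, h.g_apply_J hJ]
  simp only [map_add, map_sub, map_smul, add_apply, smul_apply, smul_eq_mul, sub_apply,
    h.compatible, h.g_apply_J hJ, h.g_J_self hJ, s1, s2, ← hqd, ← hr, ← hs] at hW
  rw [gram, ← hqd, ← hr, ← hs]
  have e := mul_pos hW hq
  have e2 : ∀ x : ℝ, x / q * q = x := fun x => div_mul_cancel₀ x hq.ne'
  refine e.trans_eq ?_
  field_simp
  ring

theorem contDiff_wedge_fundamentalForm (hJ : ∀ z v, J z (J z v) = -v) (hJs : ContDiff ℝ ∞ J)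
    (h : HermitianMetric Γ J) :
    ContDiff ℝ ∞ fun z => wedge (h.fundamentalForm z) (h.fundamentalForm z) := by
  have hω := h.contDiff_fundamentalForm hJ hJs
  refine contDiff_form_of_apply fun v => ?_
  simp only [wedge_two_two_apply]
  have h1 : ∀ a b, ContDiff ℝ ∞ fun z => h.fundamentalForm z ![a, b] :=
    fun a b => contDiff_form_apply hω _
  exact contDiff_const.mul ((((h1 _ _).mul (h1 _ _)).sub ((h1 _ _).mul (h1 _ _))).add
    ((h1 _ _).mul (h1 _ _)))

theorem isInvariant_wedge_fundamentalForm (hJ : ∀ z v, J z (J z v) = -v)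
    (hJi : ∀ γ ∈ Γ, ∀ z v, J (γ * z) (leftDiff γ z v) = leftDiff γ z (J z v))
    (h : HermitianMetric Γ J) :
    IsInvariant Γ fun z => wedge (h.fundamentalForm z) (h.fundamentalForm z) := by
  intro γ hγ z
  have h1 : ∀ a b, h.fundamentalForm (γ * z) ![leftDiff γ z a, leftDiff γ z b] =
      h.fundamentalForm z ![a, b] := fun a b => by
    rw [h.fundamentalForm_apply hJ, h.fundamentalForm_apply hJ, hJi γ hγ, h.invariant γ hγ]
  ext v
  rw [ContinuousAlternatingMap.compContinuousLinearMap_apply, wedge_two_two_apply,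
    wedge_two_two_apply]
  simp only [Function.comp_apply, h1]

end HermitianMetric

/-- The Gram determinant of the last two vectors of the deformed frame is bounded below and above. -/
theorem HermitianMetric.exists_gram_bounds (hΓ : IsLattice Γ)
    (hchar : ∀ γ ∈ Γ, exp (γ 0 - conj (γ 0)) = 1) (ht : IsSmall t)
    (h : HermitianMetric Γ (deformedJ t)) :
    ∃ c C : ℝ, 0 < c ∧ ∀ z,
      c ≤ h.gram z (deformedFrame t z ![0, 0, 1, 0]) (deformedFrame t z ![0, 0, 0, 1]) ∧
      h.gram z (deformedFrame t z ![0, 0, 1, 0]) (deformedFrame t z ![0, 0, 0, 1]) ≤ C := by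
  have hJ := deformedJ_deformedJ ht
  have hs : ∀ u, ContDiff ℝ ∞ fun z => deformedFrame t z u := fun u =>
    (contDiff_deformedFrame ht).clm_apply contDiff_const
  have hg : ∀ {A B : SolvGroup → SolvGroup}, ContDiff ℝ ∞ A → ContDiff ℝ ∞ B →
      Continuous fun z => h.g z (A z) (B z) := fun hA hB =>
    ((h.smooth.clm_apply hA).clm_apply hB).continuous
  refine exists_bounds_of_invariant_of_pos hΓ ?_ (fun γ hγ z => ?_) (fun z => ?_)
  · unfold gram
    exact (((hg (hs _) (hs _)).mul (hg (hs _) (hs _))).sub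
      ((hg ((contDiff_deformedJ ht).clm_apply (hs _)) (hs _)).pow 2)).sub
      ((hg (hs _) (hs _)).pow 2)
  · rw [deformedFrame_mul_left ht (hchar γ hγ)]
    simp only [gram, ContinuousLinearMap.comp_apply, deformedJ_leftDiff ht (hchar γ hγ),
      h.invariant γ hγ]
  · refine h.gram_pos hJ (fun h0 => ?_) (fun a b h0 => ?_)
    · have h1 := congrArg (deformedCoframe t z) h0
      rw [deformedCoframe_deformedFrame ht, map_zero] at h1
      exact one_ne_zero (congrFun h1 3)
    · have h1 := congrArg (deformedCoframe t z) h0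
      rw [map_add, map_smul, map_smul, deformedCoframe_deformedJ ht,
        deformedCoframe_deformedFrame ht, deformedCoframe_deformedFrame ht] at h1
      have h2 := congrFun h1 2
      simp at h2

/-- `2 Re z_1`, as a real-linear function of `z_1 + s conj z_1`. -/
def leafExponent (s : ℂ) : ℂ →L[ℝ] ℝ := (2 : ℝ) • reCLM ∘L conjInverse s

theorem leafExponent_apply (s x : ℂ) : leafExponent s x = 2 * (conjInverse s x).re := rfl

theorem leafExponent_pos {s : ℂ} (hs : ‖s‖ < 1) :
    0 < leafExponent s 1 ^ 2 + leafExponent s I ^ 2 := by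
  have h1 : leafExponent s 1 = 2 * ((1 - ‖s‖ ^ 2)⁻¹ * (1 - s.re)) := by
    have h0 : conjInverse s 1 = ((1 - ‖s‖ ^ 2)⁻¹ : ℝ) • (1 - s) := by
      simp [conjInverse]
    rw [leafExponent_apply, h0, smul_re, sub_re, one_re, smul_eq_mul]
  have h2 : 0 < 1 - ‖s‖ ^ 2 := by nlinarith [norm_nonneg s]
  have h3 : 0 < 1 - s.re := by linarith [re_le_norm s]
  have h4 : 0 < leafExponent s 1 := by
    rw [h1]
    positivity
  positivity

/-- If there is a holomorphic map from `ℂ × ℂ²` to `(G, J_t)` along which the deformed coframe is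
`(dx, a dx, e^{-z_1} dy_1 + b dx, dy_2 - ρ(x) dy_1)`, then there is no astheno-Kähler metric. -/
theorem not_isAsthenoKahler_of_holomorphicMap (hΓ : IsLattice Γ)
    (hchar : ∀ γ ∈ Γ, exp (γ 0 - conj (γ 0)) = 1) (ht : IsSmall t)
    {f : ℂ × ℂ × ℂ → SolvGroup} (hf : ContDiff ℝ ∞ f) {s : ℂ} (hs : ‖s‖ < 1) (a b : ℂ)
    {ρ : ℂ → ℂ} (hρ : Continuous ρ)
    (hfθ : ∀ w v, deformedCoframe t (f w) (fderiv ℝ f w v) =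
      ![v.1, a * v.1, exp (-conjInverse s w.1) * v.2.1 + b * v.1, v.2.2 - ρ w.1 * v.2.1])
    (h : HermitianMetric Γ (deformedJ t)) : ¬ h.IsAsthenoKahler := by
  intro hak
  have hJ := deformedJ_deformedJ ht
  have hJs := contDiff_deformedJ ht
  have hol : IsHolomorphicMap (deformedJ t) f := fun w v => by
    rw [deformedJ_eq_iff ht, hfθ, hfθ]
    simp only [Matrix.smul_cons, smul_eq_mul, Prod.smul_fst, Prod.smul_snd, Matrix.smul_empty,
      mul_add, mul_sub, mul_left_comm]
  have hJi : ∀ γ ∈ Γ, ∀ z v,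
      deformedJ t (γ * z) (leftDiff γ z v) = leftDiff γ z (deformedJ t z v) := fun γ hγ z v => deformedJ_leftDiff ht (hchar γ hγ) z v
  have hω := h.contDiff_wedge_fundamentalForm hJ hJs
  have hωi := h.isInvariant_wedge_fundamentalForm hJ hJi
  have hη := contDiff_pullbackForm hf hω
  have hw : ∀ x, HasWeight (mulI _) 0 (pullbackForm f
      (fun z => wedge (h.fundamentalForm z) (h.fundamentalForm z)) x) :=
    hasWeight_pullbackForm hol fun z => hasWeight_wedge (hasWeight_zero_of_invariant (hJ z)
      fun v w => by rw [h.fundamentalForm_apply hJ, h.fundamentalForm_apply hJ, h.compatible])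
  have hdd := alternatization_snd_deriv_eq_zero (J := mulI (ℂ × ℂ × ℂ)) mulI_mulI hη hw 2
    (fun x => by
      rw [del_delBar_pullbackForm hf hol hJs hω, pullbackForm, hak]
      rfl)
  obtain ⟨C, hC⟩ := hωi.exists_bound hΓ hchar ht hω
  obtain ⟨c, C', hc, hcC⟩ := h.exists_gram_bounds hΓ hchar ht
  have hval : ∀ x y, pullbackForm f (fun z => wedge (h.fundamentalForm z) (h.fundamentalForm z))
      (x, y) ![(0, 1, 0), (0, I, 0), (0, 0, 1), (0, 0, I)] =
      ((2 * (Real.exp (-leafExponent s x) * h.gram (f (x, y))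
        (deformedFrame t (f (x, y)) ![0, 0, 1, 0]) (deformedFrame t (f (x, y)) ![0, 0, 0, 1])) :
        ℝ) : ℂ) := by
    intro x y
    set z := f (x, y) with hz
    set A := fderiv ℝ f (x, y) ((0, 1, 0) : ℂ × ℂ × ℂ) with hA
    set B := fderiv ℝ f (x, y) ((0, 0, 1) : ℂ × ℂ × ℂ) with hB
    have eA : deformedJ t z A = fderiv ℝ f (x, y) ((0, I, 0) : ℂ × ℂ × ℂ) := by
      rw [hol]
      simp
    have eB : deformedJ t z B = fderiv ℝ f (x, y) ((0, 0, I) : ℂ × ℂ × ℂ) := by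
      rw [hol]
      simp
    have hB' : deformedFrame t z ![0, 0, 0, 1] = B := by
      rw [← deformedFrame_deformedCoframe ht z B, hB, hfθ]
      simp
    set e := exp (-conjInverse s x) with he
    set E := deformedFrame t z ![0, 0, 1, 0] with hE
    have hA' : A = e.re • E + e.im • deformedJ t z E +
        ((-ρ x).re • B + (-ρ x).im • deformedJ t z B) := by
      apply deformedCoframe_injective ht z
      have hBθ : deformedCoframe t z B = ![0, 0, 0, 1] := by
        rw [← hB', deformedCoframe_deformedFrame ht]
      simp only [map_add, map_smul, deformedCoframe_deformedJ ht, hBθ, hE,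
        deformedCoframe_deformedFrame ht]
      rw [hA, hfθ]
      have hre : ∀ c : ℂ, (c.re : ℂ) + c.im * I = c := re_add_im
      funext j
      fin_cases j
      · simp
      · simp
      · simp [he]
      · simpa using (hre (-ρ x)).symm
    have hn : e.re ^ 2 + e.im ^ 2 = Real.exp (-leafExponent s x) := by
      have h1 : e.re ^ 2 + e.im ^ 2 = ‖e‖ ^ 2 := by
        rw [← normSq_eq_norm_sq, normSq_apply]
        ring
      rw [h1, he, norm_exp, ← Real.exp_nat_mul, leafExponent_apply, neg_re]
      congr 1
      push_cast
      ring
    have hp : pullbackForm f (fun z => wedge (h.fundamentalForm z) (h.fundamentalForm z))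
        (x, y) ![(0, 1, 0), (0, I, 0), (0, 0, 1), (0, 0, I)] =
        wedge (h.fundamentalForm z) (h.fundamentalForm z)
          ![A, deformedJ t z A, B, deformedJ t z B] := by
      rw [eA, eB, pullbackForm, ContinuousAlternatingMap.compContinuousLinearMap_apply]
      congr 1
      funext i
      fin_cases i <;> rfl
    rw [hp, h.wedge_fundamentalForm_apply hJ, hB', hA', h.gram_combination hJ, hn]
  refine false_of_alternatization_eq_zero hη hdd (fun p R => ?_) (leafExponent s)
    (leafExponent_pos hs) (c := 2 * c) (C := 2 * C') (by positivity) (fun x y => ?_) (fun x y => ?_)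
  · have hN : Continuous (conjInverse s) := (conjInverse s).continuous
    have hu : Continuous fun x : ℂ => C * ∏ i, ‖(![(p i).1, a * (p i).1,
        exp (-conjInverse s x) * (p i).2.1 + b * (p i).1, (p i).2.2 - ρ x * (p i).2.1] :
        Fin 4 → ℂ)‖ := by
      refine continuous_const.mul (continuous_finsetProd _ fun i _ => Continuous.norm ?_)
      refine continuous_pi fun j => ?_
      fin_cases j
      · exact continuous_const
      · exact continuous_const
      · exact ((continuous_exp.comp hN.neg).mul continuous_const).add continuous_const
      · exact continuous_const.sub (hρ.mul continuous_const)
    obtain ⟨M, hM⟩ := (isCompact_closedBall (0 : ℂ) R).exists_bound_of_continuousOn hu.continuousOn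
    refine ⟨M, fun x y hx => ?_⟩
    exact (norm_pullbackForm_le hC (x, y) p fun i => hfθ (x, y) (p i)).trans
      ((le_abs_self _).trans (hM x (by simpa using hx)))
  · rw [hval, ofReal_re, mul_assoc, mul_comm c]
    exact mul_le_mul_of_nonneg_left (mul_le_mul_of_nonneg_left (hcC _).1 (Real.exp_pos _).le)
      (by norm_num)
  · rw [hval, ofReal_re, mul_assoc, mul_comm C']
    exact mul_le_mul_of_nonneg_left (mul_le_mul_of_nonneg_left (hcC _).2 (Real.exp_pos _).le)
      (by norm_num)

/-! ### A holomorphic leaf -/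

/-- The first coordinate of the leaf `leafMap`. -/
def leafFst (t : Param) (x : ℂ) : ℂ := conjInverse (t 0 0) x

/-- The second coordinate of the leaf `leafMap`. -/
def leafSnd (t : Param) (x : ℂ) : ℂ :=
  conjInverse (t 1 1) (-(t 1 0 / t 0 0) * exp (-leafFst t x))

/-- The third coordinate of the leaf `leafMap`. -/
def leafThird (t : Param) (x y : ℂ) : ℂ :=
  conjInverse (t 2 2) (y + t 2 0 / t 0 0 * exp (leafFst t x))

/-- The correction term in the last coordinate of the leaf `leafMap`, as a function of the parameter
`y = w_2` and of the first three coordinates. -/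
def leafCorrection (t : Param) (y z₀ z₁ z₂ : ℂ) : ℂ :=
  1 / 2 * (z₁ * z₂) + t 1 1 * (conj z₁ * z₂) + 1 / 2 * t 1 1 * t 2 2 * (conj z₁ * conj z₂) -
    t 1 1 * (y * conj z₁) + t 3 0 * conj z₀ + t 1 0 / t 0 0 * (t 2 0 / t 0 0) * z₀

/-- The parametrisation of a holomorphic leaf transverse to the second coordinate. Here
`a = t_{21} / t_{11}`, `b = t_{31} / t_{11}`, and `z_1, z_2, z_3, z_4` are determined by
`z_1 + t_{11} conj z_1 = w_1`, `z_2 + t_{22} conj z_2 = -a e^{-z_1}`,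
`z_3 + t_{33} conj z_3 = w_2 + b e^{z_1}`, and an equation for `z_4` for which
`φ_t^4 = dw_3 - z_2 dw_2` on the leaf. -/
def leafMap (t : Param) (w : ℂ × ℂ × ℂ) : SolvGroup :=
  ![leafFst t w.1, leafSnd t w.1, leafThird t w.1 w.2.1, conjInverse (lastCoeff t)
    (w.2.2 - leafCorrection t w.2.1 (leafFst t w.1) (leafSnd t w.1) (leafThird t w.1 w.2.1))]

theorem contDiff_leafMap (t : Param) : ContDiff ℝ ∞ (leafMap t) := by
  have h0 : ContDiff ℝ ∞ fun w : ℂ × ℂ × ℂ => leafFst t w.1 := by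
    unfold leafFst
    fun_prop
  have h1 : ContDiff ℝ ∞ fun w : ℂ × ℂ × ℂ => leafSnd t w.1 := by
    have := h0.neg.cexp
    unfold leafSnd
    fun_prop
  have h2 : ContDiff ℝ ∞ fun w : ℂ × ℂ × ℂ => leafThird t w.1 w.2.1 := by
    have := h0.cexp
    unfold leafThird
    fun_prop
  have c : ∀ {F : ℂ × ℂ × ℂ → ℂ}, ContDiff ℝ ∞ F → ContDiff ℝ ∞ fun w => conj (F w) := fun hF =>
    (conjCLE : ℂ →L[ℝ] ℂ).contDiff.comp hF
  have c0 := c h0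
  have c1 := c h1
  have c2 := c h2
  refine contDiff_pi.2 fun i => ?_
  fin_cases i
  · exact h0
  · exact h1
  · exact h2
  · refine (conjInverse (lastCoeff t)).contDiff.comp ?_
    unfold leafCorrection
    fun_prop

theorem deformedCoframe_fderiv_leafMap (ht : IsSmall t) (hclass : DeformationClass 0 t)
    (w v : ℂ × ℂ × ℂ) :
    deformedCoframe t (leafMap t w) (fderiv ℝ (leafMap t) w v) =
      ![v.1, t 1 0 / t 0 0 * v.1, exp (-conjInverse (t 0 0) w.1) * v.2.1 + t 2 0 / t 0 0 * v.1,
        v.2.2 - leafSnd t w.1 * v.2.1] := by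
  obtain ⟨h00, h01, h02, h21, h12, h31, h32⟩ : t 0 0 ≠ 0 ∧ t 0 1 = 0 ∧ t 0 2 = 0 ∧ t 2 1 = 0 ∧
      t 1 2 = 0 ∧ t 0 0 * t 3 1 = t 2 0 * t 1 1 ∧ t 0 0 * t 3 2 = t 1 0 * t 2 2 := hclass
  have hlt : ∀ j l, ‖t j l‖ < 1 := fun j l => (ht j l).trans_lt (by norm_num)
  have hs : ‖lastCoeff t‖ < 1 := ht.norm_lastCoeff_le.trans_lt (by norm_num)
  have hsv : lastCoeff t = -(t 1 1 * t 2 2) := by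
    rw [lastCoeff, h01, h02, h12]
    ring
  set a := t 1 0 / t 0 0 with ha
  set b := t 2 0 / t 0 0 with hb
  have e10 : t 1 0 = a * t 0 0 := by rw [ha]; field_simp
  have e20 : t 2 0 = b * t 0 0 := by rw [hb]; field_simp
  have e31 : t 3 1 = b * t 1 1 := by rw [hb]; field_simp; linear_combination h31
  have e32 : t 3 2 = a * t 2 2 := by rw [ha]; field_simp; linear_combination h32
  have hc := hasDerivAt_line_coord (contDiff_leafMap t) w v
  set D := fderiv ℝ (leafMap t) w v with hD
  have hcc := fun i => HasDerivAt.conj_comp (hc i)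
  have hw0 : HasDerivAt (fun τ : ℝ => (w + τ • v).1) v.1 0 :=
    hasDerivAt_clm_line (ContinuousLinearMap.fst ℝ ℂ (ℂ × ℂ)) w v
  have hw1 : HasDerivAt (fun τ : ℝ => (w + τ • v).2.1) v.2.1 0 :=
    hasDerivAt_clm_line (ContinuousLinearMap.fst ℝ ℂ ℂ ∘L ContinuousLinearMap.snd ℝ ℂ (ℂ × ℂ)) w v
  have hw2 : HasDerivAt (fun τ : ℝ => (w + τ • v).2.2) v.2.2 0 :=
    hasDerivAt_clm_line (ContinuousLinearMap.snd ℝ ℂ ℂ ∘L ContinuousLinearMap.snd ℝ ℂ (ℂ × ℂ)) w v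
  have r0 : ∀ w, leafMap t w 0 + t 0 0 * conj (leafMap t w 0) = w.1 :=
    fun w => conjInverse_add (hlt 0 0) _
  have r1 : ∀ w, leafMap t w 1 + t 1 1 * conj (leafMap t w 1) = -a * exp (-leafMap t w 0) :=
    fun w => conjInverse_add (hlt 1 1) _
  have r2 : ∀ w, leafMap t w 2 + t 2 2 * conj (leafMap t w 2) = w.2.1 + b * exp (leafMap t w 0) :=
    fun w => conjInverse_add (hlt 2 2) _
  have r3 : ∀ w, leafMap t w 3 + lastCoeff t * conj (leafMap t w 3) = w.2.2 -
      leafCorrection t w.2.1 (leafMap t w 0) (leafMap t w 1) (leafMap t w 2) :=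
    fun w => conjInverse_add hs _
  have hz : ∀ i, leafMap t (w + (0 : ℝ) • v) i = leafMap t w i := fun i => by
    rw [zero_smul, add_zero]
  have hwz : w + (0 : ℝ) • v = w := by rw [zero_smul, add_zero]
  have d0 : D 0 + t 0 0 * conj (D 0) = v.1 := by
    have h1 := (hc 0).fun_add ((hcc 0).const_mul (t 0 0))
    simp only [r0] at h1
    exact h1.unique hw0
  have d1 : D 1 + t 1 1 * conj (D 1) = a * exp (-leafMap t w 0) * D 0 := by
    have h1 := (hc 1).fun_add ((hcc 1).const_mul (t 1 1))
    simp only [r1] at h1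
    have h2 := ((hc 0).fun_neg.cexp).const_mul (-a)
    rw [hz] at h2
    rw [h1.unique h2]
    ring
  have d2 : D 2 + t 2 2 * conj (D 2) = v.2.1 + b * exp (leafMap t w 0) * D 0 := by
    have h1 := (hc 2).fun_add ((hcc 2).const_mul (t 2 2))
    simp only [r2] at h1
    have h2 := hw1.fun_add (((hc 0).cexp).const_mul b)
    rw [hz] at h2
    rw [h1.unique h2]
    ring
  set z := leafMap t w with hzd
  have d3 : D 3 + lastCoeff t * conj (D 3) = v.2.2 -
      (1 / 2 * (D 1 * z 2 + z 1 * D 2) + t 1 1 * (conj (D 1) * z 2 + conj (z 1) * D 2) +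
        1 / 2 * t 1 1 * t 2 2 * (conj (D 1) * conj (z 2) + conj (z 1) * conj (D 2)) -
        t 1 1 * (v.2.1 * conj (z 1) + w.2.1 * conj (D 1)) + t 3 0 * conj (D 0) + a * b * D 0) := by
    have h1 := (hc 3).fun_add ((hcc 3).const_mul (lastCoeff t))
    simp only [r3] at h1
    have h2 := hw2.fun_sub (((((((hc 1).fun_mul (hc 2)).const_mul (1 / 2)).fun_add
      (((hcc 1).fun_mul (hc 2)).const_mul (t 1 1))).fun_add
      (((hcc 1).fun_mul (hcc 2)).const_mul (1 / 2 * t 1 1 * t 2 2))).fun_sub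
      ((hw1.fun_mul (hcc 1)).const_mul (t 1 1))).fun_add ((hcc 0).const_mul (t 3 0)) |>.fun_add
      ((hc 0).const_mul (a * b)))
    simp only [hwz, ← hzd] at h2
    exact h1.unique h2
  have hee : exp (z 0) * exp (-z 0) = 1 := by rw [← exp_add, add_neg_cancel, exp_zero]
  have q1 := r1 w
  have q2 := r2 w
  rw [← hzd] at q1 q2
  have hz0 : conjInverse (t 0 0) w.1 = z 0 := rfl
  have hz1 : leafSnd t w.1 = z 1 := rfl
  rw [hz0, hz1]
  refine ext_coord (y := deformedCoframe t z D) ?_ ?_ ?_ ?_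
  · rw [deformedCoframe_zero, h01, h02]
    simpa using d0
  · rw [deformedCoframe_one, h12, e10]
    simp only [Matrix.cons_val]
    linear_combination exp (z 0) * d1 + a * d0 + a * D 0 * hee
  · rw [deformedCoframe_two, h21, e20]
    simp only [Matrix.cons_val]
    linear_combination exp (-z 0) * d2 + b * d0 + b * D 0 * hee
  · rw [deformedCoframe_three, e31, e32]
    simp only [Matrix.cons_val]
    rw [hsv] at d3 ⊢
    linear_combination d3 - t 1 1 * conj (D 1) * q2 - (D 2 - v.2.1) * q1 + a * exp (-z 0) * d2 +
      a * b * D 0 * hee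

theorem not_isAsthenoKahler (hΓ : IsLattice Γ) (hchar : ∀ γ ∈ Γ, exp (γ 0 - conj (γ 0)) = 1)
    (ht : IsSmall t) (hclass : DeformationClass 0 t) (h : HermitianMetric Γ (deformedJ t)) :
    ¬ h.IsAsthenoKahler := by
  have hρ : Continuous (leafSnd t) := by
    unfold leafSnd leafFst
    fun_prop
  exact not_isAsthenoKahler_of_holomorphicMap hΓ hchar ht (contDiff_leafMap t)
    ((ht 0 0).trans_lt (by norm_num)) _ _ hρ (deformedCoframe_fderiv_leafMap ht hclass) h

end SolvGroup

end

theorem theorem1p3 (Γ : Subgroup SolvGroup) (hΓ : SolvGroup.IsLattice Γ)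
    (hchar : ∀ γ ∈ Γ, Complex.exp (γ 0 - (starRingEnd ℂ) (γ 0)) = 1) :
    (∀ t : SolvGroup.Param,
      SolvGroup.KuranishiEquations t ↔ ∃! c : Fin 4, SolvGroup.DeformationClass c t) ∧
    ∃ ε : ℝ, 0 < ε ∧ ∀ t : SolvGroup.Param, ‖t‖ < ε →
      (SolvGroup.IsComplexStructure Γ (SolvGroup.deformedJ t) ↔
        SolvGroup.KuranishiEquations t) ∧
      (SolvGroup.DeformationClass 0 t ∨ SolvGroup.DeformationClass 1 t →
        ¬ ∃ h : SolvGroup.HermitianMetric Γ (SolvGroup.deformedJ t), h.IsSKT) ∧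
      (SolvGroup.DeformationClass 0 t →
        ¬ ∃ h : SolvGroup.HermitianMetric Γ (SolvGroup.deformedJ t), h.IsAsthenoKahler) := by
  refine ⟨SolvGroup.kuranishiEquations_iff_existsUnique, 1 / 100, by norm_num, fun t ht => ?_⟩
  have hs : SolvGroup.IsSmall t := fun j l =>
    ((norm_le_pi_norm (t j) l).trans (norm_le_pi_norm t j)).trans ht.le
  refine ⟨SolvGroup.isComplexStructure_deformedJ_iff Γ hchar hs, ?_, ?_⟩
  · rintro hc ⟨h, hskt⟩
    have h0 : t 0 1 = 0 ∧ t 0 2 = 0 := by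
      rcases hc with ⟨-, h1, h2, -⟩ | ⟨-, h1, h2, -⟩ <;> exact ⟨h1, h2⟩
    exact SolvGroup.not_isSKT hΓ hchar hs h0.1 h0.2 h hskt
  · rintro hc ⟨h, hak⟩
    exact SolvGroup.not_isAsthenoKahler hΓ hchar hs hc h hak
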